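/- **Vertex weights.** Fix integers $I,J\ge 1$. For $q>0$, $\alpha\ne -1$ and $\nu=q^{-I}$ define, for $m\in\{0,\dots,I\}$, $$L^{(1)}_\alpha(m,0;m,0)=\tfrac{1+\alpha q^m}{1+\alpha},\quad L^{(1)}_\alpha(m,0;m-1,1)=\tfrac{\alpha(1-q^m)}{1+\alpha},\quad L^{(1)}_\alpha(m,1;m,1)=\tfrac{\alpha+\nu q^m}{1+\alpha},\quad L^{(1)}_\alpha(m,1;m+1,0)=\tfrac{1-\nu q^m}{1+\alpha},$$ all other entries being $0$. The vertex weight with horizontal spin $J/2$ is given by fusion: for $v,v'\in\{0,\dots,I\}$ and $h,h'\in\{0,\dots,J\}$, $$L^{(J)}_\alpha(v,h;v',h')=\sum_{\substack{e\in\{0,1\}^J\\ \sum e_i=h}}\ \sum_{\substack{e'\in\{0,1\}^J\\ \sum e'_i=h'}}\frac{\prod_{i:e_i=1}q^{i-1}}{Z_J(h)}\sum_{\substack{v_0,\dots,v_J\in\{0,\dots,I\}\\ v_0=v,\ v_J=v'}}\ \prod_{i=1}^J L^{(1)}_{\alpha q^{i-1}}(v_{i-1},e_i;v_i,e'_i),\qquad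 Z_J(h)=\sum_{\substack{e\in\{0,1\}^J\\ \sum e_i=h}}\ \prod_{i:e_i=1}q^{i-1}.$$ **Model.** The stochastic higher spin six vertex model with parameters $q,\alpha$ is a random family $v_{x,y}\in\{0,\dots,I\}$, $h_{x,y}\in\{0,\dots,J\}$ $(x,y\in\mathbb Z_{\ge0})$, the numbers of lines entering the vertex $(x,y)$ from below and from the left. The boundary values $(v_{x,0})_x,(h_{0,y})_y$ are deterministic or random with any joint law. The vertices are then sampled sequentially in the order $(0,0),(1,0),(0,1),(2,0),(1,1),(0,2),\dots$: conditionally on the boundary and on the outputs of all previously sampled vertices, the outputs $(v_{x,y+1},h_{x+1,y})$ of $(x,y)$ have law $L^{(J)}_\alpha(v_{x,y},h_{x,y};\cdot,\cdot)$. The height function is $H(x,y)=\sum_{j=1}^{y}h_{0,j-1}-\sum_{i=1}^{x}v_{i-1,y}$ for integers $x,y\ge0$, extended to real $x,y\ge0$ by linear interpolation first in $x$, then in $y$. **Theorem 1.6.** Let $\beta_1\ne\beta_2$ be positive, $\mathfrak q=e^{\beta_1-\beta_2}$ and $A,B>0$. Let $L\to\infty$ (along a sequence or a continuous family), and for each $L$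 consider the model with $q=q_L$, $\alpha=\alpha_L$ given by $$q=e^{(\beta_1-\beta_2)/L},\qquad \frac{1+\alpha q^J}{1+\alpha}=e^{-J\beta_2/L}.$$ Let $\chi$ on $[0,A]$ and $\psi$ on $[0,B]$ be monotone Lipschitz functions, and suppose that $\frac1L H(Lx,0)\to\chi(x)$ uniformly on $[0,A]$ in probability and $\frac1L H(0,Ly)\to\psi(y)$ uniformly on $[0,B]$ in probability. Then there is a function $\mathbf h$ such that $$\sup_{(x,y)\in[0,A]\times[0,B]}\Big|\tfrac1L H(Lx,Ly)-\mathbf h(x,y)\Big|\to0\quad\text{in probability as }L\to\infty,$$ and $u=\mathfrak q^{\mathbf h}$ is, on $[0,A]\times[0,B]$, the unique continuous solution of the telegraph equation $$\frac{\partial^2u}{\partial x\,\partial y}+J\beta_2\frac{\partial u}{\partial x}+I\beta_1\frac{\partial u}{\partial y}=0,\qquad u(x,0)=\mathfrak q^{\chi(x)},\quad u(0,y)=\mathfrak q^{\psi(y)}.$$ Since the boundary data are only Lipschitz, the equation is understood in integrated form: for all $(X,Y)\in[0,A]\times[0,B]$, $$u(X,Y)-u(X,0)-u(0,Y)+u(0,0)+J\beta_2\int_0^Y\big(u(X,y)-u(0,y)\big)dy+I\beta_1\int_0^X\big(u(x,Y)-u(x,0)\big)dx=0.$$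 Moreover, the equation holds pointwise, with all the derivatives in it existing, at each $(x,y)\in(0,A)\times(0,B)$ such that $\chi$ is differentiable at $x$ and $\psi$ is differentiable at $y$. -/

import Mathlib

open MeasureTheory Filter Topology Set
open scoped ENNReal

noncomputable section

namespace SHS6V

/-! ### Vertex weights -/

/-- The weights with horizontal spin `1/2` and spectral parameter `α`, where `ν = q ^ (-I)`.
The arguments are `(i₁, j₁; i₂, j₂)`: lines entering from below and from the left, lines
leaving upwards and to the right. -/
def LOne (I : ℕ) (q α : ℝ) (i₁ j₁ i₂ j₂ : ℕ) : ℝ :=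
  match j₁, j₂ with
  | 0, 0 => if i₂ = i₁ then (1 + α * q ^ i₁) / (1 + α) else 0
  | 0, 1 => if i₂ + 1 = i₁ then α * (1 - q ^ i₁) / (1 + α) else 0
  | 1, 1 => if i₂ = i₁ then (α + (q ^ I)⁻¹ * q ^ i₁) / (1 + α) else 0
  | 1, 0 => if i₂ = i₁ + 1 then (1 - (q ^ I)⁻¹ * q ^ i₁) / (1 + α) else 0
  | _, _ => 0

/-- The total number of lines in a column of `J` edges carrying at most one line each. -/
def total {J : ℕ} (e : Fin J → Fin 2) : ℕ := ∑ i, (e i : ℕ)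

/-- The product of `q ^ (i - 1)` over the occupied edges `i ∈ {1, …, J}`
(`Fin J` counts from `0`). -/
def occupiedWeight {J : ℕ} (q : ℝ) (e : Fin J → Fin 2) : ℝ :=
  ∏ i, if e i = 1 then q ^ (i : ℕ) else 1

/-- The normalizing constant `Z_J(h)`. -/
def partitionZ (J : ℕ) (q : ℝ) (h : ℕ) : ℝ :=
  ∑ e : Fin J → Fin 2, if total e = h then occupiedWeight q e else 0

/-- The matrix `Λ`, which splits `h` lines over a column of `J` edges. -/
def Lam (J : ℕ) (q : ℝ) (h : ℕ) (e : Fin J → Fin 2) : ℝ :=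
  if total e = h then occupiedWeight q e / partitionZ J q h else 0

/-- The matrix `Ξ`, which forgets the positions of the lines in a column. -/
def Xi {J : ℕ} (e : Fin J → Fin 2) (h : ℕ) : ℝ := if total e = h then 1 else 0

/-- The weight of a column of `J` vertices of horizontal spin `1/2`, with spectral parameters
`α, α q, …, α q ^ (J - 1)` from bottom to top. -/
def LColumn (I J : ℕ) (q α : ℝ) (v : Fin (I + 1)) (e : Fin J → Fin 2)
    (v' : Fin (I + 1)) (e' : Fin J → Fin 2) : ℝ :=
  ∑ w : Fin (J + 1) → Fin (I + 1),
    if w 0 = v ∧ w (Fin.last J) = v' then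
      ∏ i : Fin J, LOne I q (α * q ^ (i : ℕ)) (w i.castSucc) (e i) (w i.succ) (e' i)
    else 0

/-- The fused vertex weight `L_α^{(J)}(v, h; v', h')`, of vertical spin `I/2` and horizontal
spin `J/2`. -/
def LFused (I J : ℕ) (q α : ℝ) (v : Fin (I + 1)) (h : Fin (J + 1))
    (v' : Fin (I + 1)) (h' : Fin (J + 1)) : ℝ :=
  ∑ e : Fin J → Fin 2, ∑ e' : Fin J → Fin 2,
    Lam J q h e * LColumn I J q α v e v' e' * Xi e' h'

/-! ### The model -/

section Model

variable {I J : ℕ} {Ω : Type*}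

/-- `Precedes a b x y`: in the sequential sampling along antidiagonals
`(0,0) → (1,0) → (0,1) → (2,0) → (1,1) → (0,2) → …`, the vertex `(a, b)` is sampled before
the vertex `(x, y)`. -/
def Precedes (a b x y : ℕ) : Prop := a + b < x + y ∨ (a + b = x + y ∧ b < y)

/-- The information available when the vertex `(x, y)` is sampled: the boundary edges and the
output edges of all the vertices sampled before. -/
abbrev past (v : ℕ → ℕ → Ω → Fin (I + 1)) (h : ℕ → ℕ → Ω → Fin (J + 1)) (x y : ℕ) :
    MeasurableSpace Ω :=
  (⨆ a : ℕ, MeasurableSpace.comap (v a 0) ⊤) ⊔ (⨆ b : ℕ, MeasurableSpace.comap (h 0 b) ⊤) ⊔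
    ⨆ (a : ℕ) (b : ℕ) (_ : Precedes a b x y),
      MeasurableSpace.comap (v a (b + 1)) ⊤ ⊔ MeasurableSpace.comap (h (a + 1) b) ⊤

/-- The family `(v x y, h x y)` is the stochastic higher spin six vertex model on the quadrant
with parameters `q, α`. Here `v x y` and `h x y` are the numbers of lines that enter the vertex
`(x, y)` from below and from the left. The boundary edges `v x 0`, `h 0 y` may be random with any
joint law. Given the past, the outputs `(v x (y + 1), h (x + 1) y)` of the vertex `(x, y)` have the
law `L_α^{(J)}(v x y, h x y; ·, ·)`. -/
structure IsModel [MeasurableSpace Ω] (q α : ℝ) (μ : Measure Ω)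
    (v : ℕ → ℕ → Ω → Fin (I + 1)) (h : ℕ → ℕ → Ω → Fin (J + 1)) : Prop where
  measurable_v : ∀ x y, Measurable (v x y)
  measurable_h : ∀ x y, Measurable (h x y)
  sampling : ∀ (x y : ℕ) (v' : Fin (I + 1)) (h' : Fin (J + 1)),
    μ[Set.indicator {ω | v x (y + 1) ω = v' ∧ h (x + 1) y ω = h'} (fun _ => (1 : ℝ)) |
        past v h x y]
      =ᵐ[μ] fun ω => LFused I J q α (v x y ω) (h x y ω) v' h'

/-- The height function on lattice points. -/
def latticeHeight (v : ℕ → ℕ → Ω → Fin (I + 1)) (h : ℕ → ℕ → Ω → Fin (J + 1))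
    (ω : Ω) (x y : ℕ) : ℝ :=
  ∑ j ∈ Finset.range y, ((h 0 j ω : ℕ) : ℝ) - ∑ i ∈ Finset.range x, ((v i y ω : ℕ) : ℝ)

/-- The height function at the points of the closed quadrant, by linear interpolation first in `x`
and then in `y`. -/
def height (v : ℕ → ℕ → Ω → Fin (I + 1)) (h : ℕ → ℕ → Ω → Fin (J + 1))
    (ω : Ω) (x y : ℝ) : ℝ :=
  let interpX : ℕ → ℝ := fun n =>
    (1 - Int.fract x) * latticeHeight v h ω ⌊x⌋₊ n
      + Int.fract x * latticeHeight v h ω (⌊x⌋₊ + 1) n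
  (1 - Int.fract y) * interpX ⌊y⌋₊ + Int.fract y * interpX (⌊y⌋₊ + 1)

end Model

/-- `F i → f` uniformly on `S` in probability, along `l`. The random functions `F i` may live on
different probability spaces. -/
def TendstoUniformlyOnInProbability {ι E : Type*} {Ω : ι → Type*}
    [∀ i, MeasurableSpace (Ω i)] (μ : ∀ i, Measure (Ω i)) (F : ∀ i, Ω i → E → ℝ) (f : E → ℝ)
    (l : Filter ι) (S : Set E) : Prop :=
  ∀ ε : ℝ≥0∞, 0 < ε →
    Tendsto (fun i => μ i {ω | ε ≤ ⨆ z ∈ S, edist (F i ω z) (f z)}) l (𝓝 0)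

/-! ### The telegraph equation -/

/-- `u` is a continuous solution on `[0, A] × [0, B]` of `u_xy + a u_x + b u_y = 0` with boundary
values `u(x, 0) = f x` and `u(0, y) = g y`. As the boundary values are only Lipschitz, the equation
is integrated over the rectangles `[0, X] × [0, Y]`. -/
structure IsTelegraphSolution (a b A B : ℝ) (f g : ℝ → ℝ) (u : ℝ → ℝ → ℝ) : Prop where
  continuousOn : ContinuousOn (fun p : ℝ × ℝ => u p.1 p.2) (Icc 0 A ×ˢ Icc 0 B)
  bottom : ∀ x ∈ Icc 0 A, u x 0 = f x
  left : ∀ y ∈ Icc 0 B, u 0 y = g y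
  equation : ∀ X ∈ Icc 0 A, ∀ Y ∈ Icc 0 B,
    (u X Y - u X 0 - u 0 Y + u 0 0)
      + a * (∫ y in (0 : ℝ)..Y, (u X y - u 0 y))
      + b * (∫ x in (0 : ℝ)..X, (u x Y - u x 0)) = 0

/-- At the point `(x, y)` the derivatives `u_x`, `u_y`, `u_xy` exist and satisfy
`u_xy + a u_x + b u_y = 0`. -/
structure SatisfiesTelegraphAt (a b : ℝ) (u : ℝ → ℝ → ℝ) (x y : ℝ) : Prop where
  differentiableAt_x : DifferentiableAt ℝ (fun s => u s y) x
  differentiableAt_y : ∀ᶠ s in 𝓝 x, DifferentiableAt ℝ (fun t => u s t) y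
  differentiableAt_xy : DifferentiableAt ℝ (fun s => deriv (fun t => u s t) y) x
  equation : deriv (fun s => deriv (fun t => u s t) y) x
    + a * deriv (fun s => u s y) x + b * deriv (fun t => u x t) y = 0

end SHS6V

end

/-!
# The hydrodynamic limit of the stochastic higher spin six vertex model

The proof rests on an exact linear relation for the exponential `U = q ^ H` of the height function.
Given the past, the conditional mean of `q ^ (h - v')` at a vertex with inputs `v, h` and upper
output `v'` is an affine combination of `q ^ (-v)` and `q ^ h` (`fusedExp_inv_pow`, proved by adding
the vertices of a fused column one at a time). Hence `U` solves a discrete telegraph equation with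
coefficients `a = 1 - b₁ ~ J β₂ / L` and `b = 1 - b₂ ~ I β₁ / L`, whose right-hand side is a
field of martingale differences, the noise (`sum_noise_eq`, `IsModel.integral_mul_noise`).

The noise of a vertex has second moment of order `L⁻³`: it is of order `L⁻¹` when the vertex turns a
line, which has probability of order `L⁻¹`, and of order `L⁻²` otherwise
(`isBigO_LFused_mul_vertexNoise_sq`). Different vertices are uncorrelated, so the noise summed
over a rectangle with order `L²` vertices has variance of order `L⁻¹`. By Chebyshev's inequality it
is small on a grid with boundedly many points, and by the Lipschitz continuity of `H` it is small
everywhere (`abs_discreteTelegraph_le_of_grid`).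

The continuous equation is solved through `w = exp (b x + a y) u`, which turns it into the Goursat
problem `w_xy = a b w`. The solution is a function of `x` plus a function of `y` plus a double
primitive, and its regularity can be read off from this form (`exists_isTelegraphSolution`).
Restricted to the lattice, `u` solves the discrete equation up to a small error, and a
two-dimensional discrete Grönwall inequality (`discrete_gronwall`) shows that `U` is uniformly
close to `u` (`tendsto_measure_lattice`). As `|H|` is at most of order `L`, `U` is bounded away from
`0`; therefore `u` is positive, and taking logarithms gives the convergence of the heights
(`tendsto_height`).
-/

namespace SHS6V

/-! ### Algebra of the fused weights -/

/-- Expectation of `g` at the vertical output of a vertex of horizontal spin `1/2` whose inputs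
are `u` and `a`. -/
noncomputable def vertexExp (I : ℕ) (q α : ℝ) (u : Fin (I + 1)) (a : Fin 2)
    (g : Fin (I + 1) → ℝ) : ℝ :=
  ∑ v' : Fin (I + 1), ∑ b : Fin 2, LOne I q α u a v' b * g v'

/-- Expectation of `g` at the upper output of a column with inputs `v` and `e`. -/
noncomputable def columnExp (I J : ℕ) (q α : ℝ) (v : Fin (I + 1)) (e : Fin J → Fin 2)
    (g : Fin (I + 1) → ℝ) : ℝ :=
  ∑ v' : Fin (I + 1), ∑ e' : Fin J → Fin 2, LColumn I J q α v e v' e' * g v'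

/-- Unnormalized expectation of `g` at the upper output of a column with lower input `v` and
`h` lines entering from the left, positioned according to `occupiedWeight`. -/
noncomputable def fusedExp (I J : ℕ) (q α : ℝ) (v : Fin (I + 1)) (h : ℕ)
    (g : Fin (I + 1) → ℝ) : ℝ :=
  ∑ e : Fin J → Fin 2, if total e = h then occupiedWeight q e * columnExp I J q α v e g else 0

lemma sum_snoc {J : ℕ} {X : Type*} [Fintype X] [DecidableEq X] (F : (Fin (J + 1) → X) → ℝ) :
    ∑ e, F e = ∑ e : Fin J → X, ∑ a : X, F (Fin.snoc e a) := by
  rw [← (Fin.snocEquiv (fun _ : Fin (J + 1) => X)).sum_comp, Fintype.sum_prod_type,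
    Finset.sum_comm]
  rfl

@[simp] lemma total_snoc {J : ℕ} (e : Fin J → Fin 2) (a : Fin 2) :
    total (Fin.snoc e a : Fin (J + 1) → Fin 2) = total e + a := by
  simp [total, Fin.sum_univ_castSucc]

@[simp] lemma occupiedWeight_snoc {J : ℕ} (q : ℝ) (e : Fin J → Fin 2) (a : Fin 2) :
    occupiedWeight q (Fin.snoc e a : Fin (J + 1) → Fin 2)
      = occupiedWeight q e * if a = 1 then q ^ J else 1 := by
  simp [occupiedWeight, Fin.prod_univ_castSucc]

lemma total_le {J : ℕ} (e : Fin J → Fin 2) : total e ≤ J := by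
  calc total e ≤ ∑ _i : Fin J, 1 := Finset.sum_le_sum fun i _ => by omega
    _ = J := by simp

lemma LColumn_snoc (I J : ℕ) (q α : ℝ) (v v' : Fin (I + 1)) (e e' : Fin J → Fin 2)
    (a b : Fin 2) :
    LColumn I (J + 1) q α v (Fin.snoc e a) v' (Fin.snoc e' b)
      = ∑ u, LColumn I J q α v e u e' * LOne I q (α * q ^ J) u a v' b := by
  have h1 : ∀ (w : Fin (J + 1) → Fin (I + 1)) (x : Fin (I + 1)),
      (Fin.snoc w x : Fin (J + 2) → Fin (I + 1)) 0 = w 0 := fun w x => by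
    rw [← Fin.castSucc_zero, Fin.snoc_castSucc]
  simp only [LColumn]
  rw [sum_snoc]
  simp only [Finset.sum_mul]
  rw [Finset.sum_comm (s := (Finset.univ : Finset (Fin (I + 1))))]
  refine Finset.sum_congr rfl fun w _ => ?_
  simp only [h1, Fin.snoc_last, Fin.prod_univ_castSucc, Fin.snoc_castSucc, Fin.val_castSucc,
    Fin.val_last, Fin.succ_castSucc, Fin.succ_last]
  by_cases hw : w 0 = v
  · simp [hw]
  · simp [hw]

lemma columnExp_snoc (I J : ℕ) (q α : ℝ) (v : Fin (I + 1)) (e : Fin J → Fin 2) (a : Fin 2)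
    (g : Fin (I + 1) → ℝ) :
    columnExp I (J + 1) q α v (Fin.snoc e a) g
      = columnExp I J q α v e fun u => vertexExp I q (α * q ^ J) u a g := by
  simp only [columnExp, vertexExp, sum_snoc, LColumn_snoc, Finset.sum_mul, Finset.mul_sum]
  simp only [mul_assoc]
  calc _ = ∑ x : Fin (I + 1), ∑ x_1 : Fin J → Fin 2, ∑ u : Fin (I + 1), ∑ x_2 : Fin 2,
      LColumn I J q α v e u x_1 * (LOne I q (α * q ^ J) u a x x_2 * g x) := by
        refine Finset.sum_congr rfl fun _ _ => Finset.sum_congr rfl fun _ _ => ?_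
        rw [Finset.sum_comm]
    _ = ∑ x : Fin (I + 1), ∑ u : Fin (I + 1), ∑ x_1 : Fin J → Fin 2, ∑ x_2 : Fin 2,
      LColumn I J q α v e u x_1 * (LOne I q (α * q ^ J) u a x x_2 * g x) := by
        refine Finset.sum_congr rfl fun _ _ => ?_
        rw [Finset.sum_comm]
    _ = _ := by
        rw [Finset.sum_comm]
        refine Finset.sum_congr rfl fun _ _ => ?_
        rw [Finset.sum_comm]

lemma fusedExp_succ_zero (I J : ℕ) (q α : ℝ) (v : Fin (I + 1)) (g : Fin (I + 1) → ℝ) :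
    fusedExp I (J + 1) q α v 0 g
      = fusedExp I J q α v 0 fun u => vertexExp I q (α * q ^ J) u 0 g := by
  simp only [fusedExp, sum_snoc]
  refine Finset.sum_congr rfl fun e _ => ?_
  simp [Fin.sum_univ_two, columnExp_snoc]

lemma fusedExp_succ_succ (I J : ℕ) (q α : ℝ) (v : Fin (I + 1)) (h : ℕ) (g : Fin (I + 1) → ℝ) :
    fusedExp I (J + 1) q α v (h + 1) g
      = fusedExp I J q α v (h + 1) (fun u => vertexExp I q (α * q ^ J) u 0 g)
        + q ^ J * fusedExp I J q α v h fun u => vertexExp I q (α * q ^ J) u 1 g := by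
  simp only [fusedExp, sum_snoc, Finset.mul_sum]
  rw [← Finset.sum_add_distrib]
  refine Finset.sum_congr rfl fun e _ => ?_
  simp only [Fin.sum_univ_two, columnExp_snoc, total_snoc, occupiedWeight_snoc]
  simp only [Fin.val_zero, Fin.val_one, add_left_inj, add_zero]
  split_ifs <;> (simp_all; try ring)

lemma partitionZ_succ_zero (J : ℕ) (q : ℝ) : partitionZ (J + 1) q 0 = partitionZ J q 0 := by
  simp only [partitionZ, sum_snoc]
  refine Finset.sum_congr rfl fun e _ => ?_
  simp [Fin.sum_univ_two]

lemma partitionZ_succ_succ (J : ℕ) (q : ℝ) (h : ℕ) :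
    partitionZ (J + 1) q (h + 1) = partitionZ J q (h + 1) + q ^ J * partitionZ J q h := by
  simp only [partitionZ, sum_snoc, Finset.mul_sum]
  rw [← Finset.sum_add_distrib]
  refine Finset.sum_congr rfl fun e _ => ?_
  simp only [Fin.sum_univ_two, total_snoc, occupiedWeight_snoc]
  simp only [Fin.val_zero, Fin.val_one, add_left_inj, add_zero]
  split_ifs <;> (simp_all; try ring)

lemma partitionZ_zero_left (q : ℝ) (h : ℕ) : partitionZ 0 q h = if h = 0 then 1 else 0 := by
  simp [partitionZ, total, occupiedWeight, eq_comm]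

/-- The `q`-binomial ratio of consecutive normalizing constants. -/
lemma partitionZ_ratio (J : ℕ) (q : ℝ) (h : ℕ) :
    (1 - q ^ (h + 1)) * partitionZ J q (h + 1) = (q ^ h - q ^ J) * partitionZ J q h := by
  induction J generalizing h with
  | zero =>
    rcases h with _ | h <;> simp [partitionZ_zero_left]
  | succ J ih =>
    rw [partitionZ_succ_succ]
    rcases h with _ | h
    · rw [partitionZ_succ_zero]
      have := ih 0
      linear_combination this
    · rw [partitionZ_succ_succ]
      have h1 := ih (h + 1)
      have h2 := ih h
      linear_combination h1 + q ^ (J + 1) * h2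

lemma partitionZ_pos {J : ℕ} {q : ℝ} (hq : 0 < q) {h : ℕ} (hh : h ≤ J) :
    0 < partitionZ J q h := by
  induction J generalizing h with
  | zero => simp [partitionZ_zero_left, Nat.le_zero.1 hh]
  | succ J ih =>
    have hnn : ∀ n, 0 ≤ partitionZ J q n := fun n => by
      refine Finset.sum_nonneg fun e _ => ?_
      split_ifs
      · exact Finset.prod_nonneg fun i _ => by split_ifs <;> positivity
      · exact le_rfl
    rcases h with _ | h
    · rw [partitionZ_succ_zero]; exact ih (Nat.zero_le _)
    · rw [partitionZ_succ_succ]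
      have := ih (Nat.succ_le_succ_iff.1 hh)
      have h2 := hnn (h + 1)
      positivity

lemma vertexExp_zero (I : ℕ) (q α : ℝ) (u : Fin (I + 1)) (G : ℕ → ℝ) :
    vertexExp I q α u 0 (fun w => G w)
      = (1 + α * q ^ (u : ℕ)) / (1 + α) * G u
        + α * (1 - q ^ (u : ℕ)) / (1 + α) * G (u - 1) := by
  simp only [vertexExp, Fin.sum_univ_two, Finset.sum_add_distrib]
  congr 1
  · rw [Finset.sum_eq_single u] <;> simp +contextual [LOne, Fin.ext_iff]
  · rcases Nat.eq_zero_or_pos (u : ℕ) with h0 | h0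
    · simp [LOne, h0]
    · rw [Finset.sum_eq_single (⟨u - 1, by omega⟩ : Fin (I + 1))]
      · simp [LOne]; intro h; omega
      · intro b _ hb
        have : ¬ ((b : ℕ) + 1 = u) := fun h => hb (Fin.ext (by simp; omega))
        simp [LOne, this]
      · simp

lemma vertexExp_one (I : ℕ) {q : ℝ} (hq : 0 < q) (α : ℝ) (u : Fin (I + 1)) (G : ℕ → ℝ) :
    vertexExp I q α u 1 (fun w => G w)
      = (α + (q ^ I)⁻¹ * q ^ (u : ℕ)) / (1 + α) * G u
        + (1 - (q ^ I)⁻¹ * q ^ (u : ℕ)) / (1 + α) * G (u + 1) := by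
  simp only [vertexExp, Fin.sum_univ_two, Finset.sum_add_distrib]
  rw [add_comm]
  congr 1
  · rw [Finset.sum_eq_single u] <;> simp +contextual [LOne, Fin.ext_iff]
  · rcases Nat.eq_or_lt_of_le (Nat.lt_succ_iff.1 u.2) with h0 | h0
    · have : (q ^ I) ≠ 0 := by positivity
      have h2 : ∀ x : Fin (I + 1), (x : ℕ) ≠ I + 1 := fun x => by omega
      simp [LOne, h0, this, h2]
    · rw [Finset.sum_eq_single (⟨u + 1, by omega⟩ : Fin (I + 1))]
      · simp [LOne]
      · intro b _ hb
        have : ¬ ((b : ℕ) = u + 1) := fun h => hb (Fin.ext (by simp; omega))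
        simp [LOne, this]
      · simp

lemma vertexExp_const (I : ℕ) {q α : ℝ} (hq : 0 < q) (hα : 1 + α ≠ 0) (u : Fin (I + 1))
    (a : Fin 2) (c : ℝ) : vertexExp I q α u a (fun _ => c) = c := by
  fin_cases a
  · have := vertexExp_zero I q α u (fun _ => c)
    simp only [Fin.zero_eta] at this ⊢
    rw [this]; field_simp; ring
  · have := vertexExp_one I hq α u (fun _ => c)
    simp only [Fin.mk_one] at this ⊢
    rw [this]; field_simp; ring

lemma LColumn_zero (I : ℕ) (q α : ℝ) (v v' : Fin (I + 1)) (e e' : Fin 0 → Fin 2) :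
    LColumn I 0 q α v e v' e' = if v = v' then 1 else 0 := by
  simp only [LColumn, Finset.univ_eq_empty, Finset.prod_empty]
  rw [Finset.sum_eq_single (fun _ => v)]
  · simp
  · intro w _ hw
    rw [if_neg]
    rintro ⟨h, -⟩
    exact hw (funext fun i => by rw [show i = 0 from Fin.fin_one_eq_zero i, h])
  · simp

lemma columnExp_zero (I : ℕ) (q α : ℝ) (v : Fin (I + 1)) (e : Fin 0 → Fin 2)
    (g : Fin (I + 1) → ℝ) : columnExp I 0 q α v e g = g v := by
  simp [columnExp, LColumn_zero]

lemma columnExp_const (I J : ℕ) {q α : ℝ} (hq : 0 < q) (hα : ∀ k < J, 1 + α * q ^ k ≠ 0)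
    (v : Fin (I + 1)) (e : Fin J → Fin 2) (c : ℝ) :
    columnExp I J q α v e (fun _ => c) = c := by
  induction J with
  | zero => exact columnExp_zero ..
  | succ J ih =>
    rw [← Fin.snoc_init_self e, columnExp_snoc]
    simp only [vertexExp_const I hq (hα J (Nat.lt_succ_self J))]
    exact ih (fun k hk => hα k (by omega)) _

lemma columnExp_affine (I J : ℕ) {q α : ℝ} (hq : 0 < q) (hα : ∀ k < J, 1 + α * q ^ k ≠ 0)
    (v : Fin (I + 1)) (e : Fin J → Fin 2) (c d : ℝ) (g : Fin (I + 1) → ℝ) :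
    columnExp I J q α v e (fun u => c * g u + d) = c * columnExp I J q α v e g + d := by
  have hd := columnExp_const I J hq hα v e d
  simp only [columnExp, mul_add, Finset.sum_add_distrib, Finset.mul_sum] at hd ⊢
  rw [hd]
  simp only [mul_left_comm]

lemma fusedExp_const (I J : ℕ) {q α : ℝ} (hq : 0 < q) (hα : ∀ k < J, 1 + α * q ^ k ≠ 0)
    (v : Fin (I + 1)) (h : ℕ) (c : ℝ) :
    fusedExp I J q α v h (fun _ => c) = c * partitionZ J q h := by
  simp only [fusedExp, columnExp_const I J hq hα, partitionZ, Finset.mul_sum]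
  refine Finset.sum_congr rfl fun e _ => ?_
  split_ifs <;> ring

lemma fusedExp_affine (I J : ℕ) {q α : ℝ} (hq : 0 < q) (hα : ∀ k < J, 1 + α * q ^ k ≠ 0)
    (v : Fin (I + 1)) (h : ℕ) (c d : ℝ) (g : Fin (I + 1) → ℝ) :
    fusedExp I J q α v h (fun u => c * g u + d)
      = c * fusedExp I J q α v h g + d * partitionZ J q h := by
  simp only [fusedExp, columnExp_affine I J hq hα, partitionZ, Finset.mul_sum]
  rw [← Finset.sum_add_distrib]
  refine Finset.sum_congr rfl fun e _ => ?_
  split_ifs <;> ring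

lemma vertexExp_zero_inv_pow (I : ℕ) {q α : ℝ} (hq : 0 < q) (u : Fin (I + 1)) :
    vertexExp I q α u 0 (fun w => (q ^ (w : ℕ))⁻¹)
      = (1 + α * q) / (1 + α) * (q ^ (u : ℕ))⁻¹ + α * (1 - q) / (1 + α) := by
  rw [vertexExp_zero I q α u (fun w => (q ^ w)⁻¹)]
  rcases hu : (u : ℕ) with _ | m
  · simp; ring
  · have : q ^ m ≠ 0 := by positivity
    simp only [Nat.add_sub_cancel, pow_succ]
    field_simp
    ring

lemma vertexExp_one_inv_pow (I : ℕ) {q α : ℝ} (hq : 0 < q) (u : Fin (I + 1)) :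
    vertexExp I q α u 1 (fun w => (q ^ (w : ℕ))⁻¹)
      = (1 + α * q) / (1 + α) / q * (q ^ (u : ℕ))⁻¹
        + (q ^ I)⁻¹ * (q - 1) / (1 + α) / q := by
  rw [vertexExp_one I hq α u (fun w => (q ^ w)⁻¹)]
  have : q ^ (u : ℕ) ≠ 0 := by positivity
  simp only [pow_succ]
  field_simp
  ring

/-- The one-vertex form of the discrete telegraph equation: the conditional mean of `q ^ (h - v')`
is an affine combination of `q ^ (-v)` and `q ^ h`. It is proved by adding the vertices of a
column one at a time. -/
lemma fusedExp_inv_pow (I J : ℕ) {q α : ℝ} (hq : 0 < q) (hα : ∀ k ≤ J, 1 + α * q ^ k ≠ 0)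
    (v : Fin (I + 1)) (h : ℕ) :
    q ^ h * fusedExp I J q α v h (fun w => (q ^ (w : ℕ))⁻¹)
      = partitionZ J q h * ((1 + α * q ^ J) / (1 + α) * (q ^ (v : ℕ))⁻¹
        + (α + (q ^ I)⁻¹) / (1 + α) * (q ^ h - 1) + 1 - (1 + α * q ^ J) / (1 + α)) := by
  have h0 : 1 + α ≠ 0 := by simpa using hα 0 (Nat.zero_le _)
  induction J generalizing h with
  | zero =>
    rw [partitionZ_zero_left]
    simp only [fusedExp, columnExp_zero, total, occupiedWeight]
    rcases h with _ | h
    · simp [h0]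
    · simp
  | succ J ih =>
    have hJ : 1 + α * q ^ J ≠ 0 := hα J (by omega)
    have ih := ih fun k hk => hα k (by omega)
    have haff := fusedExp_affine I J hq (fun k hk => hα k (by omega)) v
    rcases h with _ | h
    · rw [fusedExp_succ_zero, partitionZ_succ_zero]
      simp only [vertexExp_zero_inv_pow I hq]
      rw [haff]
      have := ih 0
      simp only [pow_zero, one_mul, sub_self, mul_zero] at this ⊢
      rw [this]
      simp only [pow_succ]
      field_simp
      ring
    · rw [fusedExp_succ_succ, partitionZ_succ_succ]
      simp only [vertexExp_zero_inv_pow I hq, vertexExp_one_inv_pow I hq]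
      rw [haff, haff]
      have h1 := ih (h + 1)
      have h2 := ih h
      have h3 := partitionZ_ratio J q h
      set S1 := fusedExp I J q α v (h + 1) (fun w => (q ^ (w : ℕ))⁻¹)
      set S2 := fusedExp I J q α v h (fun w => (q ^ (w : ℕ))⁻¹)
      set Z1 := partitionZ J q (h + 1)
      set Z2 := partitionZ J q h
      set x := (q ^ (v : ℕ))⁻¹
      set n := (q ^ I)⁻¹
      calc _ = (1 + α * q ^ J * q) / (1 + α * q ^ J) * (q ^ (h + 1) * S1)
            + α * q ^ J * (1 - q) / (1 + α * q ^ J) * (q ^ (h + 1) * Z1)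
            + q ^ J * ((1 + α * q ^ J * q) / (1 + α * q ^ J) * (q ^ h * S2)
              + n * (q - 1) / (1 + α * q ^ J) * (q ^ h * Z2)) := by
            field_simp
            ring
        _ = _ := by
          rw [h1, h2]
          simp only [pow_succ] at h3 ⊢
          generalize q ^ h = s at *
          generalize q ^ J = t at *
          linear_combination (norm := (field_simp; ring))
            (-(α * t * (1 - q) / (1 + α * t)) * ((1 - n) / (1 + α))) * h3

/-! ### The law of the outputs of a fused vertex -/

lemma sum_LFused_mul (I J : ℕ) (q α : ℝ) (v : Fin (I + 1)) (h : Fin (J + 1))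
    (g : Fin (I + 1) → ℝ) :
    ∑ v', ∑ h', LFused I J q α v h v' h' * g v'
      = fusedExp I J q α v h g / partitionZ J q h := by
  have hXi : ∀ e' : Fin J → Fin 2, ∑ h' : Fin (J + 1), Xi e' h' = 1 := fun e' => by
    have := total_le e'
    rw [Finset.sum_eq_single (⟨total e', by omega⟩ : Fin (J + 1))]
    · simp [Xi]
    · intro b _ hb
      simp only [Xi]
      rw [if_neg fun h => hb (Fin.ext h.symm)]
    · simp
  have h1 : ∀ v', ∑ h', LFused I J q α v h v' h' * g v'
      = ∑ e, ∑ e', Lam J q h e * LColumn I J q α v e v' e' * g v' := fun v' => by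
    simp only [LFused, Finset.sum_mul]
    rw [Finset.sum_comm]
    refine Finset.sum_congr rfl fun e _ => ?_
    rw [Finset.sum_comm]
    refine Finset.sum_congr rfl fun e' _ => ?_
    rw [← Finset.sum_mul, ← Finset.mul_sum, hXi, mul_one]
  simp only [h1, fusedExp, columnExp, Finset.sum_div]
  rw [Finset.sum_comm]
  refine Finset.sum_congr rfl fun e _ => ?_
  simp only [Lam]
  split_ifs
  · simp only [Finset.mul_sum, Finset.sum_div]
    refine Finset.sum_congr rfl fun v' _ => Finset.sum_congr rfl fun e' _ => ?_
    ring
  · simp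

lemma sum_LFused (I J : ℕ) {q α : ℝ} (hq : 0 < q) (hα : ∀ k ≤ J, 1 + α * q ^ k ≠ 0)
    (v : Fin (I + 1)) (h : Fin (J + 1)) :
    ∑ v', ∑ h', LFused I J q α v h v' h' = 1 := by
  have h1 := sum_LFused_mul I J q α v h (fun _ => 1)
  rw [fusedExp_const I J hq (fun k hk => hα k hk.le), one_mul,
    div_self (partitionZ_pos hq (Nat.lt_succ_iff.1 h.2)).ne'] at h1
  simpa using h1

/-- The noise of a vertex, for the coefficients `a = 1 - b₁` and `b = 1 - b₂` of the discrete
telegraph equation: the mixed difference of `q ^ H` around the vertex plus the first order terms,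
relative to the value of `q ^ H` at the lower left corner. -/
noncomputable def vertexNoise (q a b : ℝ) (v h v' : ℕ) : ℝ :=
  q ^ h * (q ^ v')⁻¹ - (q ^ v)⁻¹ - q ^ h + 1 + a * ((q ^ v)⁻¹ - 1) + b * (q ^ h - 1)

/-- The noise of a vertex is centered: the exact four-point relation. -/
lemma sum_LFused_mul_vertexNoise (I J : ℕ) {q α : ℝ} (hq : 0 < q)
    (hα : ∀ k ≤ J, 1 + α * q ^ k ≠ 0) (v : Fin (I + 1)) (h : Fin (J + 1)) :
    ∑ v', ∑ h', LFused I J q α v h v' h'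
      * vertexNoise q (1 - (1 + α * q ^ J) / (1 + α)) ((1 - (q ^ I)⁻¹) / (1 + α)) v h v' = 0 := by
  have h0 : 1 + α ≠ 0 := by simpa using hα 0 (Nat.zero_le _)
  have hZ := partitionZ_pos hq (Nat.lt_succ_iff.1 h.2)
  have h1 := sum_LFused_mul I J q α v h (fun w => (q ^ (w : ℕ))⁻¹)
  have h2 := fusedExp_inv_pow I J hq hα v h
  have h3 := sum_LFused I J hq hα v h
  have h4 : ∀ a b : ℝ, ∑ v', ∑ h', LFused I J q α v h v' h' * vertexNoise q a b v h v'
      = q ^ (h : ℕ) * ∑ v', ∑ h', LFused I J q α v h v' h' * (q ^ (v' : ℕ))⁻¹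
        + (-(q ^ (v : ℕ))⁻¹ - q ^ (h : ℕ) + 1 + a * ((q ^ (v : ℕ))⁻¹ - 1)
          + b * (q ^ (h : ℕ) - 1)) * ∑ v', ∑ h', LFused I J q α v h v' h' := fun a b => by
    simp only [Finset.mul_sum, ← Finset.sum_add_distrib, vertexNoise]
    refine Finset.sum_congr rfl fun _ _ => Finset.sum_congr rfl fun _ _ => ?_
    ring
  rw [h4, h1, h3, ← mul_div_assoc, h2, mul_div_assoc, mul_comm, div_mul_cancel₀ _ hZ.ne']
  field_simp
  ring

lemma LOne_eq_zero {I : ℕ} {q α : ℝ} {i₁ i₂ : ℕ} {a b : Fin 2}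
    (hne : i₁ + (a : ℕ) ≠ i₂ + (b : ℕ)) : LOne I q α i₁ a i₂ b = 0 := by
  fin_cases a <;> fin_cases b <;> simp [LOne] at hne ⊢ <;> intro <;> omega

lemma LColumn_eq_zero {I J : ℕ} {q α : ℝ} {v v' : Fin (I + 1)} {e e' : Fin J → Fin 2}
    (hne : (v : ℕ) + total e ≠ v' + total e') : LColumn I J q α v e v' e' = 0 := by
  induction J generalizing v' with
  | zero =>
    rw [LColumn_zero, if_neg]
    rintro rfl
    exact hne (by simp [total])
  | succ J ih =>
    rw [← Fin.snoc_init_self e, ← Fin.snoc_init_self e'] at hne ⊢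
    rw [LColumn_snoc]
    rw [total_snoc, total_snoc] at hne
    refine Finset.sum_eq_zero fun u _ => ?_
    by_cases hu : (v : ℕ) + total (Fin.init e) = u + total (Fin.init e')
    · rw [LOne_eq_zero, mul_zero]
      omega
    · rw [ih hu, zero_mul]

/-- Lines are conserved at each vertex. -/
lemma LFused_eq_zero {I J : ℕ} {q α : ℝ} {v v' : Fin (I + 1)} {h h' : Fin (J + 1)}
    (hne : (v : ℕ) + h ≠ v' + h') : LFused I J q α v h v' h' = 0 := by
  refine Finset.sum_eq_zero fun e _ => Finset.sum_eq_zero fun e' _ => ?_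
  simp only [Lam, Xi]
  split_ifs with h1 h2
  · rw [LColumn_eq_zero (by omega)]; simp
  all_goals simp

/-! ### Asymptotics of the weights under the scaling -/

section Scaling

open Asymptotics

variable {ι : Type*} {l : Filter ι} {L q α : ι → ℝ} {α₀ : ℝ}

lemma isBigO_pow_sub_one (hq : Tendsto q l (𝓝 1))
    (hq' : (fun i => q i - 1) =O[l] fun i => (L i)⁻¹) (n : ℕ) :
    (fun i => q i ^ n - 1) =O[l] fun i => (L i)⁻¹ := by
  have h : ∀ i, q i ^ n - 1 = (∑ k ∈ Finset.range n, q i ^ k) * (q i - 1) := fun i =>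
    (geom_sum_mul (q i) n).symm
  simp only [h]
  have h1 : Tendsto (fun i => ∑ k ∈ Finset.range n, q i ^ k) l
      (𝓝 (∑ k ∈ Finset.range n, 1 ^ k)) := tendsto_finsetSum _ fun k _ => hq.pow k
  simpa using (h1.isBigO_one ℝ).mul hq'

lemma isBigO_inv_pow_sub_one (hq : Tendsto q l (𝓝 1))
    (hq' : (fun i => q i - 1) =O[l] fun i => (L i)⁻¹) (n : ℕ) :
    (fun i => (q i ^ n)⁻¹ - 1) =O[l] fun i => (L i)⁻¹ := by
  have h1 : Tendsto (fun i => -(q i ^ n)⁻¹) l (𝓝 (-(1 ^ n)⁻¹)) :=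
    ((hq.pow n).inv₀ (by simp)).neg
  have h2 := (h1.isBigO_one ℝ).mul (isBigO_pow_sub_one hq hq' n)
  simp only [one_mul] at h2
  refine h2.congr' ?_ EventuallyEq.rfl
  filter_upwards [hq.eventually_ne one_ne_zero] with i hi
  have : q i ^ n ≠ 0 := pow_ne_zero _ hi
  field_simp
  ring

lemma tendsto_one_add_mul_pow (hq : Tendsto q l (𝓝 1)) (hα : Tendsto α l (𝓝 α₀)) (k : ℕ) :
    Tendsto (fun i => 1 + α i * q i ^ k) l (𝓝 (1 + α₀)) := by
  simpa using (hα.mul (hq.pow k)).const_add 1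

lemma isBigO_LOne_one (hq : Tendsto q l (𝓝 1)) (hα : Tendsto α l (𝓝 α₀)) (hα₀ : 1 + α₀ ≠ 0)
    (I k v v' : ℕ) (a b : Fin 2) :
    (fun i => LOne I (q i) (α i * q i ^ k) v a v' b) =O[l] fun _ => (1 : ℝ) := by
  have h0 : Tendsto (fun i => α i * q i ^ k) l (𝓝 α₀) := by simpa using hα.mul (hq.pow k)
  have h1 := tendsto_one_add_mul_pow hq hα k
  have hI : Tendsto (fun i => (q i ^ I)⁻¹) l (𝓝 1) := by simpa using (hq.pow I).inv₀ (by simp)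
  have hv : Tendsto (fun i => q i ^ v) l (𝓝 1) := by simpa using hq.pow v
  fin_cases a <;> fin_cases b <;> simp only [LOne] <;> split_ifs <;>
    first
    | exact isBigO_zero _ _
    | skip
  · exact (((h0.mul hv).const_add 1).div h1 hα₀).isBigO_one ℝ
  · exact ((h0.mul (hv.const_sub 1)).div h1 hα₀).isBigO_one ℝ
  · exact (((hI.mul hv).const_sub 1).div h1 hα₀).isBigO_one ℝ
  · exact ((h0.add (hI.mul hv)).div h1 hα₀).isBigO_one ℝ

/-- A vertex of horizontal spin `1/2` changes its number of vertical lines with a rate of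
order `1 / L`. -/
lemma isBigO_LOne_of_ne (hq : Tendsto q l (𝓝 1))
    (hq' : (fun i => q i - 1) =O[l] fun i => (L i)⁻¹)
    (hα : Tendsto α l (𝓝 α₀)) (hα₀ : 1 + α₀ ≠ 0) (I k : ℕ) {v v' : ℕ} (hne : v ≠ v')
    (a b : Fin 2) :
    (fun i => LOne I (q i) (α i * q i ^ k) v a v' b) =O[l] fun i => (L i)⁻¹ := by
  have h0 : Tendsto (fun i => α i * q i ^ k) l (𝓝 α₀) := by simpa using hα.mul (hq.pow k)
  have h1 := (tendsto_one_add_mul_pow hq hα k).inv₀ hα₀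
  have hI : Tendsto (fun i => (q i ^ I)⁻¹) l (𝓝 1) := by simpa using (hq.pow I).inv₀ (by simp)
  have hv := isBigO_pow_sub_one hq hq' v
  have hv' := isBigO_inv_pow_sub_one hq hq' I
  have hqv : Tendsto (fun i => q i ^ v) l (𝓝 1) := by simpa using hq.pow v
  fin_cases a <;> fin_cases b <;> simp only [LOne, hne.symm, if_false] <;> (try split_ifs) <;>
    first
    | exact isBigO_zero _ _
    | skip
  · have := (((h0.mul h1).neg.isBigO_one ℝ).mul hv)
    simp only [one_mul] at this
    exact this.congr_left fun i => by rw [div_eq_mul_inv]; ring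
  · have h2 := ((hqv.isBigO_one ℝ).mul hv')
    simp only [one_mul] at h2
    have := ((h1.neg.isBigO_one ℝ).mul (h2.add hv))
    simp only [one_mul] at this
    exact this.congr_left fun i => by rw [div_eq_mul_inv]; ring

lemma isBigO_LColumn_one (hq : Tendsto q l (𝓝 1)) (hα : Tendsto α l (𝓝 α₀))
    (hα₀ : 1 + α₀ ≠ 0) (I J : ℕ) (v v' : Fin (I + 1)) (e e' : Fin J → Fin 2) :
    (fun i => LColumn I J (q i) (α i) v e v' e') =O[l] fun _ => (1 : ℝ) := by
  induction J generalizing v' with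
  | zero => simp only [LColumn_zero]; exact isBigO_const_const _ one_ne_zero _
  | succ J ih =>
    rw [← Fin.snoc_init_self e, ← Fin.snoc_init_self e']
    simp only [LColumn_snoc]
    refine IsBigO.fun_sum fun u _ => ?_
    simpa using (ih u (Fin.init e) (Fin.init e')).mul
      (isBigO_LOne_one hq hα hα₀ I J u v' (e (Fin.last J)) (e' (Fin.last J)))

/-- A column that changes the number of vertical lines contains such a vertex. -/
lemma isBigO_LColumn_of_ne (hq : Tendsto q l (𝓝 1))
    (hq' : (fun i => q i - 1) =O[l] fun i => (L i)⁻¹)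
    (hα : Tendsto α l (𝓝 α₀)) (hα₀ : 1 + α₀ ≠ 0) (I J : ℕ) {v v' : Fin (I + 1)}
    (hne : v ≠ v') (e e' : Fin J → Fin 2) :
    (fun i => LColumn I J (q i) (α i) v e v' e') =O[l] fun i => (L i)⁻¹ := by
  induction J generalizing v' with
  | zero => simp only [LColumn_zero, if_neg hne]; exact isBigO_zero _ _
  | succ J ih =>
    rw [← Fin.snoc_init_self e, ← Fin.snoc_init_self e']
    simp only [LColumn_snoc]
    refine IsBigO.fun_sum fun u _ => ?_
    by_cases hu : v = u
    · subst hu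
      simpa using (isBigO_LColumn_one hq hα hα₀ I J v v (Fin.init e) (Fin.init e')).mul
        (isBigO_LOne_of_ne hq hq' hα hα₀ I J (Fin.val_ne_of_ne hne) (e (Fin.last J))
          (e' (Fin.last J)))
    · simpa using (ih hu (Fin.init e) (Fin.init e')).mul
        (isBigO_LOne_one hq hα hα₀ I J u v' (e (Fin.last J)) (e' (Fin.last J)))

lemma isBigO_Lam (hq : Tendsto q l (𝓝 1)) (J : ℕ) (h : Fin (J + 1)) (e : Fin J → Fin 2) :
    (fun i => Lam J (q i) h e) =O[l] fun _ => (1 : ℝ) := by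
  have h1 : ∀ e : Fin J → Fin 2, Continuous fun x : ℝ => occupiedWeight x e := fun e => by
    unfold occupiedWeight
    refine continuous_finsetProd _ fun i _ => ?_
    split_ifs <;> fun_prop
  have h2 : Continuous fun x : ℝ => partitionZ J x h := by
    unfold partitionZ
    refine continuous_finsetSum _ fun e _ => ?_
    split_ifs
    · exact h1 e
    · fun_prop
  unfold Lam
  split_ifs
  · have h3 := ((h1 e).tendsto 1).comp hq
    have h4 := (h2.tendsto 1).comp hq
    exact (h3.div h4 (partitionZ_pos one_pos (Nat.lt_succ_iff.1 h.2)).ne').isBigO_one ℝ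
  · exact isBigO_zero _ _

lemma isBigO_LFused_one (hq : Tendsto q l (𝓝 1)) (hα : Tendsto α l (𝓝 α₀))
    (hα₀ : 1 + α₀ ≠ 0) (I J : ℕ) (v v' : Fin (I + 1)) (h h' : Fin (J + 1)) :
    (fun i => LFused I J (q i) (α i) v h v' h') =O[l] fun _ => (1 : ℝ) := by
  unfold LFused
  refine IsBigO.fun_sum fun e _ => IsBigO.fun_sum fun e' _ => ?_
  simpa using ((isBigO_Lam hq J h e).mul (isBigO_LColumn_one hq hα hα₀ I J v v' e e')).mul
    (isBigO_const_const (Xi e' h') one_ne_zero l)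

lemma isBigO_LFused_of_ne (hq : Tendsto q l (𝓝 1))
    (hq' : (fun i => q i - 1) =O[l] fun i => (L i)⁻¹)
    (hα : Tendsto α l (𝓝 α₀)) (hα₀ : 1 + α₀ ≠ 0) (I J : ℕ) {v v' : Fin (I + 1)}
    (hne : v ≠ v') (h h' : Fin (J + 1)) :
    (fun i => LFused I J (q i) (α i) v h v' h') =O[l] fun i => (L i)⁻¹ := by
  unfold LFused
  refine IsBigO.fun_sum fun e _ => IsBigO.fun_sum fun e' _ => ?_
  simpa using ((isBigO_Lam hq J h e).mul (isBigO_LColumn_of_ne hq hq' hα hα₀ I J hne e e')).mul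
    (isBigO_const_const (Xi e' h') one_ne_zero l)

/-- The noise of a vertex has second moment of order `L⁻³`: a vertex that changes the number
of vertical lines has noise of order `L⁻¹` but probability of order `L⁻¹`, and the other vertices
have noise of order `L⁻²`. -/
lemma isBigO_LFused_mul_vertexNoise_sq {a b : ι → ℝ} (hL : Tendsto L l atTop)
    (hq : Tendsto q l (𝓝 1))
    (hq' : (fun i => q i - 1) =O[l] fun i => (L i)⁻¹)
    (hα : Tendsto α l (𝓝 α₀)) (hα₀ : 1 + α₀ ≠ 0)
    (ha : a =O[l] fun i => (L i)⁻¹) (hb : b =O[l] fun i => (L i)⁻¹)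
    (I J : ℕ) (v v' : Fin (I + 1)) (h h' : Fin (J + 1)) :
    (fun i => LFused I J (q i) (α i) v h v' h' * vertexNoise (q i) (a i) (b i) v h v' ^ 2)
      =O[l] fun i => (L i)⁻¹ ^ 3 := by
  have hL1 : (fun i => (L i)⁻¹) =O[l] fun _ => (1 : ℝ) :=
    (tendsto_inv_atTop_zero.comp hL).isBigO_one ℝ
  have hv := isBigO_inv_pow_sub_one hq hq' v
  have hh := isBigO_pow_sub_one hq hq' h
  have hav := ha.mul hv
  have hbh := hb.mul hh
  by_cases hne : v = v'
  · subst hne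
    have h1 : (fun i => vertexNoise (q i) (a i) (b i) v h v) =O[l] fun i => (L i)⁻¹ ^ 2 := by
      refine (((hh.mul hv).add hav).add hbh).congr (fun i => ?_) (fun i => ?_)
      · simp only [vertexNoise]; ring
      · ring
    have h2 := ((isBigO_LFused_one hq hα hα₀ I J v v h h').mul (h1.pow 2))
    refine h2.trans ?_
    have h3 := hL1.mul (isBigO_refl (fun i => (L i)⁻¹ ^ 3) l)
    refine h3.congr (fun i => ?_) (fun i => ?_) <;> ring
  · have hv' := isBigO_inv_pow_sub_one hq hq' v'
    have hqh : (fun i => q i ^ (h : ℕ)) =O[l] fun _ => (1 : ℝ) := (hq.pow _).isBigO_one ℝ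
    have h1 : (fun i => vertexNoise (q i) (a i) (b i) v h v') =O[l] fun i => (L i)⁻¹ := by
      have h2 := hqh.mul hv'
      simp only [one_mul] at h2
      have h3 := ((hL1.mul hv).congr_right (g₂ := fun i => (L i)⁻¹) fun i => by ring)
      have h4 := ha.mul (hv.trans hL1)
      have h5 := hb.mul (hh.trans hL1)
      simp only [mul_one] at h4 h5
      refine (((h2.sub hv).add h4).add h5).congr (fun i => ?_) (fun i => rfl)
      simp only [vertexNoise]; ring
    refine ((isBigO_LFused_of_ne hq hq' hα hα₀ I J hne h h').mul (h1.pow 2)).congr_right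
      fun i => ?_
    ring

end Scaling

section Parameters

variable {ι : Type*} {l : Filter ι} {L q α : ι → ℝ} {β₁ β₂ : ℝ}

/-- `L (exp (c / L) - 1) → c`. -/
lemma tendsto_mul_exp_div_sub_one (hL : Tendsto L l atTop) (c : ℝ) :
    Tendsto (fun i => L i * (Real.exp (c / L i) - 1)) l (𝓝 c) := by
  have hd : HasDerivAt (fun t : ℝ => Real.exp (c * t)) c 0 := by
    simpa using ((hasDerivAt_id (0 : ℝ)).const_mul c).exp
  have h1 : Tendsto (fun i => (L i)⁻¹) l (𝓝[≠] 0) := by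
    refine tendsto_nhdsWithin_iff.2 ⟨tendsto_inv_atTop_zero.comp hL, ?_⟩
    filter_upwards [hL.eventually_gt_atTop 0] with i hi
    exact (inv_pos.2 hi).ne'
  refine ((hasDerivAt_iff_tendsto_slope.1 hd).comp h1).congr fun i => ?_
  simp [slope_def_field, div_eq_mul_inv, mul_comm]

lemma tendsto_exp_div (hL : Tendsto L l atTop) (c : ℝ) :
    Tendsto (fun i => Real.exp (c / L i)) l (𝓝 1) := by
  have := (Real.continuous_exp.tendsto 0).comp (hL.const_div_atTop c)
  simpa [Function.comp_def] using this

lemma tendsto_mul_pow_sub_one (hL : Tendsto L l atTop) {c : ℝ}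
    (hq : ∀ᶠ i in l, q i = Real.exp (c / L i)) (n : ℕ) :
    Tendsto (fun i => L i * (q i ^ n - 1)) l (𝓝 (n * c)) := by
  refine (tendsto_mul_exp_div_sub_one hL (n * c)).congr' ?_
  filter_upwards [hq] with i hi
  rw [hi, ← Real.exp_nat_mul, mul_div_assoc]

/-- The spectral parameter converges to `-β₂ / β₁`. -/
lemma tendsto_spectral {J : ℕ} (hJ : 1 ≤ J) (hβ₁ : 0 < β₁) (hL : Tendsto L l atTop)
    (hq : ∀ᶠ i in l, q i = Real.exp ((β₁ - β₂) / L i))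
    (hα : ∀ᶠ i in l, (1 + α i * q i ^ J) / (1 + α i) = Real.exp (-(J * β₂) / L i)) :
    Tendsto α l (𝓝 (-β₂ / β₁)) := by
  have hJ' : (0 : ℝ) < J := by exact_mod_cast hJ
  have h1 := tendsto_mul_exp_div_sub_one hL (-(J * β₂))
  have h2 := tendsto_mul_pow_sub_one hL hq J
  have hlim : ((J : ℝ) * (β₁ - β₂) - -(J * β₂)) ≠ 0 := by
    ring_nf; positivity
  have h3 := h1.div (h2.sub h1) hlim
  have h4 : -((J : ℝ) * β₂) / (J * (β₁ - β₂) - -(J * β₂)) = -β₂ / β₁ := by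
    have : (J : ℝ) * (β₁ - β₂) - -(J * β₂) = J * β₁ := by ring
    rw [this]; field_simp
  rw [h4] at h3
  refine h3.congr' ?_
  filter_upwards [hα, hL.eventually_gt_atTop 0, (h2.sub h1).eventually_ne hlim] with i hi hLi hne
  have h0 : 1 + α i ≠ 0 := fun h => by
    rw [h, div_zero] at hi; exact (Real.exp_pos _).ne hi
  rw [div_eq_iff h0] at hi
  simp only [Pi.div_apply]
  rw [div_eq_iff hne]
  linear_combination (-L i) * hi

lemma tendsto_mul_one_sub_b₁ {J : ℕ} (hL : Tendsto L l atTop)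
    (hα : ∀ᶠ i in l, (1 + α i * q i ^ J) / (1 + α i) = Real.exp (-(J * β₂) / L i)) :
    Tendsto (fun i => L i * (1 - (1 + α i * q i ^ J) / (1 + α i))) l (𝓝 (J * β₂)) := by
  have := (tendsto_mul_exp_div_sub_one hL (-(J * β₂))).neg
  rw [neg_neg] at this
  refine this.congr' ?_
  filter_upwards [hα] with i hi
  rw [hi]; ring

lemma tendsto_mul_one_sub_b₂ {I J : ℕ} (hJ : 1 ≤ J) (hβ₁ : 0 < β₁) (hβ : β₁ ≠ β₂)
    (hL : Tendsto L l atTop)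
    (hq : ∀ᶠ i in l, q i = Real.exp ((β₁ - β₂) / L i))
    (hα : ∀ᶠ i in l, (1 + α i * q i ^ J) / (1 + α i) = Real.exp (-(J * β₂) / L i)) :
    Tendsto (fun i => L i * ((1 - (q i ^ I)⁻¹) / (1 + α i))) l (𝓝 (I * β₁)) := by
  have h1 := (tendsto_mul_exp_div_sub_one hL (-(I * (β₁ - β₂)))).neg
  have h2 := (tendsto_spectral hJ hβ₁ hL hq hα).const_add 1
  have hne : 1 + -β₂ / β₁ ≠ 0 := by
    have : 1 + -β₂ / β₁ = (β₁ - β₂) / β₁ := by field_simp; ring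
    rw [this]; exact div_ne_zero (sub_ne_zero.2 hβ) hβ₁.ne'
  have h3 := h1.div h2 hne
  have h4 : - -((I : ℝ) * (β₁ - β₂)) / (1 + -β₂ / β₁) = I * β₁ := by
    rw [div_eq_iff hne]; field_simp; ring
  rw [h4] at h3
  refine h3.congr' ?_
  filter_upwards [hq] with i hi
  have : (q i ^ I)⁻¹ = Real.exp (-(I * (β₁ - β₂)) / L i) := by
    rw [hi, ← Real.exp_nat_mul, ← Real.exp_neg]; congr 1; ring
  simp only [Pi.div_apply]
  rw [this]; ring

lemma isBigO_inv_of_tendsto_mul (hL : Tendsto L l atTop) {f : ι → ℝ} {c : ℝ}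
    (hf : Tendsto (fun i => L i * f i) l (𝓝 c)) : f =O[l] fun i => (L i)⁻¹ := by
  have h := (hf.isBigO_one ℝ).mul (Asymptotics.isBigO_refl (fun i => (L i)⁻¹) l)
  simp only [one_mul] at h
  refine h.congr' ?_ EventuallyEq.rfl
  filter_upwards [hL.eventually_gt_atTop 0] with i hi
  field_simp

end Parameters

/-! ### The noise field of the model -/

section Noise

variable {I J : ℕ} {Ω : Type*}

/-- The exponential `q ^ H` of the height function on lattice points. -/
noncomputable def expHeight (q : ℝ) (v : ℕ → ℕ → Ω → Fin (I + 1)) (h : ℕ → ℕ → Ω → Fin (J + 1))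
    (ω : Ω) (x y : ℕ) : ℝ :=
  q ^ latticeHeight v h ω x y

/-- The noise produced by the vertex `(x, y)`. -/
noncomputable def noise (q a b : ℝ) (v : ℕ → ℕ → Ω → Fin (I + 1)) (h : ℕ → ℕ → Ω → Fin (J + 1))
    (p : ℕ × ℕ) (ω : Ω) : ℝ :=
  expHeight q v h ω p.1 p.2
    * vertexNoise q a b (v p.1 p.2 ω) (h p.1 p.2 ω) (v p.1 (p.2 + 1) ω)

/-- Lines are conserved at every vertex of the configuration `ω`. -/
def Conserved (v : ℕ → ℕ → Ω → Fin (I + 1)) (h : ℕ → ℕ → Ω → Fin (J + 1)) (ω : Ω) : Prop :=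
  ∀ x y, (v x y ω : ℕ) + h x y ω = v x (y + 1) ω + h (x + 1) y ω

/-- The left-hand side of the discrete telegraph equation with coefficients `a` and `b`, summed
over the rectangle `[0, X) × [0, Y)`. -/
def discreteTelegraph (a b : ℝ) (F : ℕ → ℕ → ℝ) (X Y : ℕ) : ℝ :=
  F X Y - F X 0 - F 0 Y + F 0 0 + a * ∑ y ∈ Finset.range Y, (F X y - F 0 y)
    + b * ∑ x ∈ Finset.range X, (F x Y - F x 0)

lemma sum_telegraph_eq (a b : ℝ) (F : ℕ → ℕ → ℝ) (X Y : ℕ) :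
    ∑ x ∈ Finset.range X, ∑ y ∈ Finset.range Y,
      (F (x + 1) (y + 1) - F (x + 1) y - F x (y + 1) + F x y + a * (F (x + 1) y - F x y)
        + b * (F x (y + 1) - F x y)) = discreteTelegraph a b F X Y := by
  have h1 : ∀ x, ∑ y ∈ Finset.range Y,
      (F (x + 1) (y + 1) - F (x + 1) y - F x (y + 1) + F x y + a * (F (x + 1) y - F x y)
        + b * (F x (y + 1) - F x y))
      = (F (x + 1) Y - F (x + 1) 0 + a * ∑ y ∈ Finset.range Y, F (x + 1) y)
        - (F x Y - F x 0 + a * ∑ y ∈ Finset.range Y, F x y) + b * (F x Y - F x 0) := fun x => by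
    rw [← Finset.sum_range_sub (F x), ← Finset.sum_range_sub (F (x + 1))]
    simp only [Finset.mul_sum, ← Finset.sum_add_distrib, ← Finset.sum_sub_distrib]
    refine Finset.sum_congr rfl fun y _ => ?_
    ring
  simp only [h1, Finset.sum_add_distrib]
  rw [Finset.sum_range_sub
    (fun x => F x Y - F x 0 + a * ∑ y ∈ Finset.range Y, F x y), ← Finset.mul_sum]
  simp only [discreteTelegraph, Finset.sum_sub_distrib]
  ring

variable {v : ℕ → ℕ → Ω → Fin (I + 1)} {h : ℕ → ℕ → Ω → Fin (J + 1)}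

lemma latticeHeight_succ_left (ω : Ω) (x y : ℕ) :
    latticeHeight v h ω (x + 1) y = latticeHeight v h ω x y - (v x y ω : ℕ) := by
  simp only [latticeHeight, Finset.sum_range_succ]; ring

lemma latticeHeight_succ_right {ω : Ω} (hω : Conserved v h ω) (x y : ℕ) :
    latticeHeight v h ω x (y + 1) = latticeHeight v h ω x y + (h x y ω : ℕ) := by
  induction x with
  | zero => simp [latticeHeight, Finset.sum_range_succ]
  | succ x ih =>
    rw [latticeHeight_succ_left, latticeHeight_succ_left, ih]
    have : ((v x y ω : ℕ) : ℝ) + (h x y ω : ℕ) = (v x (y + 1) ω : ℕ) + (h (x + 1) y ω : ℕ) :=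
      mod_cast hω x y
    linarith

lemma abs_latticeHeight_le (ω : Ω) (x y : ℕ) :
    |latticeHeight v h ω x y| ≤ I * x + J * y := by
  have h1 : ∑ j ∈ Finset.range y, ((h 0 j ω : ℕ) : ℝ) ≤ ∑ _j ∈ Finset.range y, (J : ℝ) :=
    Finset.sum_le_sum fun j _ => by exact_mod_cast Nat.lt_succ_iff.1 (h 0 j ω).2
  have h2 : ∑ i ∈ Finset.range x, ((v i y ω : ℕ) : ℝ) ≤ ∑ _j ∈ Finset.range x, (I : ℝ) :=
    Finset.sum_le_sum fun j _ => by exact_mod_cast Nat.lt_succ_iff.1 (v j y ω).2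
  have h3 : 0 ≤ ∑ j ∈ Finset.range y, ((h 0 j ω : ℕ) : ℝ) :=
    Finset.sum_nonneg fun _ _ => Nat.cast_nonneg _
  have h4 : 0 ≤ ∑ i ∈ Finset.range x, ((v i y ω : ℕ) : ℝ) :=
    Finset.sum_nonneg fun _ _ => Nat.cast_nonneg _
  simp only [Finset.sum_const, Finset.card_range, nsmul_eq_mul] at h1 h2
  rw [abs_le]
  constructor <;> unfold latticeHeight <;> nlinarith

lemma expHeight_eq_exp {q : ℝ} (hq : 0 < q) (ω : Ω) (x y : ℕ) :
    expHeight q v h ω x y = Real.exp (Real.log q * latticeHeight v h ω x y) :=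
  Real.rpow_def_of_pos hq _

lemma expHeight_pos {q : ℝ} (hq : 0 < q) (ω : Ω) (x y : ℕ) : 0 < expHeight q v h ω x y :=
  Real.rpow_pos_of_pos hq _

lemma abs_log_mul_latticeHeight_le {q c : ℝ} (hc : |Real.log q| ≤ c) (ω : Ω) (x y : ℕ) :
    |Real.log q * latticeHeight v h ω x y| ≤ c * (I * x + J * y) := by
  rw [abs_mul]
  exact mul_le_mul hc (abs_latticeHeight_le ω x y) (abs_nonneg _) ((abs_nonneg _).trans hc)

lemma expHeight_le {q c : ℝ} (hq : 0 < q) (hc : |Real.log q| ≤ c) (ω : Ω) (x y : ℕ) :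
    expHeight q v h ω x y ≤ Real.exp (c * (I * x + J * y)) := by
  rw [expHeight_eq_exp hq]
  exact Real.exp_le_exp.2 ((le_abs_self _).trans (abs_log_mul_latticeHeight_le hc ω x y))

lemma le_expHeight {q c : ℝ} (hq : 0 < q) (hc : |Real.log q| ≤ c) (ω : Ω) (x y : ℕ) :
    Real.exp (-(c * (I * x + J * y))) ≤ expHeight q v h ω x y := by
  rw [expHeight_eq_exp hq]
  exact Real.exp_le_exp.2 (neg_le_of_abs_le (abs_log_mul_latticeHeight_le hc ω x y))

/-- On a configuration that conserves lines, `q ^ H` solves the discrete telegraph equation with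
the noise as its right-hand side. -/
lemma sum_noise_eq {q : ℝ} (hq : 0 < q) (a b : ℝ) {ω : Ω} (hω : Conserved v h ω) (X Y : ℕ) :
    ∑ p ∈ Finset.range X ×ˢ Finset.range Y, noise q a b v h p ω
      = discreteTelegraph a b (expHeight q v h ω) X Y := by
  rw [← sum_telegraph_eq, Finset.sum_product]
  refine Finset.sum_congr rfl fun x _ => Finset.sum_congr rfl fun y _ => ?_
  have h1 : expHeight q v h ω (x + 1) y = expHeight q v h ω x y * (q ^ (v x y ω : ℕ))⁻¹ := by
    simp only [expHeight]
    rw [latticeHeight_succ_left, Real.rpow_sub hq, Real.rpow_natCast, div_eq_mul_inv]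
  have h2 : expHeight q v h ω x (y + 1) = expHeight q v h ω x y * q ^ (h x y ω : ℕ) := by
    simp only [expHeight]
    rw [latticeHeight_succ_right hω, Real.rpow_add hq, Real.rpow_natCast]
  have h3 : expHeight q v h ω (x + 1) (y + 1)
      = expHeight q v h ω x y * q ^ (h x y ω : ℕ) * (q ^ (v x (y + 1) ω : ℕ))⁻¹ := by
    rw [← h2]
    simp only [expHeight]
    rw [latticeHeight_succ_left, Real.rpow_sub hq, Real.rpow_natCast, div_eq_mul_inv]
  rw [h1, h2, h3]
  simp only [noise, vertexNoise]
  ring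

/-! ### Conditional expectations -/

lemma measurable_past_of_precedes {a b x y : ℕ} (hp : Precedes a b x y) :
    Measurable[past v h x y] (v a (b + 1)) ∧ Measurable[past v h x y] (h (a + 1) b) := by
  have h1 : MeasurableSpace.comap (v a (b + 1)) ⊤ ⊔ MeasurableSpace.comap (h (a + 1) b) ⊤
      ≤ past v h x y :=
    le_sup_of_le_right (le_iSup_of_le a (le_iSup_of_le b (le_iSup_of_le hp le_rfl)))
  exact ⟨Measurable.of_comap_le (le_sup_left.trans h1),
    Measurable.of_comap_le (le_sup_right.trans h1)⟩

lemma measurable_v_past {a b x y : ℕ} (hab : a + b ≤ x + y) :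
    Measurable[past v h x y] (v a b) := by
  rcases b with _ | b
  · refine Measurable.of_comap_le ?_
    exact le_sup_of_le_left (le_sup_of_le_left
      (le_iSup (fun a => MeasurableSpace.comap (v a 0) ⊤) a))
  · exact (measurable_past_of_precedes (Or.inl (by omega))).1

lemma measurable_h_past {a b x y : ℕ} (hab : a + b ≤ x + y) :
    Measurable[past v h x y] (h a b) := by
  rcases a with _ | a
  · refine Measurable.of_comap_le ?_
    exact le_sup_of_le_left (le_sup_of_le_right
      (le_iSup (fun a => MeasurableSpace.comap (h 0 a) ⊤) b))
  · exact (measurable_past_of_precedes (Or.inl (by omega))).2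

lemma measurable_expHeight_past (q : ℝ) {a b x y : ℕ} (hab : a + b ≤ x + y) :
    Measurable[past v h x y] fun ω => expHeight q v h ω a b := by
  have hcast : ∀ n, Measurable fun k : Fin n => ((k : ℕ) : ℝ) := fun n => measurable_of_finite _
  have h1 : Measurable[past v h x y] fun ω => latticeHeight v h ω a b := by
    unfold latticeHeight
    refine Measurable.sub (Finset.measurable_sum _ fun j hj => ?_)
      (Finset.measurable_sum _ fun j hj => ?_)
    · exact (hcast _).comp (measurable_h_past (by have := Finset.mem_range.1 hj; omega))
    · exact (hcast _).comp (measurable_v_past (by have := Finset.mem_range.1 hj; omega))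
  exact h1.const_pow q

lemma measurable_noise_past (q a b : ℝ) {p : ℕ × ℕ} {x y : ℕ} (hp : Precedes p.1 p.2 x y) :
    Measurable[past v h x y] (noise q a b v h p) := by
  have hle : p.1 + p.2 ≤ x + y := by
    rcases hp with hp | hp <;> omega
  have h1 : Measurable fun z : Fin (I + 1) × Fin (J + 1) × Fin (I + 1) =>
      vertexNoise q a b z.1 z.2.1 z.2.2 := measurable_of_finite _
  have h2 : Measurable[past v h x y] fun ω =>
      (v p.1 p.2 ω, h p.1 p.2 ω, v p.1 (p.2 + 1) ω) :=
    (measurable_v_past hle).prodMk ((measurable_h_past hle).prodMk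
      (measurable_past_of_precedes hp).1)
  have h3 := measurable_expHeight_past (v := v) (h := h) q hle
  have h4 := h1.comp h2
  exact h3.mul h4

/-- The noise of a fixed vertex is a bounded random variable, for every value of its output. -/
lemma exists_abs_noise_le {q : ℝ} (hq : 0 < q) (a b : ℝ) (p : ℕ × ℕ) :
    ∃ C, ∀ (ω : Ω) (v' : Fin (I + 1)), |expHeight q v h ω p.1 p.2
      * vertexNoise q a b (v p.1 p.2 ω) (h p.1 p.2 ω) v'| ≤ C := by
  obtain ⟨D, hD⟩ : ∃ D, ∀ z : Fin (I + 1) × Fin (J + 1) × Fin (I + 1),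
      |vertexNoise q a b z.1 z.2.1 z.2.2| ≤ D := by
    obtain ⟨D, hD⟩ := (Set.finite_range fun z : Fin (I + 1) × Fin (J + 1) × Fin (I + 1) =>
      |vertexNoise q a b z.1 z.2.1 z.2.2|).bddAbove
    exact ⟨D, fun z => hD ⟨z, rfl⟩⟩
  refine ⟨Real.exp (|Real.log q| * (I * p.1 + J * p.2)) * D, fun ω v' => ?_⟩
  rw [abs_mul, abs_of_pos (expHeight_pos hq ω _ _)]
  exact mul_le_mul (expHeight_le hq le_rfl ω _ _) (hD (_, _, v')) (abs_nonneg _)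
    (Real.exp_pos _).le

lemma measurable_noise_output (q a b : ℝ) (x y : ℕ) (v' : Fin (I + 1)) :
    Measurable[past v h x y] fun ω => expHeight q v h ω x y
      * vertexNoise q a b (v x y ω) (h x y ω) v' := by
  have h1 : Measurable fun z : Fin (I + 1) × Fin (J + 1) =>
      vertexNoise q a b z.1 z.2 v' := measurable_of_finite _
  have h2 : Measurable[past v h x y] fun ω => (v x y ω, h x y ω) :=
    (measurable_v_past le_rfl).prodMk (measurable_h_past le_rfl)
  have h3 := measurable_expHeight_past (v := v) (h := h) q (le_refl (x + y))
  have h4 := h1.comp h2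
  exact h3.mul h4

variable [mΩ : MeasurableSpace Ω] {μ : Measure Ω} [IsProbabilityMeasure μ] {q α : ℝ}

lemma past_le (hv : ∀ x y, Measurable (v x y)) (hh : ∀ x y, Measurable (h x y)) (x y : ℕ) :
    past v h x y ≤ mΩ :=
  sup_le (sup_le (iSup_le fun a => (hv a 0).comap_le) (iSup_le fun b => (hh 0 b).comap_le))
    (iSup_le fun a => iSup_le fun b => iSup_le fun _ =>
      sup_le (hv a (b + 1)).comap_le (hh (a + 1) b).comap_le)

/-- Averaging over the outputs of the vertex `(x, y)` a function that may depend on the past. -/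
lemma IsModel.integral_outputs (hm : IsModel q α μ v h) (x y : ℕ)
    (F : Fin (I + 1) → Fin (J + 1) → Ω → ℝ)
    (hF : ∀ a b, Measurable[past v h x y] (F a b)) {C : ℝ} (hC : ∀ a b ω, |F a b ω| ≤ C) :
    ∫ ω, F (v x (y + 1) ω) (h (x + 1) y ω) ω ∂μ
      = ∫ ω, ∑ a, ∑ b, LFused I J q α (v x y ω) (h x y ω) a b * F a b ω ∂μ := by
  have hle := past_le hm.measurable_v hm.measurable_h x y
  set S : Fin (I + 1) → Fin (J + 1) → Set Ω :=
    fun a b => {ω | v x (y + 1) ω = a ∧ h (x + 1) y ω = b} with hS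
  have hSm : ∀ a b, MeasurableSet (S a b) := fun a b =>
    (hm.measurable_v x (y + 1) (measurableSet_singleton a)).inter
      (hm.measurable_h (x + 1) y (measurableSet_singleton b))
  have hFint : ∀ a b, Integrable (F a b) μ := fun a b =>
    Integrable.of_bound ((hF a b).mono hle le_rfl).aestronglyMeasurable C
      (ae_of_all _ fun ω => hC a b ω)
  have hind : ∀ a b, Integrable ((S a b).indicator fun _ => (1 : ℝ)) μ := fun a b =>
    (integrable_const 1).indicator (hSm a b)
  have hprod : ∀ a b, Integrable (F a b * (S a b).indicator fun _ => (1 : ℝ)) μ := fun a b => by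
    refine ((hFint a b).indicator (hSm a b)).congr (ae_of_all _ fun ω => ?_)
    by_cases hω : ω ∈ S a b <;> simp [hω]
  have hcond : ∀ a b, μ[F a b * (S a b).indicator (fun _ => (1 : ℝ)) | past v h x y]
      =ᵐ[μ] fun ω => LFused I J q α (v x y ω) (h x y ω) a b * F a b ω := fun a b => by
    filter_upwards [condExp_mul_of_stronglyMeasurable_left (hF a b).stronglyMeasurable
      (hprod a b) (hind a b), hm.sampling x y a b] with ω h1 h2
    rw [h1, Pi.mul_apply, h2, mul_comm]
  have hint : ∀ a b, ∫ ω, (F a b * (S a b).indicator fun _ => (1 : ℝ)) ω ∂μ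
      = ∫ ω, LFused I J q α (v x y ω) (h x y ω) a b * F a b ω ∂μ := fun a b => by
    rw [← integral_condExp hle]
    exact integral_congr_ae (hcond a b)
  have hint' : ∀ a b, Integrable
      (fun ω => LFused I J q α (v x y ω) (h x y ω) a b * F a b ω) μ := fun a b =>
    integrable_condExp.congr (hcond a b)
  have hpt : ∀ ω, F (v x (y + 1) ω) (h (x + 1) y ω) ω
      = ∑ a, ∑ b, (F a b * (S a b).indicator fun _ => (1 : ℝ)) ω := fun ω => by
    rw [Finset.sum_eq_single (v x (y + 1) ω), Finset.sum_eq_single (h (x + 1) y ω)]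
    · simp [hS]
    · intro b _ hb; simp [hS, hb.symm]
    · simp
    · intro a _ ha; simp [hS, ha.symm]
    · simp
  simp only [hpt]
  rw [integral_finsetSum _ fun a _ => integrable_finsetSum _ fun b _ => hprod a b,
    integral_finsetSum _ fun a _ => integrable_finsetSum _ fun b _ => hint' a b]
  refine Finset.sum_congr rfl fun a _ => ?_
  rw [integral_finsetSum _ fun b _ => hprod a b, integral_finsetSum _ fun b _ => hint' a b]
  exact Finset.sum_congr rfl fun b _ => hint a b

/-- Almost every configuration of the model conserves lines. -/
lemma IsModel.ae_conserved (hm : IsModel q α μ v h) : ∀ᵐ ω ∂μ, Conserved v h ω := by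
  refine ae_all_iff.2 fun x => ae_all_iff.2 fun y => ?_
  have hF : ∀ (a : Fin (I + 1)) (b : Fin (J + 1)), Measurable[past v h x y] fun ω =>
      if (v x y ω : ℕ) + h x y ω = a + b then (0 : ℝ) else 1 := fun a b => by
    have h1 : Measurable fun z : Fin (I + 1) × Fin (J + 1) =>
      if (z.1 : ℕ) + z.2 = a + b then (0 : ℝ) else 1 := measurable_of_finite _
    exact h1.comp ((measurable_v_past le_rfl).prodMk (measurable_h_past le_rfl))
  have h1 := hm.integral_outputs x y _ hF (C := 1) fun a b ω => by split_ifs <;> simp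
  have h2 : ∀ ω, ∑ a, ∑ b, LFused I J q α (v x y ω) (h x y ω) a b
      * (if (v x y ω : ℕ) + h x y ω = a + b then (0 : ℝ) else 1) = 0 := fun ω => by
    refine Finset.sum_eq_zero fun a _ => Finset.sum_eq_zero fun b _ => ?_
    split_ifs with hab
    · simp
    · rw [LFused_eq_zero hab, zero_mul]
  simp only [h2, integral_zero] at h1
  rw [integral_eq_zero_iff_of_nonneg
    (fun ω => by simp only [Pi.zero_apply]; split_ifs <;> simp)] at h1
  · filter_upwards [h1] with ω hω
    by_contra hne
    simp [hne] at hω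
  · have h1 : Measurable fun z : Fin (I + 1) × Fin (J + 1) × Fin (I + 1) × Fin (J + 1) =>
      if (z.1 : ℕ) + z.2.1 = z.2.2.1 + z.2.2.2 then (0 : ℝ) else 1 := measurable_of_finite _
    have h2 : Measurable fun ω => if (v x y ω : ℕ) + h x y ω = v x (y + 1) ω + h (x + 1) y ω
        then (0 : ℝ) else 1 :=
      h1.comp ((hm.measurable_v x y).prodMk ((hm.measurable_h x y).prodMk
        ((hm.measurable_v x (y + 1)).prodMk (hm.measurable_h (x + 1) y))))
    exact Integrable.of_bound h2.aestronglyMeasurable 1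
      (ae_of_all _ fun ω => by split_ifs <;> simp)

/-! ### Variance of the summed noise -/

/-- The coefficient `1 - b₁` of the discrete telegraph equation, where `b₁` is the weight of
`q ^ (-v)` in the conditional mean of `q ^ (h - v')`. -/
noncomputable def coeffA (J : ℕ) (q α : ℝ) : ℝ := 1 - (1 + α * q ^ J) / (1 + α)

/-- The coefficient `1 - b₂` of the discrete telegraph equation, where
`b₂ = (α + q ^ (-I)) / (1 + α)` is the weight of `q ^ h` in the conditional mean of `q ^ (h - v')`. -/
noncomputable def coeffB (I : ℕ) (q α : ℝ) : ℝ := (1 - (q ^ I)⁻¹) / (1 + α)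

/-- The noise of a vertex is orthogonal to every bounded function of the past. -/
lemma IsModel.integral_mul_noise (hm : IsModel q α μ v h) (hq : 0 < q)
    (hα : ∀ k ≤ J, 1 + α * q ^ k ≠ 0) (x y : ℕ) {G : Ω → ℝ}
    (hG : Measurable[past v h x y] G) {C : ℝ} (hC : ∀ ω, |G ω| ≤ C) :
    ∫ ω, G ω * noise q (coeffA J q α) (coeffB I q α) v h (x, y) ω ∂μ = 0 := by
  obtain ⟨D, hD⟩ := exists_abs_noise_le (v := v) (h := h) hq (coeffA J q α) (coeffB I q α) (x, y)
  have h1 := hm.integral_outputs x y (fun a _ ω => G ω * (expHeight q v h ω x y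
      * vertexNoise q (coeffA J q α) (coeffB I q α) (v x y ω) (h x y ω) a))
    (fun a _ => hG.mul (measurable_noise_output q _ _ x y a)) (C := C * D)
    (fun a _ ω => by
      rw [abs_mul]
      exact mul_le_mul (hC ω) (hD ω a) (abs_nonneg _) ((abs_nonneg _).trans (hC ω)))
  simp only [noise]
  rw [h1]
  have h2 : ∀ ω, ∑ a, ∑ b, LFused I J q α (v x y ω) (h x y ω) a b * (G ω * (expHeight q v h ω x y
      * vertexNoise q (coeffA J q α) (coeffB I q α) (v x y ω) (h x y ω) a)) = 0 := fun ω => by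
    have h3 := sum_LFused_mul_vertexNoise I J hq hα (v x y ω) (h x y ω)
    have h4 := congrArg (fun t => G ω * expHeight q v h ω x y * t) h3
    simp only [Finset.mul_sum, mul_zero] at h4
    rw [← h4]
    refine Finset.sum_congr rfl fun _ _ => Finset.sum_congr rfl fun _ _ => ?_
    simp only [coeffA, coeffB]
    ring
  simp [h2]

/-- A bound on the weighted squares of the local noise bounds its second moment. -/
lemma IsModel.integral_noise_sq_le (hm : IsModel q α μ v h) (hq : 0 < q) {a b : ℝ} (x y : ℕ)
    {K R : ℝ} (hK : ∀ (i i' : Fin (I + 1)) (j j' : Fin (J + 1)),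
      LFused I J q α i j i' j' * vertexNoise q a b i j i' ^ 2 ≤ K) (hK0 : 0 ≤ K)
    (hR : ∀ ω, expHeight q v h ω x y ≤ R) :
    ∫ ω, noise q a b v h (x, y) ω ^ 2 ∂μ ≤ R ^ 2 * ((I + 1) * (J + 1) * K) := by
  obtain ⟨D, hD⟩ := exists_abs_noise_le (v := v) (h := h) hq a b (x, y)
  have h1 := hm.integral_outputs x y (fun i _ ω => (expHeight q v h ω x y
      * vertexNoise q a b (v x y ω) (h x y ω) i) ^ 2)
    (fun i _ => (measurable_noise_output q _ _ x y i).pow_const 2) (C := D ^ 2)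
    (fun i _ ω => by
      rw [abs_pow]
      exact pow_le_pow_left₀ (abs_nonneg _) (hD ω i) 2)
  simp only [noise]
  rw [h1]
  have h2 : ∀ ω, ∑ i, ∑ j, LFused I J q α (v x y ω) (h x y ω) i j * (expHeight q v h ω x y
      * vertexNoise q a b (v x y ω) (h x y ω) i) ^ 2 ≤ R ^ 2 * ((I + 1) * (J + 1) * K) :=
    fun ω => by
    calc _ ≤ ∑ _i : Fin (I + 1), ∑ _j : Fin (J + 1), R ^ 2 * K := by
          refine Finset.sum_le_sum fun i _ => Finset.sum_le_sum fun j _ => ?_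
          have h3 := hK (v x y ω) i (h x y ω) j
          have h4 : expHeight q v h ω x y ^ 2 ≤ R ^ 2 :=
            pow_le_pow_left₀ (expHeight_pos hq ω x y).le (hR ω) 2
          calc _ = expHeight q v h ω x y ^ 2 * (LFused I J q α (v x y ω) (h x y ω) i j
              * vertexNoise q a b (v x y ω) (h x y ω) i ^ 2) := by ring
            _ ≤ expHeight q v h ω x y ^ 2 * K := by gcongr
            _ ≤ R ^ 2 * K := by gcongr
      _ = _ := by simp; ring
  calc _ ≤ ∫ _ω, R ^ 2 * ((I + 1) * (J + 1) * K) ∂μ := by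
        by_cases hint : Integrable (fun ω => ∑ i, ∑ j, LFused I J q α (v x y ω) (h x y ω) i j
            * (expHeight q v h ω x y
              * vertexNoise q a b (v x y ω) (h x y ω) i) ^ 2) μ
        · exact integral_mono hint (integrable_const _) h2
        · rw [integral_undef hint]
          exact integral_nonneg fun _ => by positivity
    _ = _ := by simp

/-- The noise of different vertices is uncorrelated, so the second moments add up. -/
lemma IsModel.integral_sum_noise_sq_le (hm : IsModel q α μ v h) (hq : 0 < q)
    (hα : ∀ k ≤ J, 1 + α * q ^ k ≠ 0) {X Y : ℕ} {K R : ℝ}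
    (hK : ∀ (i i' : Fin (I + 1)) (j j' : Fin (J + 1)), LFused I J q α i j i' j'
      * vertexNoise q (coeffA J q α) (coeffB I q α) i j i' ^ 2 ≤ K) (hK0 : 0 ≤ K)
    (hR : ∀ ω, ∀ x < X, ∀ y < Y, expHeight q v h ω x y ≤ R) :
    ∫ ω, (∑ p ∈ Finset.range X ×ˢ Finset.range Y,
        noise q (coeffA J q α) (coeffB I q α) v h p ω) ^ 2 ∂μ
      ≤ X * Y * (R ^ 2 * ((I + 1) * (J + 1) * K)) := by
  set N := noise q (coeffA J q α) (coeffB I q α) v h with hN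
  have hbd : ∀ p, ∃ C, ∀ ω, |N p ω| ≤ C := fun p => by
    obtain ⟨C, hC⟩ := exists_abs_noise_le (v := v) (h := h) hq (coeffA J q α) (coeffB I q α) p
    exact ⟨C, fun ω => hC ω _⟩
  have hNm : ∀ p, Measurable (N p) := fun p =>
    (measurable_noise_past q _ _ (x := p.1 + p.2 + 1) (y := 0) (Or.inl (by omega))).mono
      (past_le hm.measurable_v hm.measurable_h _ _) le_rfl
  have hint : ∀ p p', Integrable (fun ω => N p ω * N p' ω) μ := fun p p' => by
    obtain ⟨C, hC⟩ := hbd p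
    obtain ⟨C', hC'⟩ := hbd p'
    refine Integrable.of_bound ((hNm p).mul (hNm p')).aestronglyMeasurable (C * C')
      (ae_of_all _ fun ω => ?_)
    rw [Real.norm_eq_abs, abs_mul]
    exact mul_le_mul (hC ω) (hC' ω) (abs_nonneg _) ((abs_nonneg _).trans (hC ω))
  have horth : ∀ p p' : ℕ × ℕ, Precedes p.1 p.2 p'.1 p'.2 → ∫ ω, N p ω * N p' ω ∂μ = 0 :=
    fun p p' hp => by
    obtain ⟨C, hC⟩ := hbd p
    exact hm.integral_mul_noise hq hα p'.1 p'.2 (measurable_noise_past q _ _ hp) hC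
  have horth' : ∀ p p' : ℕ × ℕ, p ≠ p' → ∫ ω, N p ω * N p' ω ∂μ = 0 := fun p p' hne => by
    have htri : Precedes p.1 p.2 p'.1 p'.2 ∨ Precedes p'.1 p'.2 p.1 p.2 := by
      unfold Precedes
      by_contra hcon
      exact hne (Prod.ext (by omega) (by omega))
    rcases htri with hp | hp
    · exact horth p p' hp
    · simp only [mul_comm (N p _)]; exact horth p' p hp
  have h1 : ∀ ω, (∑ p ∈ Finset.range X ×ˢ Finset.range Y, N p ω) ^ 2
      = ∑ p ∈ Finset.range X ×ˢ Finset.range Y, ∑ p' ∈ Finset.range X ×ˢ Finset.range Y,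
        N p ω * N p' ω := fun ω => by rw [sq, Finset.sum_mul_sum]
  simp only [h1]
  rw [integral_finsetSum _ fun p _ => integrable_finsetSum _ fun p' _ => hint p p']
  calc _ ≤ ∑ _p ∈ Finset.range X ×ˢ Finset.range Y, R ^ 2 * ((I + 1) * (J + 1) * K) := by
        refine Finset.sum_le_sum fun p hp => ?_
        rw [integral_finsetSum _ fun p' _ => hint p p', Finset.sum_eq_single p
          (fun p' _ hne => horth' p p' hne.symm) (fun hnot => absurd hp hnot)]
        rw [Finset.mem_product, Finset.mem_range, Finset.mem_range] at hp
        simp only [← sq]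
        exact hm.integral_noise_sq_le hq p.1 p.2 hK hK0 fun ω => hR ω _ hp.1 _ hp.2
    _ = _ := by simp

/-- Chebyshev's inequality for the summed noise. -/
lemma IsModel.measure_sum_noise_le (hm : IsModel q α μ v h) (hq : 0 < q)
    (hα : ∀ k ≤ J, 1 + α * q ^ k ≠ 0) {X Y : ℕ} {K R ε : ℝ} (hε : 0 < ε)
    (hK : ∀ (i i' : Fin (I + 1)) (j j' : Fin (J + 1)), LFused I J q α i j i' j'
      * vertexNoise q (coeffA J q α) (coeffB I q α) i j i' ^ 2 ≤ K) (hK0 : 0 ≤ K)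
    (hR : ∀ ω, ∀ x < X, ∀ y < Y, expHeight q v h ω x y ≤ R) :
    μ {ω | ε ≤ |∑ p ∈ Finset.range X ×ˢ Finset.range Y,
        noise q (coeffA J q α) (coeffB I q α) v h p ω|}
      ≤ ENNReal.ofReal (X * Y * (R ^ 2 * ((I + 1) * (J + 1) * K)) / ε ^ 2) := by
  set S : Ω → ℝ := fun ω => ∑ p ∈ Finset.range X ×ˢ Finset.range Y,
    noise q (coeffA J q α) (coeffB I q α) v h p ω with hS
  have hNm : ∀ p, Measurable (noise q (coeffA J q α) (coeffB I q α) v h p) := fun p =>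
    (measurable_noise_past q _ _ (x := p.1 + p.2 + 1) (y := 0) (Or.inl (by omega))).mono
      (past_le hm.measurable_v hm.measurable_h _ _) le_rfl
  have hbd : ∀ p, ∃ C, ∀ ω, |noise q (coeffA J q α) (coeffB I q α) v h p ω| ≤ C := fun p => by
    obtain ⟨C, hC⟩ := exists_abs_noise_le (v := v) (h := h) hq (coeffA J q α) (coeffB I q α) p
    exact ⟨C, fun ω => hC ω _⟩
  choose C hC using hbd
  have hSm : Measurable S := Finset.measurable_sum _ fun p _ => hNm p
  have hSbd : ∀ ω, |S ω| ≤ ∑ p ∈ Finset.range X ×ˢ Finset.range Y, C p := fun ω =>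
    (Finset.abs_sum_le_sum_abs _ _).trans (Finset.sum_le_sum fun p _ => hC p ω)
  have hSint : Integrable (fun ω => S ω ^ 2) μ := by
    refine Integrable.of_bound (hSm.pow_const 2).aestronglyMeasurable
      ((∑ p ∈ Finset.range X ×ˢ Finset.range Y, C p) ^ 2) (ae_of_all _ fun ω => ?_)
    rw [Real.norm_eq_abs, abs_pow]
    exact pow_le_pow_left₀ (abs_nonneg _) (hSbd ω) 2
  have h1 := mul_meas_ge_le_integral_of_nonneg (ae_of_all _ fun ω => sq_nonneg (S ω)) hSint
    (ε ^ 2)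
  have h2 := h1.trans (hm.integral_sum_noise_sq_le hq hα hK hK0 hR)
  have h3 : {ω | ε ≤ |S ω|} = {ω | ε ^ 2 ≤ S ω ^ 2} := by
    ext ω
    simp only [mem_ofPred_eq]
    rw [sq_le_sq, abs_of_pos hε]
  rw [h3, ← ENNReal.ofReal_toReal (measure_ne_top μ _)]
  refine ENNReal.ofReal_le_ofReal ?_
  rw [le_div_iff₀ (by positivity), mul_comm]
  exact h2

end Noise

/-! ### Stability of the discrete telegraph equation -/

lemma discreteTelegraph_swap (a b : ℝ) (F : ℕ → ℕ → ℝ) (X Y : ℕ) :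
    discreteTelegraph b a (fun x y => F y x) Y X = discreteTelegraph a b F X Y := by
  unfold discreteTelegraph; ring

lemma discreteTelegraph_sub (a b : ℝ) (F G : ℕ → ℕ → ℝ) (X Y : ℕ) :
    discreteTelegraph a b (fun x y => F x y - G x y) X Y
      = discreteTelegraph a b F X Y - discreteTelegraph a b G X Y := by
  simp only [discreteTelegraph, Finset.sum_sub_distrib]; ring

lemma geom_sum_bound {c θ : ℝ} (hθ : θ = 1 + 4 * c) (n : ℕ) :
    4 * c * ∑ k ∈ Finset.range n, θ ^ k ≤ θ ^ n := by
  have h := geom_sum_mul θ n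
  have : θ - 1 = 4 * c := by rw [hθ]; ring
  rw [this] at h
  linarith

/-- A two-dimensional discrete Grönwall inequality. -/
lemma discrete_gronwall {D : ℕ → ℕ → ℝ} {a b c ε : ℝ} (ha : |a| ≤ c) (hb : |b| ≤ c)
    (hε : 0 ≤ ε) {m n : ℕ}
    (hD : ∀ X ≤ m, ∀ Y ≤ n, |D X Y + a * ∑ y ∈ Finset.range Y, D X y
      + b * ∑ x ∈ Finset.range X, D x Y| ≤ ε) {X Y : ℕ} (hX : X ≤ m) (hY : Y ≤ n) :
    |D X Y| ≤ 2 * ε * (1 + 4 * c) ^ (X + Y) := by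
  have hc : 0 ≤ c := (abs_nonneg a).trans ha
  set θ := 1 + 4 * c with hθ
  have hθ1 : 1 ≤ θ := by linarith
  induction hs : X + Y using Nat.strong_induction_on generalizing X Y with
  | _ s ih =>
    have h1 : |∑ y ∈ Finset.range Y, D X y| ≤ 2 * ε * θ ^ X * ∑ y ∈ Finset.range Y, θ ^ y := by
      rw [Finset.mul_sum]
      refine (Finset.abs_sum_le_sum_abs _ _).trans (Finset.sum_le_sum fun y hy => ?_)
      have hy := Finset.mem_range.1 hy
      have := ih (X + y) (by omega) hX (by omega) rfl
      rwa [pow_add, ← mul_assoc] at this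
    have h2 : |∑ x ∈ Finset.range X, D x Y| ≤ 2 * ε * θ ^ Y * ∑ x ∈ Finset.range X, θ ^ x := by
      rw [Finset.mul_sum]
      refine (Finset.abs_sum_le_sum_abs _ _).trans (Finset.sum_le_sum fun x hx => ?_)
      have hx := Finset.mem_range.1 hx
      have := ih (x + Y) (by omega) (by omega) hY rfl
      rwa [add_comm x, pow_add, ← mul_assoc] at this
    have h3 : |a * ∑ y ∈ Finset.range Y, D X y| ≤ ε / 2 * θ ^ s := by
      rw [abs_mul]
      calc _ ≤ c * (2 * ε * θ ^ X * ∑ y ∈ Finset.range Y, θ ^ y) := by gcongr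
        _ = ε / 2 * θ ^ X * (4 * c * ∑ y ∈ Finset.range Y, θ ^ y) := by ring
        _ ≤ ε / 2 * θ ^ X * θ ^ Y := by
          gcongr; exact geom_sum_bound hθ Y
        _ = _ := by rw [← hs, pow_add]; ring
    have h4 : |b * ∑ x ∈ Finset.range X, D x Y| ≤ ε / 2 * θ ^ s := by
      rw [abs_mul]
      calc _ ≤ c * (2 * ε * θ ^ Y * ∑ x ∈ Finset.range X, θ ^ x) := by gcongr
        _ = ε / 2 * θ ^ Y * (4 * c * ∑ x ∈ Finset.range X, θ ^ x) := by ring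
        _ ≤ ε / 2 * θ ^ Y * θ ^ X := by
          gcongr; exact geom_sum_bound hθ X
        _ = _ := by rw [← hs, pow_add]; ring
    have h5 := hD X hX Y hY
    have h6 : ε ≤ ε * θ ^ s := le_mul_of_one_le_right hε (one_le_pow₀ hθ1)
    rw [abs_le] at h3 h4 h5 ⊢
    constructor <;> linarith

/-- Two lattice functions that are close on the axes and whose images under the discrete
telegraph operator are small are close to each other. -/
lemma abs_sub_le_of_discreteTelegraph {F G : ℕ → ℕ → ℝ} {a b c δ κ : ℝ} (ha : |a| ≤ c)
    (hb : |b| ≤ c) {m n : ℕ} (hδ : 0 ≤ δ) (hκ : 0 ≤ κ)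
    (hbottom : ∀ X ≤ m, |F X 0 - G X 0| ≤ δ) (hleft : ∀ Y ≤ n, |F 0 Y - G 0 Y| ≤ δ)
    (hF : ∀ X ≤ m, ∀ Y ≤ n, |discreteTelegraph a b F X Y - discreteTelegraph a b G X Y| ≤ κ)
    {X Y : ℕ} (hX : X ≤ m) (hY : Y ≤ n) :
    |F X Y - G X Y| ≤ 2 * (κ + (3 + c * (m + n)) * δ) * (1 + 4 * c) ^ (m + n) := by
  have hc : 0 ≤ c := (abs_nonneg a).trans ha
  refine (discrete_gronwall (D := fun x y => F x y - G x y) (ε := κ + (3 + c * (m + n)) * δ)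
    ha hb (by positivity) (m := m) (n := n) (fun X hX Y hY => ?_) hX hY).trans ?_
  · have h1 := hF X hX Y hY
    rw [← discreteTelegraph_sub] at h1
    have h2 := hbottom X hX
    have h3 := hleft Y hY
    have h4 := hleft 0 (Nat.zero_le _)
    have h5 : |a * ∑ y ∈ Finset.range Y, (F 0 y - G 0 y)| ≤ c * (n * δ) := by
      rw [abs_mul]
      refine mul_le_mul ha ?_ (abs_nonneg _) hc
      calc _ ≤ ∑ y ∈ Finset.range Y, |F 0 y - G 0 y| := Finset.abs_sum_le_sum_abs _ _
        _ ≤ ∑ _y ∈ Finset.range Y, δ := Finset.sum_le_sum fun y hy =>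
          hleft y ((Finset.mem_range.1 hy).le.trans hY)
        _ = Y * δ := by simp
        _ ≤ n * δ := by gcongr
    have h6 : |b * ∑ x ∈ Finset.range X, (F x 0 - G x 0)| ≤ c * (m * δ) := by
      rw [abs_mul]
      refine mul_le_mul hb ?_ (abs_nonneg _) hc
      calc _ ≤ ∑ x ∈ Finset.range X, |F x 0 - G x 0| := Finset.abs_sum_le_sum_abs _ _
        _ ≤ ∑ _x ∈ Finset.range X, δ := Finset.sum_le_sum fun x hx =>
          hbottom x ((Finset.mem_range.1 hx).le.trans hX)
        _ = X * δ := by simp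
        _ ≤ m * δ := by gcongr
    simp only [discreteTelegraph, Finset.sum_sub_distrib, mul_sub] at h1 h5 h6 ⊢
    rw [abs_le] at *
    constructor <;> linarith
  · gcongr
    linarith

/-- Riemann sums with mesh `1 / L` of a function that oscillates by at most `η` on the mesh
intervals. -/
lemma abs_riemannSum_sub_le {f : ℝ → ℝ} {L η T : ℝ} (hL : 0 < L) (hf : ContinuousOn f (Icc 0 T))
    (hosc : ∀ s ∈ Icc 0 T, ∀ t ∈ Icc 0 T, |s - t| ≤ 1 / L → |f s - f t| ≤ η) {n : ℕ}
    (hn : n / L ≤ T) :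
    |1 / L * ∑ k ∈ Finset.range n, f (k / L) - ∫ t in (0 : ℝ)..(n / L), f t| ≤ η * (n / L) := by
  induction n with
  | zero => simp
  | succ n ih =>
    have hlt : (n : ℝ) / L ≤ ((n + 1 : ℕ) : ℝ) / L := by
      gcongr; exact Nat.le_succ n
    have h0 : 0 ≤ (n : ℝ) / L := by positivity
    have hdiff : ((n + 1 : ℕ) : ℝ) / L - n / L = 1 / L := by push_cast; ring
    have hint : ∀ s t, s ∈ Icc 0 T → t ∈ Icc 0 T → IntervalIntegrable f volume s t :=
      fun s t hs ht => (hf.mono (ordConnected_Icc.uIcc_subset hs ht)).intervalIntegrable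
    have hT : (0 : ℝ) ∈ Icc 0 T := ⟨le_rfl, h0.trans (hlt.trans hn)⟩
    have hn1 : (n : ℝ) / L ∈ Icc 0 T := ⟨h0, hlt.trans hn⟩
    have hn2 : ((n + 1 : ℕ) : ℝ) / L ∈ Icc 0 T := ⟨h0.trans hlt, hn⟩
    have h1 := ih (hlt.trans hn)
    rw [Finset.sum_range_succ, ← intervalIntegral.integral_add_adjacent_intervals
      (hint _ _ hT hn1) (hint _ _ hn1 hn2)]
    have h2 : |1 / L * f (n / L) - ∫ t in ((n : ℝ) / L)..(((n + 1 : ℕ) : ℝ) / L), f t|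
        ≤ η * (1 / L) := by
      have h3 : 1 / L * f (n / L) = ∫ _t in ((n : ℝ) / L)..(((n + 1 : ℕ) : ℝ) / L), f (n / L) := by
        rw [intervalIntegral.integral_const, hdiff, smul_eq_mul]
      rw [h3, ← intervalIntegral.integral_sub (by simp) (hint _ _ hn1 hn2)]
      have h4 := intervalIntegral.norm_integral_le_of_norm_le_const
        (a := (n : ℝ) / L) (b := ((n + 1 : ℕ) : ℝ) / L) (C := η)
        (f := fun t => f (n / L) - f t) (fun t ht => by
          rw [uIoc_of_le hlt] at ht
          refine hosc _ hn1 _ ⟨h0.trans ht.1.le, ht.2.trans hn⟩ ?_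
          rw [abs_sub_comm, abs_of_nonneg (by linarith [ht.1])]
          linarith [ht.2])
      rwa [hdiff, abs_of_pos (by positivity), Real.norm_eq_abs] at h4
    have h5 : η * (((n + 1 : ℕ) : ℝ) / L) = η * (n / L) + η * (1 / L) := by
      rw [← hdiff]; ring
    rw [h5, mul_add]
    rw [abs_le] at *
    constructor <;> linarith

/-- The scaled restriction of a solution of the telegraph equation almost solves the discrete
telegraph equation. -/
lemma abs_discreteTelegraph_le {a b A B a' b' L η η' R : ℝ} {f g : ℝ → ℝ} {u : ℝ → ℝ → ℝ}
    (hu : IsTelegraphSolution a b A B f g u) (hL : 0 < L)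
    (ha : |L * a' - a| ≤ η') (hb : |L * b' - b| ≤ η')
    (hR : ∀ x ∈ Icc 0 A, ∀ y ∈ Icc 0 B, |u x y| ≤ R)
    (hosc : ∀ x ∈ Icc 0 A, ∀ y ∈ Icc 0 B, ∀ x' ∈ Icc 0 A, ∀ y' ∈ Icc 0 B,
      |x - x'| ≤ 1 / L → |y - y'| ≤ 1 / L → |u x y - u x' y'| ≤ η)
    {X Y : ℕ} (hX : X / L ≤ A) (hY : Y / L ≤ B) :
    |discreteTelegraph a' b' (fun x y => u (x / L) (y / L)) X Y|
      ≤ η' * (2 * R * (A + B)) + (|a| * B + |b| * A) * (2 * η) := by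
  have hX0 : 0 ≤ (X : ℝ) / L := by positivity
  have hY0 : 0 ≤ (Y : ℝ) / L := by positivity
  have hA0 : 0 ≤ A := hX0.trans hX
  have hB0 : 0 ≤ B := hY0.trans hY
  have h0A : (0 : ℝ) ∈ Icc 0 A := ⟨le_rfl, hA0⟩
  have h0B : (0 : ℝ) ∈ Icc 0 B := ⟨le_rfl, hB0⟩
  have hXA : (X : ℝ) / L ∈ Icc 0 A := ⟨hX0, hX⟩
  have hYB : (Y : ℝ) / L ∈ Icc 0 B := ⟨hY0, hY⟩
  have hη' : 0 ≤ η' := (abs_nonneg _).trans ha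
  have hη : 0 ≤ η := by
    have := hosc 0 h0A 0 h0B 0 h0A 0 h0B (by simp [hL.le]) (by simp [hL.le])
    exact (abs_nonneg _).trans this
  have hR0 : 0 ≤ R := (abs_nonneg _).trans (hR 0 h0A 0 h0B)
  have hL1 : (0 : ℝ) ≤ 1 / L := by positivity
  -- the two Riemann sums
  have key : ∀ (T c c' : ℝ) (w : ℝ → ℝ) (n : ℕ), 0 ≤ T → ContinuousOn w (Icc 0 T) →
      (∀ s ∈ Icc 0 T, ∀ t ∈ Icc 0 T, |s - t| ≤ 1 / L → |w s - w t| ≤ 2 * η) →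
      (∀ s ∈ Icc 0 T, |w s| ≤ 2 * R) → |L * c' - c| ≤ η' → n / L ≤ T →
      |c' * ∑ k ∈ Finset.range n, w (k / L) - c * ∫ t in (0 : ℝ)..(n / L), w t|
        ≤ η' * (2 * R * T) + |c| * T * (2 * η) := by
    intro T c c' w n hT hw hwosc hwR hc hn
    have h1 := abs_riemannSum_sub_le hL hw hwosc hn
    have h2 : |1 / L * ∑ k ∈ Finset.range n, w (k / L)| ≤ 2 * R * T := by
      rw [abs_mul, abs_of_nonneg hL1]
      calc _ ≤ 1 / L * ∑ _k ∈ Finset.range n, 2 * R := by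
            gcongr
            refine (Finset.abs_sum_le_sum_abs _ _).trans (Finset.sum_le_sum fun k hk => ?_)
            refine hwR _ ⟨by positivity, le_trans ?_ hn⟩
            gcongr
            exact (Finset.mem_range.1 hk).le
        _ = 2 * R * (n / L) := by simp; ring
        _ ≤ 2 * R * T := by gcongr
    have h3 : c' * ∑ k ∈ Finset.range n, w (k / L) - c * ∫ t in (0 : ℝ)..(n / L), w t
        = (L * c' - c) * (1 / L * ∑ k ∈ Finset.range n, w (k / L))
          + c * (1 / L * ∑ k ∈ Finset.range n, w (k / L) - ∫ t in (0 : ℝ)..(n / L), w t) := by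
      field_simp; ring
    rw [h3]
    refine (abs_add_le _ _).trans (add_le_add ?_ ?_)
    · rw [abs_mul]; gcongr
    · rw [abs_mul]
      calc _ ≤ |c| * (2 * η * (n / L)) := by gcongr
        _ ≤ |c| * (2 * η * T) := by gcongr
        _ = _ := by ring
  have hcx : ∀ x ∈ Icc 0 A, ContinuousOn (fun y => u x y) (Icc 0 B) := fun x hx =>
    hu.continuousOn.comp (f := fun y => (x, y)) (by fun_prop) fun y hy => ⟨hx, hy⟩
  have hcy : ∀ y ∈ Icc 0 B, ContinuousOn (fun x => u x y) (Icc 0 A) := fun y hy =>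
    hu.continuousOn.comp (f := fun x => (x, y)) (by fun_prop) fun x hx => ⟨hx, hy⟩
  have h1 := key B a a' (fun y => u (X / L) y - u 0 y) Y hB0 ((hcx _ hXA).sub (hcx _ h0A))
    (fun s hs t ht hst => by
      have e1 := hosc _ hXA s hs _ hXA t ht (by simpa using hL1) hst
      have e2 := hosc _ h0A s hs _ h0A t ht (by simpa using hL1) hst
      rw [abs_le] at *
      constructor <;> linarith)
    (fun s hs => by
      have e1 := hR _ hXA s hs
      have e2 := hR _ h0A s hs
      rw [abs_le] at *
      constructor <;> linarith) ha hY
  have h2 := key A b b' (fun x => u x (Y / L) - u x 0) X hA0 ((hcy _ hYB).sub (hcy _ h0B))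
    (fun s hs t ht hst => by
      have e1 := hosc s hs _ hYB t ht _ hYB hst (by simpa using hL1)
      have e2 := hosc s hs _ h0B t ht _ h0B hst (by simpa using hL1)
      rw [abs_le] at *
      constructor <;> linarith)
    (fun s hs => by
      have e1 := hR s hs _ hYB
      have e2 := hR s hs _ h0B
      rw [abs_le] at *
      constructor <;> linarith) hb hX
  have h3 := hu.equation _ hXA _ hYB
  simp only [discreteTelegraph, Nat.cast_zero, zero_div]
  rw [abs_le] at *
  constructor <;> linarith

/-! ### Passing from a coarse grid to the lattice -/

/-- The discrete telegraph operator maps Lipschitz functions to Lipschitz functions. -/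
lemma abs_discreteTelegraph_succ_sub_le {F : ℕ → ℕ → ℝ} {a b c r : ℝ} (ha : |a| ≤ c)
    (hb : |b| ≤ c) {m n : ℕ} (hFx : ∀ x < m, ∀ y ≤ n, |F (x + 1) y - F x y| ≤ r)
    (hFy : ∀ x ≤ m, ∀ y < n, |F x (y + 1) - F x y| ≤ r) (hr : 0 ≤ r) {X Y : ℕ} (hX : X < m)
    (hY : Y ≤ n) :
    |discreteTelegraph a b F (X + 1) Y - discreteTelegraph a b F X Y| ≤ (2 + 2 * c * n) * r := by
  have hc : 0 ≤ c := (abs_nonneg a).trans ha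
  have h1 := hFx X hX Y hY
  have h2 := hFx X hX 0 (Nat.zero_le _)
  have h3 : |a * ∑ y ∈ Finset.range Y, (F (X + 1) y - F X y)| ≤ c * (n * r) := by
    rw [abs_mul]
    refine mul_le_mul ha ?_ (abs_nonneg _) hc
    calc _ ≤ ∑ y ∈ Finset.range Y, |F (X + 1) y - F X y| := Finset.abs_sum_le_sum_abs _ _
      _ ≤ ∑ _y ∈ Finset.range Y, r := Finset.sum_le_sum fun y hy =>
        hFx X hX y ((Finset.mem_range.1 hy).le.trans hY)
      _ = Y * r := by simp
      _ ≤ n * r := by gcongr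
  have h4 : |b * (F X Y - F X 0)| ≤ c * (n * r) := by
    rw [abs_mul]
    refine mul_le_mul hb ?_ (abs_nonneg _) hc
    rw [← Finset.sum_range_sub (F X)]
    calc _ ≤ ∑ y ∈ Finset.range Y, |F X (y + 1) - F X y| := Finset.abs_sum_le_sum_abs _ _
      _ ≤ ∑ _y ∈ Finset.range Y, r := Finset.sum_le_sum fun y hy =>
        hFy X hX.le y ((Finset.mem_range.1 hy).trans_le hY)
      _ = Y * r := by simp
      _ ≤ n * r := by gcongr
  have h5 : discreteTelegraph a b F (X + 1) Y - discreteTelegraph a b F X Y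
      = (F (X + 1) Y - F X Y) - (F (X + 1) 0 - F X 0)
        + a * ∑ y ∈ Finset.range Y, (F (X + 1) y - F X y) + b * (F X Y - F X 0) := by
    simp only [discreteTelegraph, Finset.sum_range_succ, Finset.sum_sub_distrib]; ring
  rw [h5]
  rw [abs_le] at *
  constructor <;> linarith

lemma abs_sub_le_of_steps {f : ℕ → ℝ} {r : ℝ} {m n : ℕ}
    (h : ∀ k < n, |f (k + 1) - f k| ≤ r) (hmn : m ≤ n) : |f n - f m| ≤ (n - m : ℕ) * r := by
  induction n, hmn using Nat.le_induction with
  | base => simp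
  | succ n hmn ih =>
    have h1 := ih fun k hk => h k (by omega)
    have h2 := h n (Nat.lt_succ_self n)
    rw [Nat.succ_sub hmn]
    push_cast
    rw [abs_le] at *
    constructor <;> linarith

/-- If the discrete telegraph operator applied to a Lipschitz function is small on a grid of
mesh `s`, then it is small everywhere. -/
lemma abs_discreteTelegraph_le_of_grid {F : ℕ → ℕ → ℝ} {a b c r κ : ℝ} (ha : |a| ≤ c)
    (hb : |b| ≤ c) {m n : ℕ} (hFx : ∀ x < m, ∀ y ≤ n, |F (x + 1) y - F x y| ≤ r)
    (hFy : ∀ x ≤ m, ∀ y < n, |F x (y + 1) - F x y| ≤ r) (hr : 0 ≤ r) {s : ℕ} (hs : 0 < s)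
    {X Y : ℕ} (hX : X ≤ m) (hY : Y ≤ n)
    (hgrid : |discreteTelegraph a b F (s * (X / s)) (s * (Y / s))| ≤ κ) :
    |discreteTelegraph a b F X Y| ≤ κ + 2 * s * ((2 + 2 * c * (m + n)) * r) := by
  have hc : 0 ≤ c := (abs_nonneg a).trans ha
  have hX' := Nat.mul_div_le X s
  have hY' := Nat.mul_div_le Y s
  have hXs : X - s * (X / s) ≤ s := by
    have := Nat.div_add_mod X s
    have := Nat.mod_lt X hs
    omega
  have hYs : Y - s * (Y / s) ≤ s := by
    have := Nat.div_add_mod Y s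
    have := Nat.mod_lt Y hs
    omega
  set X' := s * (X / s)
  set Y' := s * (Y / s)
  set t := (2 + 2 * c * (m + n)) * r with ht
  have ht0 : 0 ≤ t := by positivity
  have h1 : |discreteTelegraph a b F X Y - discreteTelegraph a b F X' Y| ≤ s * t := by
    refine (abs_sub_le_of_steps (f := fun k => discreteTelegraph a b F k Y) (r := t)
      (fun k hk => ?_) hX').trans (by gcongr)
    refine (abs_discreteTelegraph_succ_sub_le ha hb hFx hFy hr (hk.trans_le hX) hY).trans ?_
    rw [ht]; gcongr; linarith [Nat.cast_nonneg (α := ℝ) m]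
  have h2 : |discreteTelegraph a b F X' Y - discreteTelegraph a b F X' Y'| ≤ s * t := by
    refine (abs_sub_le_of_steps (f := fun k => discreteTelegraph a b F X' k) (r := t)
      (fun k hk => ?_) hY').trans (by gcongr)
    rw [← discreteTelegraph_swap, ← discreteTelegraph_swap a b F X' k]
    refine (abs_discreteTelegraph_succ_sub_le hb ha (fun y hy x hx => hFy x hx y hy)
      (fun y hy x hx => hFx x hx y hy) hr (hk.trans_le hY) (hX'.trans hX)).trans ?_
    rw [ht]; gcongr; linarith [Nat.cast_nonneg (α := ℝ) n]
  rw [abs_le] at *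
  constructor <;> linarith

/-! ### The telegraph equation: existence and regularity -/

section Primitive

variable {w : ℝ → ℝ → ℝ}

/-- The double primitive of a function of two variables. -/
noncomputable def doublePrimitive (w : ℝ → ℝ → ℝ) (x y : ℝ) : ℝ :=
  ∫ s in (0 : ℝ)..x, ∫ t in (0 : ℝ)..y, w s t

/-- The inner primitive is jointly continuous in the parameter and the upper limit. -/
lemma continuous_inner_primitive (hw : Continuous w.uncurry) {X : Type*} [TopologicalSpace X]
    {f g : X → ℝ} (hf : Continuous f) (hg : Continuous g) :
    Continuous fun z => ∫ t in (0 : ℝ)..g z, w (f z) t :=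
  intervalIntegral.continuous_parametric_intervalIntegral_of_continuous
    (f := fun z t => w (f z) t)
    (hw.comp ((hf.comp continuous_fst).prodMk continuous_snd)) hg

lemma continuous_doublePrimitive (hw : Continuous w.uncurry) :
    Continuous (doublePrimitive w).uncurry :=
  intervalIntegral.continuous_parametric_intervalIntegral_of_continuous
    (f := fun (z : ℝ × ℝ) s => ∫ t in (0 : ℝ)..z.2, w s t)
    (continuous_inner_primitive hw continuous_snd (continuous_snd.comp continuous_fst))
    continuous_fst

lemma doublePrimitive_swap (hw : Continuous w.uncurry) (x y : ℝ) :
    doublePrimitive w x y = doublePrimitive (fun t s => w s t) y x := by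
  refine intervalIntegral_intervalIntegral_swap ?_
  have : IsCompact (uIcc 0 x ×ˢ uIcc 0 y) := isCompact_uIcc.prod isCompact_uIcc
  exact (hw.continuousOn.integrableOn_compact this).mono_set
    (prod_mono uIoc_subset_uIcc uIoc_subset_uIcc)

lemma hasDerivAt_doublePrimitive_left (hw : Continuous w.uncurry) (x y : ℝ) :
    HasDerivAt (fun x => doublePrimitive w x y) (∫ t in (0 : ℝ)..y, w x t) x :=
  ((continuous_inner_primitive hw continuous_id continuous_const).integral_hasStrictDerivAt
    0 x).hasDerivAt

lemma hasDerivAt_doublePrimitive_right (hw : Continuous w.uncurry) (x y : ℝ) :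
    HasDerivAt (fun y => doublePrimitive w x y) (∫ s in (0 : ℝ)..x, w s y) y := by
  simp only [doublePrimitive_swap hw]
  exact hasDerivAt_doublePrimitive_left (w := fun t s => w s t) (hw.comp continuous_swap) y x

end Primitive

lemma integral_exp_mul_le {lam : ℝ} (hlam : 0 < lam) (x : ℝ) :
    ∫ s in (0 : ℝ)..x, Real.exp (lam * s) ≤ Real.exp (lam * x) / lam := by
  have h : ∀ s ∈ uIcc 0 x, HasDerivAt (fun s => Real.exp (lam * s) / lam) (Real.exp (lam * s)) s :=
    fun s _ => by
      refine (((hasDerivAt_id s).const_mul lam).exp.div_const lam).congr_deriv ?_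
      simp [hlam.ne']
  rw [intervalIntegral.integral_eq_sub_of_hasDerivAt h
    (Continuous.intervalIntegrable (by fun_prop) _ _)]
  have : 0 ≤ Real.exp (lam * 0) / lam := by positivity
  linarith

/-- The Goursat problem `w_xy = c w` in integrated form, on a rectangle. The solution is the fixed
point of a contraction for a weighted supremum norm. -/
lemma exists_goursat (c A B : ℝ) (hA : 0 ≤ A) (hB : 0 ≤ B) {G : ℝ → ℝ → ℝ}
    (hG : Continuous G.uncurry) :
    ∃ w : ℝ → ℝ → ℝ, Continuous w.uncurry ∧ ∀ x ∈ Icc 0 A, ∀ y ∈ Icc 0 B,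
      w x y = G x y + c * doublePrimitive w x y := by
  set lam : ℝ := 2 * |c| * B + 1 with hlam
  have hlam0 : 0 < lam := by positivity
  -- the clamps that extend functions from the rectangle to the plane
  set cA : ℝ → ℝ := fun x => projIcc 0 A hA x with hcA
  set cB : ℝ → ℝ := fun y => projIcc 0 B hB y with hcB
  have hcAc : Continuous cA := continuous_subtype_val.comp continuous_projIcc
  have hcBc : Continuous cB := continuous_subtype_val.comp continuous_projIcc
  have hcAm : ∀ x, cA x ∈ Icc 0 A := fun x => (projIcc 0 A hA x).2
  have hcBm : ∀ x, cB x ∈ Icc 0 B := fun x => (projIcc 0 B hB x).2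
  -- the unweighted function and the operator
  set W : BoundedContinuousFunction (ℝ × ℝ) ℝ → ℝ → ℝ → ℝ :=
    fun z s t => Real.exp (lam * s) * z (s, t) with hW
  have hWc : ∀ z, Continuous (W z).uncurry := fun z => by
    have : Continuous fun p : ℝ × ℝ => Real.exp (lam * p.1) * z p := by fun_prop
    exact this
  set H : BoundedContinuousFunction (ℝ × ℝ) ℝ → ℝ × ℝ → ℝ := fun z p =>
    Real.exp (-(lam * p.1)) * (G p.1 p.2 + c * doublePrimitive (W z) p.1 p.2) with hH
  have hHc : ∀ z, Continuous (H z) := fun z => by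
    have h1 : Continuous fun p : ℝ × ℝ => G p.1 p.2 := hG
    have h2 : Continuous fun p : ℝ × ℝ => doublePrimitive (W z) p.1 p.2 :=
      continuous_doublePrimitive (hWc z)
    fun_prop
  have hbd : ∀ z, ∃ C, ∀ p : ℝ × ℝ, ‖H z (cA p.1, cB p.2)‖ ≤ C := fun z => by
    obtain ⟨C, hC⟩ := (isCompact_Icc.prod isCompact_Icc).exists_bound_of_continuousOn
      (s := Icc 0 A ×ˢ Icc 0 B) (hHc z).continuousOn
    exact ⟨C, fun p => hC _ ⟨hcAm _, hcBm _⟩⟩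
  choose C hC using hbd
  set S : BoundedContinuousFunction (ℝ × ℝ) ℝ → BoundedContinuousFunction (ℝ × ℝ) ℝ := fun z =>
    BoundedContinuousFunction.ofNormedAddCommGroup (fun p => H z (cA p.1, cB p.2))
      ((hHc z).comp ((hcAc.comp continuous_fst).prodMk (hcBc.comp continuous_snd))) (C z) (hC z)
    with hS
  have hdiff : ∀ z z' x y, x ∈ Icc 0 A → y ∈ Icc 0 B →
      |H z (x, y) - H z' (x, y)| ≤ 1 / 2 * dist z z' := by
    intro z z' x y hx hy
    have hd : 0 ≤ dist z z' := dist_nonneg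
    have hin : ∀ s, |(∫ t in (0 : ℝ)..y, W z s t) - ∫ t in (0 : ℝ)..y, W z' s t|
        ≤ Real.exp (lam * s) * (B * dist z z') := fun s => by
      have hi : ∀ z, IntervalIntegrable (fun t => W z s t) volume 0 y := fun z =>
        ((hWc z).comp (Continuous.prodMk_right s)).intervalIntegrable _ _
      rw [← intervalIntegral.integral_sub (hi z) (hi z')]
      have h1 := intervalIntegral.norm_integral_le_of_norm_le_const (a := 0) (b := y)
        (f := fun t => W z s t - W z' s t) (C := Real.exp (lam * s) * dist z z') (fun t _ => by
          simp only [hW]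
          rw [← mul_sub, norm_mul, Real.norm_eq_abs, Real.norm_eq_abs, abs_of_pos (Real.exp_pos _)]
          have := BoundedContinuousFunction.dist_coe_le_dist (f := z) (g := z') (s, t)
          rw [Real.dist_eq] at this
          gcongr)
      rw [Real.norm_eq_abs, sub_zero, abs_of_nonneg hy.1] at h1
      calc _ ≤ _ := h1
        _ ≤ Real.exp (lam * s) * dist z z' * B := by gcongr; exact hy.2
        _ = _ := by ring
    have hout : |doublePrimitive (W z) x y - doublePrimitive (W z') x y|
        ≤ Real.exp (lam * x) / lam * (B * dist z z') := by
      have hi : ∀ z, IntervalIntegrable (fun s => ∫ t in (0 : ℝ)..y, W z s t) volume 0 x :=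
        fun z => (continuous_inner_primitive (hWc z) continuous_id
          continuous_const).intervalIntegrable _ _
      unfold doublePrimitive
      rw [← intervalIntegral.integral_sub (hi z) (hi z')]
      have h1 := intervalIntegral.norm_integral_le_of_norm_le (μ := volume) hx.1
        (f := fun s => (∫ t in (0 : ℝ)..y, W z s t) - ∫ t in (0 : ℝ)..y, W z' s t)
        (g := fun s => Real.exp (lam * s) * (B * dist z z'))
        (ae_of_all _ fun s _ => hin s)
        (Continuous.intervalIntegrable (by fun_prop) _ _)
      rw [intervalIntegral.integral_mul_const, Real.norm_eq_abs] at h1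
      refine h1.trans ?_
      gcongr
      exact integral_exp_mul_le hlam0 x
    simp only [hH]
    rw [← mul_sub, abs_mul, abs_of_pos (Real.exp_pos _), add_sub_add_left_eq_sub, ← mul_sub,
      abs_mul]
    calc _ ≤ Real.exp (-(lam * x)) * (|c| * (Real.exp (lam * x) / lam * (B * dist z z'))) := by
          gcongr
      _ = |c| * B / lam * dist z z' := by rw [Real.exp_neg]; field_simp
      _ ≤ 1 / 2 * dist z z' := by
          refine mul_le_mul_of_nonneg_right ?_ hd
          rw [div_le_iff₀ hlam0, hlam]
          linarith
  have hcontr : ContractingWith (1 / 2) S := by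
    refine ⟨by norm_num, LipschitzWith.of_dist_le_mul fun z z' => ?_⟩
    refine (BoundedContinuousFunction.dist_le (by positivity)).2 fun p => ?_
    rw [Real.dist_eq]
    have := hdiff z z' _ _ (hcAm p.1) (hcBm p.2)
    simpa [hS] using this
  set z := ContractingWith.fixedPoint S hcontr
  have hz : S z = z := hcontr.fixedPoint_isFixedPt
  refine ⟨W z, hWc z, fun x hx y hy => ?_⟩
  have h1 : z (x, y) = H z (x, y) := by
    conv_lhs => rw [← hz]
    simp only [hS, BoundedContinuousFunction.coe_ofNormedAddCommGroup, hcA, hcB,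
      projIcc_of_mem hA hx, projIcc_of_mem hB hy]
  simp only [hW]
  rw [h1]
  simp only [hH]
  rw [← mul_assoc, ← Real.exp_add]
  simp [hW]

/-- Existence of a solution of the telegraph equation, with its regularity. The substitution
`w = exp (b x + a y) u` turns the equation into `w_xy = a b w`, so that `w` is the sum of a function
of `x`, a function of `y` and a double primitive. -/
lemma exists_isTelegraphSolution (a b : ℝ) {A B : ℝ} (hA : 0 < A) (hB : 0 < B) {f g : ℝ → ℝ}
    (hf : ContinuousOn f (Icc 0 A)) (hg : ContinuousOn g (Icc 0 B)) (hfg : f 0 = g 0) :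
    ∃ u, IsTelegraphSolution a b A B f g u ∧ ∀ x ∈ Ioo 0 A, ∀ y ∈ Ioo 0 B,
      DifferentiableAt ℝ f x → DifferentiableAt ℝ g y → SatisfiesTelegraphAt a b u x y := by
  -- continuous extensions of the boundary values to the line
  set F : ℝ → ℝ := IccExtend hA.le ((Icc 0 A).domRestrict f) with hF
  set r₀ : ℝ → ℝ := IccExtend hB.le ((Icc 0 B).domRestrict g) with hr₀
  have hFc : Continuous F := (continuousOn_iff_continuous_domRestrict.1 hf).Icc_extend'
  have hr₀c : Continuous r₀ := (continuousOn_iff_continuous_domRestrict.1 hg).Icc_extend'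
  have hFf : ∀ x ∈ Icc 0 A, F x = f x := fun x hx => by
    rw [hF, IccExtend_of_mem _ _ hx]; rfl
  have hrg : ∀ y ∈ Icc 0 B, r₀ y = g y := fun y hy => by
    rw [hr₀, IccExtend_of_mem _ _ hy]; rfl
  have h0A : (0 : ℝ) ∈ Icc 0 A := ⟨le_rfl, hA.le⟩
  have h0B : (0 : ℝ) ∈ Icc 0 B := ⟨le_rfl, hB.le⟩
  have hF0 : F 0 = r₀ 0 := by rw [hFf 0 h0A, hrg 0 h0B, hfg]
  obtain ⟨r, hr⟩ : ∃ r : ℝ → ℝ, r = fun y => Real.exp (a * y) * r₀ y - r₀ 0 := ⟨_, rfl⟩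
  have hrc : Continuous r := by rw [hr]; fun_prop
  obtain ⟨w, hw, hweq⟩ := exists_goursat (a * b) A B hA.le hB.le
    (G := fun x y => Real.exp (b * x) * F x + r y)
    (by
      have : Continuous fun p : ℝ × ℝ => Real.exp (b * p.1) * F p.1 + r p.2 := by fun_prop
      exact this)
  obtain ⟨K, hK⟩ : ∃ K, K = doublePrimitive w := ⟨_, rfl⟩
  have hKc : Continuous fun p : ℝ × ℝ => K p.1 p.2 := by
    rw [hK]; exact continuous_doublePrimitive hw
  have hKx : ∀ x y, HasDerivAt (fun x => K x y) (∫ t in (0 : ℝ)..y, w x t) x := fun x y => by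
    rw [hK]; exact hasDerivAt_doublePrimitive_left hw x y
  have hKy : ∀ x y, HasDerivAt (fun y => K x y) (∫ s in (0 : ℝ)..x, w s y) y := fun x y => by
    rw [hK]; exact hasDerivAt_doublePrimitive_right hw x y
  have hK0 : ∀ x, K x 0 = 0 := fun x => by simp [hK, doublePrimitive]
  have hK0' : ∀ y, K 0 y = 0 := fun x => by simp [hK, doublePrimitive]
  rw [← hK] at hweq
  obtain ⟨u, hu⟩ : ∃ u : ℝ → ℝ → ℝ, u = fun x y =>
    Real.exp (-(b * x)) * Real.exp (-(a * y)) * (Real.exp (b * x) * F x + r y + a * b * K x y) :=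
    ⟨_, rfl⟩
  have huw : ∀ x ∈ Icc 0 A, ∀ y ∈ Icc 0 B,
      u x y = Real.exp (-(b * x)) * Real.exp (-(a * y)) * w x y := fun x hx y hy => by
    rw [hweq x hx y hy, hu]
  have huc : Continuous fun p : ℝ × ℝ => u p.1 p.2 := by rw [hu]; fun_prop
  have hexp : ∀ t : ℝ, Real.exp (-t) * Real.exp t = 1 := fun t => by
    rw [← Real.exp_add]; simp
  have hux0 : ∀ x, u x 0 = F x := fun x => by
    simp only [hu, hr, hK0]
    have := hexp (b * x)
    simp only [mul_zero, neg_zero, Real.exp_zero]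
    linear_combination F x * this
  have hu0y : ∀ y, u 0 y = r₀ y := fun y => by
    simp only [hu, hr, hK0', hF0]
    have := hexp (a * y)
    simp only [mul_zero, neg_zero, Real.exp_zero]
    linear_combination r₀ y * this
  have hexpd : ∀ k t : ℝ, HasDerivAt (fun t => Real.exp (k * t)) (k * Real.exp (k * t)) t :=
    fun k t => by simpa [mul_comm] using ((hasDerivAt_id t).const_mul k).exp
  have hexpd' : ∀ k t : ℝ, HasDerivAt (fun t => Real.exp (-(k * t))) (-k * Real.exp (-(k * t))) t :=
    fun k t => by simpa [mul_comm] using (((hasDerivAt_id t).const_mul k).neg).exp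
  refine ⟨u, ⟨huc.continuousOn, fun x hx => by rw [hux0, hFf x hx],
    fun y hy => by rw [hu0y, hrg y hy], fun X hX Y hY => ?_⟩, fun x hx y hy hfx hgy => ?_⟩
  · obtain ⟨V, hV⟩ : ∃ V, V = doublePrimitive fun s t => Real.exp (-(b * s)) * w s t := ⟨_, rfl⟩
    have hVw : Continuous (fun s t => Real.exp (-(b * s)) * w s t).uncurry := by
      have h1 : Continuous fun p : ℝ × ℝ => w p.1 p.2 := hw
      have : Continuous fun p : ℝ × ℝ => Real.exp (-(b * p.1)) * w p.1 p.2 := by fun_prop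
      exact this
    have hVy : ∀ y, HasDerivAt (fun y => V X y)
        (∫ s in (0 : ℝ)..X, Real.exp (-(b * s)) * w s y) y := fun y => by
      rw [hV]; exact hasDerivAt_doublePrimitive_right hVw X y
    set Q := F X - F 0 + b * ∫ x in (0 : ℝ)..X, F x with hQ
    -- the combination `u(X, y) - u(0, y) + b ∫ u(x, y) dx` is continuously differentiable in `y`
    -- although `u` is not
    have hΦ : ∀ y, u X y - u 0 y + b * ∫ x in (0 : ℝ)..X, u x y
        = Real.exp (-(a * y)) * (Q + a * b * V X y) := fun y => by
      have hn : ∀ x ∈ uIcc 0 X, HasDerivAt (fun x => Real.exp (-(b * x)) * (r y + a * b * K x y))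
          (a * b * (∫ t in (0 : ℝ)..y, Real.exp (-(b * x)) * w x t)
            - b * (Real.exp (-(b * x)) * (r y + a * b * K x y))) x := fun x _ => by
        have := (hexpd' b x).mul (((hKx x y).const_mul (a * b)).const_add (r y))
        refine HasDerivAt.congr_deriv this ?_
        rw [intervalIntegral.integral_const_mul]
        ring
      have hKcy : Continuous fun x => K x y := hKc.comp (Continuous.prodMk_left y)
      have hi1 : IntervalIntegrable (fun x => a * b * ∫ t in (0 : ℝ)..y,
          Real.exp (-(b * x)) * w x t) volume 0 X :=
        (continuous_const.mul (continuous_inner_primitive hVw continuous_id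
          continuous_const)).intervalIntegrable _ _
      have hi2 : IntervalIntegrable (fun x => b * (Real.exp (-(b * x))
          * (r y + a * b * K x y))) volume 0 X :=
        Continuous.intervalIntegrable (by fun_prop) _ _
      have hi3 : IntervalIntegrable (fun x => Real.exp (-(b * x))
          * (r y + a * b * K x y)) volume 0 X :=
        Continuous.intervalIntegrable (by fun_prop) _ _
      have h1 := intervalIntegral.integral_eq_sub_of_hasDerivAt hn (hi1.sub hi2)
      rw [intervalIntegral.integral_sub hi1 hi2, intervalIntegral.integral_const_mul,
        intervalIntegral.integral_const_mul] at h1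
      have h2 : V X y = ∫ x in (0 : ℝ)..X, ∫ t in (0 : ℝ)..y, Real.exp (-(b * x)) * w x t := by
        rw [hV]; rfl
      rw [← h2] at h1
      have h3 : ∀ x, u x y = Real.exp (-(a * y)) * (F x + Real.exp (-(b * x))
          * (r y + a * b * K x y)) := fun x => by
        rw [hu]
        linear_combination Real.exp (-(a * y)) * F x * hexp (b * x)
      simp only [h3]
      rw [intervalIntegral.integral_const_mul, intervalIntegral.integral_add
        (hFc.intervalIntegrable _ _) hi3]
      linear_combination (-Real.exp (-(a * y))) * h1
    have hd : ∀ y ∈ uIcc 0 Y, HasDerivAt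
        (fun y => u X y - u 0 y + b * ∫ x in (0 : ℝ)..X, u x y) (-a * (u X y - u 0 y)) y := by
      intro y hy
      rw [uIcc_of_le hY.1] at hy
      have hyB : y ∈ Icc 0 B := ⟨hy.1, hy.2.trans hY.2⟩
      have h1 : ∫ x in (0 : ℝ)..X, u x y
          = Real.exp (-(a * y)) * ∫ s in (0 : ℝ)..X, Real.exp (-(b * s)) * w s y := by
        rw [← intervalIntegral.integral_const_mul]
        refine intervalIntegral.integral_congr fun x hx => ?_
        rw [uIcc_of_le hX.1] at hx
        rw [huw x ⟨hx.1, hx.2.trans hX.2⟩ y hyB]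
        ring
      have h2 := hΦ y
      rw [h1] at h2
      simp only [hΦ]
      refine HasDerivAt.congr_deriv
        ((hexpd' a y).mul (((hVy y).const_mul (a * b)).const_add Q)) ?_
      linear_combination a * h2
    have h1 := intervalIntegral.integral_eq_sub_of_hasDerivAt hd
      (Continuous.intervalIntegrable (by
        have e1 : Continuous fun y => u X y := huc.comp (Continuous.prodMk_right X)
        have e2 : Continuous fun y => u 0 y := huc.comp (Continuous.prodMk_right 0)
        fun_prop) _ _)
    rw [intervalIntegral.integral_const_mul] at h1
    have hcx : ∀ y, IntervalIntegrable (fun x => u x y) volume 0 X := fun y =>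
      (huc.comp (Continuous.prodMk_left y)).intervalIntegrable _ _
    rw [intervalIntegral.integral_sub (hcx Y) (hcx 0)]
    linear_combination -h1
  · have hFx : HasDerivAt F (deriv f x) x := by
      refine hfx.hasDerivAt.congr_of_eventuallyEq ?_
      filter_upwards [Icc_mem_nhds hx.1 hx.2] with s hs using hFf s hs
    have hr₀y : HasDerivAt r₀ (deriv g y) y := by
      refine hgy.hasDerivAt.congr_of_eventuallyEq ?_
      filter_upwards [Icc_mem_nhds hy.1 hy.2] with s hs using hrg s hs
    have hry : HasDerivAt r (a * Real.exp (a * y) * r₀ y + Real.exp (a * y) * deriv g y) y := by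
      rw [hr]; exact ((hexpd a y).mul hr₀y).sub_const _
    obtain ⟨r', hr'⟩ : ∃ r', HasDerivAt r r' y := ⟨_, hry⟩
    have hux : HasDerivAt (fun s => u s y) (-b * u x y + Real.exp (-(b * x)) * Real.exp (-(a * y))
        * (b * Real.exp (b * x) * F x + Real.exp (b * x) * deriv f x
          + a * b * ∫ t in (0 : ℝ)..y, w x t)) x := by
      rw [hu]
      have := ((hexpd' b x).mul_const (Real.exp (-(a * y)))).mul
        ((((hexpd b x).mul hFx).add_const (r y)).add ((hKx x y).const_mul (a * b)))
      refine HasDerivAt.congr_deriv this ?_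
      simp only [Pi.add_apply, Pi.mul_apply]
      ring
    have huy : ∀ s, HasDerivAt (fun t => u s t) (-a * u s y + Real.exp (-(b * s))
        * Real.exp (-(a * y)) * (r' + a * b * ∫ σ in (0 : ℝ)..s, w σ y)) y := fun s => by
      rw [hu]
      have := ((hexpd' a y).const_mul (Real.exp (-(b * s)))).mul
        ((hr'.const_add (Real.exp (b * s) * F s)).add ((hKy s y).const_mul (a * b)))
      refine HasDerivAt.congr_deriv this ?_
      simp only [Pi.add_apply]
      ring
    have hwy : HasDerivAt (fun s => ∫ σ in (0 : ℝ)..s, w σ y) (w x y) x :=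
      ((hw.comp (Continuous.prodMk_left y)).integral_hasStrictDerivAt 0 x).hasDerivAt
    have huyx := (hux.const_mul (-a)).add
      (((hexpd' b x).mul_const (Real.exp (-(a * y)))).mul ((hwy.const_mul (a * b)).const_add r'))
    have hfun : (fun s => deriv (fun t => u s t) y) = fun s => -a * u s y + Real.exp (-(b * s))
        * Real.exp (-(a * y)) * (r' + a * b * ∫ σ in (0 : ℝ)..s, w σ y) :=
      funext fun s => (huy s).deriv
    refine ⟨hux.differentiableAt, Eventually.of_forall fun s => (huy s).differentiableAt, ?_, ?_⟩
    · rw [hfun]; exact huyx.differentiableAt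
    · rw [hfun, (huy x).deriv, hux.deriv]
      erw [huyx.deriv]
      have := huw x (Ioo_subset_Icc_self hx) y (Ioo_subset_Icc_self hy)
      linear_combination (-a * b) * this

/-! ### The telegraph equation: uniqueness -/

lemma IsTelegraphSolution.continuousOn_right {a b A B : ℝ} {f g : ℝ → ℝ} {u : ℝ → ℝ → ℝ}
    (hu : IsTelegraphSolution a b A B f g u) {x : ℝ} (hx : x ∈ Icc 0 A) :
    ContinuousOn (fun y => u x y) (Icc 0 B) :=
  hu.continuousOn.comp (f := fun y => (x, y)) (by fun_prop) fun _ hy => ⟨hx, hy⟩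

lemma IsTelegraphSolution.continuousOn_left {a b A B : ℝ} {f g : ℝ → ℝ} {u : ℝ → ℝ → ℝ}
    (hu : IsTelegraphSolution a b A B f g u) {y : ℝ} (hy : y ∈ Icc 0 B) :
    ContinuousOn (fun x => u x y) (Icc 0 A) :=
  hu.continuousOn.comp (f := fun x => (x, y)) (by fun_prop) fun _ hx => ⟨hx, hy⟩

/-- Continuous solutions of the telegraph equation are unique: the difference of two solutions is
compared with its maximum in a weighted supremum norm. -/
lemma IsTelegraphSolution.unique {a b A B : ℝ} {f g : ℝ → ℝ} {u u' : ℝ → ℝ → ℝ}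
    (hu : IsTelegraphSolution a b A B f g u) (hu' : IsTelegraphSolution a b A B f g u')
    {x y : ℝ} (hx : x ∈ Icc 0 A) (hy : y ∈ Icc 0 B) : u x y = u' x y := by
  have hA : 0 ≤ A := hx.1.trans hx.2
  have hB : 0 ≤ B := hy.1.trans hy.2
  have h0A : (0 : ℝ) ∈ Icc 0 A := ⟨le_rfl, hA⟩
  have h0B : (0 : ℝ) ∈ Icc 0 B := ⟨le_rfl, hB⟩
  set D : ℝ → ℝ → ℝ := fun x y => u x y - u' x y with hD
  have hD0 : ∀ x ∈ Icc 0 A, D x 0 = 0 := fun x hx => by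
    simp only [hD]; rw [hu.bottom x hx, hu'.bottom x hx, sub_self]
  have hD0' : ∀ y ∈ Icc 0 B, D 0 y = 0 := fun y hy => by
    simp only [hD]; rw [hu.left y hy, hu'.left y hy, sub_self]
  have hint : ∀ {T t : ℝ} {φ : ℝ → ℝ}, ContinuousOn φ (Icc 0 T) → t ∈ Icc 0 T →
      IntervalIntegrable φ volume 0 t := fun hφ ht =>
    (hφ.mono (by rw [uIcc_of_le ht.1]; exact Icc_subset_Icc_right ht.2)).intervalIntegrable
  have hDeq : ∀ X ∈ Icc 0 A, ∀ Y ∈ Icc 0 B, D X Y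
      = -(a * ∫ y in (0 : ℝ)..Y, D X y) - b * ∫ x in (0 : ℝ)..X, D x Y := by
    intro X hX Y hY
    have i1 : ∀ x ∈ Icc 0 A, IntervalIntegrable (fun y => u x y) volume 0 Y :=
      fun x hx => hint (hu.continuousOn_right hx) hY
    have i2 : ∀ x ∈ Icc 0 A, IntervalIntegrable (fun y => u' x y) volume 0 Y :=
      fun x hx => hint (hu'.continuousOn_right hx) hY
    have i3 : ∀ y ∈ Icc 0 B, IntervalIntegrable (fun x => u x y) volume 0 X :=
      fun y hy => hint (hu.continuousOn_left hy) hX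
    have i4 : ∀ y ∈ Icc 0 B, IntervalIntegrable (fun x => u' x y) volume 0 X :=
      fun y hy => hint (hu'.continuousOn_left hy) hX
    have e1 := hu.equation X hX Y hY
    have e2 := hu'.equation X hX Y hY
    have z1 : ∫ y in (0 : ℝ)..Y, D 0 y = 0 := by
      rw [intervalIntegral.integral_congr (g := fun _ => (0 : ℝ)) fun y hy => ?_]
      · simp
      · rw [uIcc_of_le hY.1] at hy
        exact hD0' y ⟨hy.1, hy.2.trans hY.2⟩
    have z2 : ∫ x in (0 : ℝ)..X, D x 0 = 0 := by
      rw [intervalIntegral.integral_congr (g := fun _ => (0 : ℝ)) fun x hx => ?_]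
      · simp
      · rw [uIcc_of_le hX.1] at hx
        exact hD0 x ⟨hx.1, hx.2.trans hX.2⟩
    simp only [hD] at z1 z2 ⊢
    rw [intervalIntegral.integral_sub (i1 _ h0A) (i2 _ h0A)] at z1
    rw [intervalIntegral.integral_sub (i3 _ h0B) (i4 _ h0B)] at z2
    rw [intervalIntegral.integral_sub (i1 _ hX) (i1 _ h0A),
      intervalIntegral.integral_sub (i3 _ hY) (i3 _ h0B)] at e1
    rw [intervalIntegral.integral_sub (i2 _ hX) (i2 _ h0A),
      intervalIntegral.integral_sub (i4 _ hY) (i4 _ h0B)] at e2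
    rw [intervalIntegral.integral_sub (i1 _ hX) (i2 _ hX),
      intervalIntegral.integral_sub (i3 _ hY) (i4 _ hY)]
    have d1 := hD0 X hX
    have d2 := hD0' Y hY
    have d3 := hD0 0 h0A
    simp only [hD] at d1 d2 d3
    linear_combination e1 - e2 + d1 + d2 - d3 + a * z1 + b * z2
  set lam : ℝ := 2 * (|a| + |b|) + 1 with hlam
  have hlam0 : 0 < lam := by positivity
  have hDc : ContinuousOn (fun p : ℝ × ℝ => Real.exp (-(lam * p.1)) * Real.exp (-(lam * p.2))
      * |D p.1 p.2|) (Icc 0 A ×ˢ Icc 0 B) := by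
    have h1 : ContinuousOn (fun p : ℝ × ℝ => D p.1 p.2) (Icc 0 A ×ˢ Icc 0 B) :=
      hu.continuousOn.sub hu'.continuousOn
    exact ContinuousOn.mul (by fun_prop) h1.abs
  obtain ⟨⟨X, Y⟩, ⟨hX, hY⟩, hmax⟩ := (isCompact_Icc.prod isCompact_Icc).exists_isMaxOn
    ⟨(x, y), hx, hy⟩ hDc
  simp only at hX hY
  set m := Real.exp (-(lam * X)) * Real.exp (-(lam * Y)) * |D X Y| with hm
  have hm0 : 0 ≤ m := by positivity
  have hle : ∀ s ∈ Icc 0 A, ∀ t ∈ Icc 0 B,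
      |D s t| ≤ m * Real.exp (lam * t) * Real.exp (lam * s) := by
    intro s hs t ht
    have h1 : Real.exp (-(lam * s)) * Real.exp (-(lam * t)) * |D s t| ≤ m :=
      hmax (mk_mem_prod hs ht)
    rw [Real.exp_neg, Real.exp_neg] at h1
    have e1 := Real.exp_pos (lam * s)
    have e2 := Real.exp_pos (lam * t)
    rw [← mul_inv, inv_mul_le_iff₀ (by positivity)] at h1
    linarith
  have hI1 : |∫ t in (0 : ℝ)..Y, D X t| ≤ m * Real.exp (lam * X) * (Real.exp (lam * Y) / lam) := by
    have h1 := intervalIntegral.norm_integral_le_of_norm_le (μ := volume) hY.1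
      (f := fun t => D X t) (g := fun t => m * Real.exp (lam * X) * Real.exp (lam * t))
      (ae_of_all _ fun t ht => by
        have := hle X hX t ⟨ht.1.le, ht.2.trans hY.2⟩
        rw [Real.norm_eq_abs]; linarith)
      (Continuous.intervalIntegrable (by fun_prop) _ _)
    rw [intervalIntegral.integral_const_mul] at h1
    refine h1.trans ?_
    gcongr
    exact integral_exp_mul_le hlam0 Y
  have hI2 : |∫ s in (0 : ℝ)..X, D s Y| ≤ m * Real.exp (lam * Y) * (Real.exp (lam * X) / lam) := by
    have h1 := intervalIntegral.norm_integral_le_of_norm_le (μ := volume) hX.1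
      (f := fun s => D s Y) (g := fun s => m * Real.exp (lam * Y) * Real.exp (lam * s))
      (ae_of_all _ fun s hs => hle s ⟨hs.1.le, hs.2.trans hX.2⟩ Y hY)
      (Continuous.intervalIntegrable (by fun_prop) _ _)
    rw [intervalIntegral.integral_const_mul] at h1
    refine h1.trans ?_
    gcongr
    exact integral_exp_mul_le hlam0 X
  have hm_le : m ≤ m / 2 := by
    have h1 : |D X Y| ≤ |a| * (m * Real.exp (lam * X) * (Real.exp (lam * Y) / lam))
        + |b| * (m * Real.exp (lam * Y) * (Real.exp (lam * X) / lam)) := by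
      rw [hDeq X hX Y hY]
      refine (abs_sub _ _).trans (add_le_add ?_ ?_)
      · rw [abs_neg, abs_mul]; gcongr
      · rw [abs_mul]; gcongr
    calc m ≤ Real.exp (-(lam * X)) * Real.exp (-(lam * Y))
          * (|a| * (m * Real.exp (lam * X) * (Real.exp (lam * Y) / lam))
            + |b| * (m * Real.exp (lam * Y) * (Real.exp (lam * X) / lam))) := by
          rw [hm]; gcongr
      _ = m * ((|a| + |b|) / lam) := by
          rw [Real.exp_neg, Real.exp_neg]; field_simp
      _ ≤ m * (1 / 2) := by
          refine mul_le_mul_of_nonneg_left ?_ hm0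
          rw [div_le_iff₀ hlam0, hlam]
          linarith
      _ = m / 2 := by ring
  have hmz : m = 0 := by linarith
  have := hle x hx y hy
  rw [hmz] at this
  simp only [zero_mul] at this
  have hz := abs_nonpos_iff.1 this
  simp only [hD] at hz
  linarith

lemma IsTelegraphSolution.congr {a b A B : ℝ} {f g : ℝ → ℝ} {u u' : ℝ → ℝ → ℝ}
    (hu : IsTelegraphSolution a b A B f g u) (hA : 0 ≤ A) (hB : 0 ≤ B)
    (h : ∀ x ∈ Icc 0 A, ∀ y ∈ Icc 0 B, u' x y = u x y) :
    IsTelegraphSolution a b A B f g u' := by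
  have h0A : (0 : ℝ) ∈ Icc 0 A := ⟨le_rfl, hA⟩
  have h0B : (0 : ℝ) ∈ Icc 0 B := ⟨le_rfl, hB⟩
  refine ⟨hu.continuousOn.congr fun p hp => h _ hp.1 _ hp.2, fun x hx => ?_, fun y hy => ?_,
    fun X hX Y hY => ?_⟩
  · rw [h x hx 0 h0B, hu.bottom x hx]
  · rw [h 0 h0A y hy, hu.left y hy]
  · rw [h X hX Y hY, h X hX 0 h0B, h 0 h0A Y hY, h 0 h0A 0 h0B]
    have e1 : ∫ y in (0 : ℝ)..Y, (u' X y - u' 0 y) = ∫ y in (0 : ℝ)..Y, (u X y - u 0 y) := by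
      refine intervalIntegral.integral_congr fun y hy => ?_
      rw [uIcc_of_le hY.1] at hy
      have hy' : y ∈ Icc 0 B := ⟨hy.1, hy.2.trans hY.2⟩
      simp only [h X hX y hy', h 0 h0A y hy']
    have e2 : ∫ x in (0 : ℝ)..X, (u' x Y - u' x 0) = ∫ x in (0 : ℝ)..X, (u x Y - u x 0) := by
      refine intervalIntegral.integral_congr fun x hx => ?_
      rw [uIcc_of_le hX.1] at hx
      have hx' : x ∈ Icc 0 A := ⟨hx.1, hx.2.trans hX.2⟩
      simp only [h x hx' Y hY, h x hx' 0 h0B]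
    rw [e1, e2]
    exact hu.equation X hX Y hY

lemma SatisfiesTelegraphAt.congr {a b A B : ℝ} {u u' : ℝ → ℝ → ℝ} {x y : ℝ}
    (hu : SatisfiesTelegraphAt a b u x y) (hx : x ∈ Ioo 0 A) (hy : y ∈ Ioo 0 B)
    (h : ∀ x ∈ Icc 0 A, ∀ y ∈ Icc 0 B, u' x y = u x y) :
    SatisfiesTelegraphAt a b u' x y := by
  have hx' := Icc_mem_nhds hx.1 hx.2
  have hy' := Icc_mem_nhds hy.1 hy.2
  have e1 : (fun s => u' s y) =ᶠ[𝓝 x] fun s => u s y := by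
    filter_upwards [hx'] with s hs using h s hs y (Ioo_subset_Icc_self hy)
  have e2 : ∀ s ∈ Icc 0 A, (fun t => u' s t) =ᶠ[𝓝 y] fun t => u s t := fun s hs => by
    filter_upwards [hy'] with t ht using h s hs t ht
  have e3 : (fun s => deriv (fun t => u' s t) y) =ᶠ[𝓝 x] fun s => deriv (fun t => u s t) y := by
    filter_upwards [hx'] with s hs using (e2 s hs).deriv_eq
  refine ⟨e1.differentiableAt_iff.2 hu.differentiableAt_x, ?_,
    e3.differentiableAt_iff.2 hu.differentiableAt_xy, ?_⟩
  · filter_upwards [hu.differentiableAt_y, hx'] with s hs hsA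
    exact (e2 s hsA).differentiableAt_iff.2 hs
  · rw [e3.deriv_eq, e1.deriv_eq, (e2 x (Ioo_subset_Icc_self hx)).deriv_eq]
    exact hu.equation

/-! ### Convergence in probability -/

section Probability

variable {ι : Type*} {l : Filter ι} {Ω : ι → Type*} [∀ i, MeasurableSpace (Ω i)]
  {μ : ∀ i, Measure (Ω i)}

lemma abs_exp_sub_exp_le {s t M : ℝ} (hs : s ≤ M) (ht : t ≤ M) :
    |Real.exp s - Real.exp t| ≤ Real.exp M * |s - t| := by
  wlog hst : s ≤ t generalizing s t
  · rw [abs_sub_comm, abs_sub_comm s]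
    exact this ht hs (le_of_not_ge hst)
  have h1 := Real.add_one_le_exp (s - t)
  have h2 : Real.exp s = Real.exp t * Real.exp (s - t) := by rw [← Real.exp_add]; congr 1; ring
  have h3 := Real.exp_le_exp.2 hst
  have h4 := Real.exp_le_exp.2 ht
  have h5 := Real.exp_pos t
  rw [abs_sub_comm, abs_of_nonneg (by linarith), abs_sub_comm, abs_of_nonneg (by linarith)]
  calc _ = Real.exp t * (1 - Real.exp (s - t)) := by rw [h2]; ring
    _ ≤ Real.exp t * (t - s) := mul_le_mul_of_nonneg_left (by linarith) h5.le
    _ ≤ Real.exp M * (t - s) := mul_le_mul_of_nonneg_right h4 (by linarith)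

lemma edist_lt_of_iSup_lt {E : Type*} {F f : E → ℝ} {S : Set E} {ε : ℝ}
    (h : ¬ ENNReal.ofReal ε ≤ ⨆ z ∈ S, edist (F z) (f z)) {z : E} (hz : z ∈ S) :
    |F z - f z| < ε := by
  have h1 : edist (F z) (f z) < ENNReal.ofReal ε :=
    (le_iSup₂ (f := fun z (_ : z ∈ S) => edist (F z) (f z)) z hz).trans_lt (not_le.1 h)
  rw [edist_dist, Real.dist_eq] at h1
  exact (ENNReal.ofReal_lt_ofReal_iff_of_nonneg (abs_nonneg _)).1 h1

/-- To prove uniform convergence in probability it suffices to bound the deviations outside of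
events with vanishing probabilities. -/
lemma TendstoUniformlyOnInProbability.of_forall {E : Type*} {F : ∀ i, Ω i → E → ℝ} {f : E → ℝ}
    {S : Set E}
    (h : ∀ ε : ℝ, 0 < ε → Tendsto (fun i => μ i {ω | ∃ z ∈ S, ε < |F i ω z - f z|}) l (𝓝 0)) :
    TendstoUniformlyOnInProbability μ F f l S := by
  intro ε hε
  obtain ⟨r, hr0, hr⟩ : ∃ r : ℝ, 0 < r ∧ ENNReal.ofReal r < ε := by
    obtain ⟨r, hr0, hr⟩ := ENNReal.lt_iff_exists_nnreal_btwn.1 hε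
    exact ⟨r, by exact_mod_cast hr0, by simpa using hr⟩
  refine tendsto_of_tendsto_of_tendsto_of_le_of_le tendsto_const_nhds (h r hr0)
    (fun _ => zero_le) fun i => measure_mono fun ω hω => ?_
  by_contra hcon
  simp only [mem_ofPred_eq, not_exists, not_and, not_lt] at hcon
  refine absurd hω (not_le.2 (lt_of_le_of_lt (iSup₂_le fun z hz => ?_) hr))
  rw [edist_dist, Real.dist_eq]
  exact ENNReal.ofReal_le_ofReal (hcon z hz)

lemma TendstoUniformlyOnInProbability.exp {F : ∀ i, Ω i → ℝ → ℝ} {φ : ℝ → ℝ} {S : Set ℝ}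
    (h : TendstoUniformlyOnInProbability μ F φ l S) (k M : ℝ) {ρ : ℝ} (hρ : 0 < ρ) :
    Tendsto (fun i => μ i {ω | ∃ x ∈ S, |F i ω x| ≤ M ∧
      ρ < |Real.exp (k * F i ω x) - Real.exp (k * φ x)|}) l (𝓝 0) := by
  set E := Real.exp (|k| * (M + 1)) with hE
  have hE0 : 0 < E := Real.exp_pos _
  set ε : ℝ := min 1 (ρ / (E * (|k| + 1))) with hε
  have hε0 : 0 < ε := by positivity
  refine tendsto_of_tendsto_of_tendsto_of_le_of_le tendsto_const_nhds
    (h (ENNReal.ofReal ε) (ENNReal.ofReal_pos.2 hε0))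
    (fun _ => zero_le) fun i => measure_mono fun ω hω => ?_
  obtain ⟨x, hx, hM, hlt⟩ := hω
  by_contra hcon
  have h1 := edist_lt_of_iSup_lt hcon hx
  have h2 : |F i ω x - φ x| < 1 := h1.trans_le (min_le_left _ _)
  have h3 : |φ x| ≤ M + 1 := by
    rw [abs_le] at hM ⊢; rw [abs_lt] at h2; constructor <;> linarith
  have hle : ∀ t : ℝ, |t| ≤ M + 1 → k * t ≤ |k| * (M + 1) := fun t ht =>
    (le_abs_self _).trans (by rw [abs_mul]; gcongr)
  have h4 := abs_exp_sub_exp_le (hle (F i ω x) (by linarith)) (hle (φ x) h3)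
  rw [← mul_sub, abs_mul] at h4
  have h5 : E * (|k| * |F i ω x - φ x|) ≤ E * ((|k| + 1) * (ρ / (E * (|k| + 1)))) := by
    have := h1.le.trans (min_le_right _ _)
    gcongr
    linarith
  have h6 : E * ((|k| + 1) * (ρ / (E * (|k| + 1)))) = ρ := by
    have : |k| + 1 ≠ 0 := by positivity
    field_simp
  linarith

lemma TendstoUniformlyOnInProbability.eq_zero_of_forall [l.NeBot] [∀ i, IsProbabilityMeasure (μ i)]
    {F : ∀ i, Ω i → ℝ → ℝ} {φ : ℝ → ℝ} {S : Set ℝ}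
    (h : TendstoUniformlyOnInProbability μ F φ l S) {z : ℝ} (hz : z ∈ S)
    (hF : ∀ i ω, F i ω z = 0) : φ z = 0 := by
  by_contra hne
  have h1 := h (ENNReal.ofReal |φ z|) (ENNReal.ofReal_pos.2 (abs_pos.2 hne))
  have h2 : ∀ i, {ω | ENNReal.ofReal |φ z| ≤ ⨆ x ∈ S, edist (F i ω x) (φ x)} = univ := fun i => by
    refine eq_univ_of_forall fun ω => ?_
    by_contra hcon
    have := edist_lt_of_iSup_lt hcon hz
    rw [hF, zero_sub, abs_neg] at this
    exact lt_irrefl _ this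
  simp only [h2, measure_univ] at h1
  exact one_ne_zero (tendsto_nhds_unique tendsto_const_nhds h1)

lemma tendsto_measure_union {S T : ∀ i, Set (Ω i)} (hS : Tendsto (fun i => μ i (S i)) l (𝓝 0))
    (hT : Tendsto (fun i => μ i (T i)) l (𝓝 0)) :
    Tendsto (fun i => μ i (S i ∪ T i)) l (𝓝 0) := by
  have := hS.add hT
  rw [add_zero] at this
  exact tendsto_of_tendsto_of_tendsto_of_le_of_le tendsto_const_nhds this
    (fun _ => zero_le) fun i => measure_union_le _ _

lemma tendsto_measure_mono {S T : ∀ i, Set (Ω i)} (hT : Tendsto (fun i => μ i (T i)) l (𝓝 0))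
    (h : ∀ᶠ i in l, S i ⊆ T i) : Tendsto (fun i => μ i (S i)) l (𝓝 0) :=
  tendsto_of_tendsto_of_tendsto_of_le_of_le' tendsto_const_nhds hT
    (Eventually.of_forall fun _ => zero_le) (h.mono fun _ hi => measure_mono hi)

end Probability

/-! ### Interpolated heights -/

section Height

variable {I J : ℕ} {Ω : Type*} {v : ℕ → ℕ → Ω → Fin (I + 1)} {h : ℕ → ℕ → Ω → Fin (J + 1)}

lemma height_natCast_zero (ω : Ω) (X : ℕ) : height v h ω X 0 = latticeHeight v h ω X 0 := by
  simp [height]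

lemma height_zero_natCast (ω : Ω) (Y : ℕ) : height v h ω 0 Y = latticeHeight v h ω 0 Y := by
  simp [height]

lemma abs_height_sub_le {ω : Ω} (hω : Conserved v h ω) (x y : ℝ) :
    |height v h ω x y - latticeHeight v h ω ⌊x⌋₊ ⌊y⌋₊| ≤ I + J := by
  have hs0 := Int.fract_nonneg x
  have hs1 := (Int.fract_lt_one x).le
  have ht0 := Int.fract_nonneg y
  have ht1 := (Int.fract_lt_one y).le
  set s := Int.fract x
  set t := Int.fract y
  have e1 := latticeHeight_succ_left (v := v) (h := h) ω ⌊x⌋₊ ⌊y⌋₊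
  have e2 := latticeHeight_succ_left (v := v) (h := h) ω ⌊x⌋₊ (⌊y⌋₊ + 1)
  have e3 := latticeHeight_succ_right hω ⌊x⌋₊ ⌊y⌋₊
  have hv : ∀ n, 0 ≤ ((v ⌊x⌋₊ n ω : ℕ) : ℝ) ∧ ((v ⌊x⌋₊ n ω : ℕ) : ℝ) ≤ I := fun n =>
    ⟨Nat.cast_nonneg _, by exact_mod_cast Nat.lt_succ_iff.1 (v ⌊x⌋₊ n ω).2⟩
  have hh : 0 ≤ ((h ⌊x⌋₊ ⌊y⌋₊ ω : ℕ) : ℝ) ∧ ((h ⌊x⌋₊ ⌊y⌋₊ ω : ℕ) : ℝ) ≤ J :=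
    ⟨Nat.cast_nonneg _, by exact_mod_cast Nat.lt_succ_iff.1 (h ⌊x⌋₊ ⌊y⌋₊ ω).2⟩
  have key : height v h ω x y - latticeHeight v h ω ⌊x⌋₊ ⌊y⌋₊
      = t * (h ⌊x⌋₊ ⌊y⌋₊ ω : ℕ) - s * ((1 - t) * (v ⌊x⌋₊ ⌊y⌋₊ ω : ℕ)
        + t * (v ⌊x⌋₊ (⌊y⌋₊ + 1) ω : ℕ)) := by
    simp only [height]
    rw [e2, e1, e3]
    ring
  rw [key]
  obtain ⟨a0, a1⟩ := hv ⌊y⌋₊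
  obtain ⟨b0, b1⟩ := hv (⌊y⌋₊ + 1)
  obtain ⟨c0, c1⟩ := hh
  generalize ((v ⌊x⌋₊ ⌊y⌋₊ ω : ℕ) : ℝ) = a at *
  generalize ((v ⌊x⌋₊ (⌊y⌋₊ + 1) ω : ℕ) : ℝ) = b at *
  generalize ((h ⌊x⌋₊ ⌊y⌋₊ ω : ℕ) : ℝ) = c at *
  have f1 : t * c ≤ J := by nlinarith
  have f2 : 0 ≤ t * c := by positivity
  have f3 : (1 - t) * a + t * b ≤ I := by nlinarith
  have f4 : 0 ≤ (1 - t) * a + t * b := by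
    have : 0 ≤ 1 - t := by linarith
    positivity
  have f5 : s * ((1 - t) * a + t * b) ≤ I := by nlinarith
  have f6 : 0 ≤ s * ((1 - t) * a + t * b) := by positivity
  have f7 : (0 : ℝ) ≤ I := Nat.cast_nonneg _
  have f8 : (0 : ℝ) ≤ J := Nat.cast_nonneg _
  rw [abs_le]
  constructor <;> linarith

lemma abs_expHeight_succ_left_sub_le {q c M : ℝ} (hq : 0 < q) (hc : |Real.log q| ≤ c) (ω : Ω)
    {x y : ℕ} (hM : c * (I * (x + 1) + J * y) ≤ M) :
    |expHeight q v h ω (x + 1) y - expHeight q v h ω x y| ≤ Real.exp M * (c * (I + J)) := by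
  have hc0 : 0 ≤ c := (abs_nonneg _).trans hc
  rw [expHeight_eq_exp hq, expHeight_eq_exp hq]
  have h1 := abs_log_mul_latticeHeight_le (v := v) (h := h) hc ω (x + 1) y
  have h2 := abs_log_mul_latticeHeight_le (v := v) (h := h) hc ω x y
  push_cast at h1
  have h3 : c * (I * x + J * y) ≤ M := by
    refine le_trans ?_ hM
    gcongr; linarith
  refine (abs_exp_sub_exp_le ((le_abs_self _).trans (h1.trans hM))
    ((le_abs_self _).trans (h2.trans h3))).trans ?_
  gcongr
  rw [← mul_sub, abs_mul, latticeHeight_succ_left]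
  have h4 : ((v x y ω : ℕ) : ℝ) ≤ I := by exact_mod_cast Nat.lt_succ_iff.1 (v x y ω).2
  have h5 : |latticeHeight v h ω x y - (v x y ω : ℕ) - latticeHeight v h ω x y| ≤ I + J := by
    rw [sub_sub_cancel_left, abs_neg, abs_of_nonneg (Nat.cast_nonneg _)]
    linarith [Nat.cast_nonneg (α := ℝ) J]
  gcongr

lemma abs_expHeight_succ_right_sub_le {q c M : ℝ} (hq : 0 < q) (hc : |Real.log q| ≤ c) {ω : Ω}
    (hω : Conserved v h ω) {x y : ℕ} (hM : c * (I * x + J * (y + 1)) ≤ M) :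
    |expHeight q v h ω x (y + 1) - expHeight q v h ω x y| ≤ Real.exp M * (c * (I + J)) := by
  have hc0 : 0 ≤ c := (abs_nonneg _).trans hc
  rw [expHeight_eq_exp hq, expHeight_eq_exp hq]
  have h1 := abs_log_mul_latticeHeight_le (v := v) (h := h) hc ω x (y + 1)
  have h2 := abs_log_mul_latticeHeight_le (v := v) (h := h) hc ω x y
  push_cast at h1
  have h3 : c * (I * x + J * y) ≤ M := by
    refine le_trans ?_ hM
    gcongr; linarith
  refine (abs_exp_sub_exp_le ((le_abs_self _).trans (h1.trans hM))
    ((le_abs_self _).trans (h2.trans h3))).trans ?_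
  gcongr
  rw [← mul_sub, abs_mul, latticeHeight_succ_right hω]
  have h4 : ((h x y ω : ℕ) : ℝ) ≤ J := by exact_mod_cast Nat.lt_succ_iff.1 (h x y ω).2
  have h5 : |latticeHeight v h ω x y + (h x y ω : ℕ) - latticeHeight v h ω x y| ≤ I + J := by
    rw [add_sub_cancel_left, abs_of_nonneg (Nat.cast_nonneg _)]
    linarith [Nat.cast_nonneg (α := ℝ) I]
  gcongr

end Height

/-! ### Convergence on the lattice -/

section Lattice

variable {I J : ℕ} {ι : Type*} {l : Filter ι} {L q α : ι → ℝ} {Ω : ι → Type*}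
  [∀ i, MeasurableSpace (Ω i)] {μ : ∀ i, Measure (Ω i)} [∀ i, IsProbabilityMeasure (μ i)]
  {v : ∀ i, ℕ → ℕ → Ω i → Fin (I + 1)} {h : ∀ i, ℕ → ℕ → Ω i → Fin (J + 1)} {A B κ : ℝ}

lemma scaled_height_bound {q L : ℝ} (hL : 0 < L)
    (hlog : |Real.log q| ≤ κ / L) {X Y : ℕ} (hX : X / L ≤ A) (hY : Y / L ≤ B) :
    κ / L * (I * X + J * Y) ≤ κ * (I * A + J * B) := by
  have hκ : 0 ≤ κ := by
    have := (abs_nonneg _).trans hlog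
    rwa [le_div_iff₀ hL, zero_mul] at this
  calc κ / L * (I * X + J * Y) = κ * (I * (X / L) + J * (Y / L)) := by field_simp
    _ ≤ _ := by gcongr

/-- On a grid with boundedly many points the summed noise vanishes in probability. -/
lemma tendsto_measure_noise_grid (hL : Tendsto L l atTop) (hq : ∀ᶠ i in l, 0 < q i)
    (hlog : ∀ᶠ i in l, |Real.log (q i)| ≤ κ / L i)
    (hα : ∀ᶠ i in l, ∀ k ≤ J, 1 + α i * q i ^ k ≠ 0)
    {K : ℝ} (hK0 : 0 ≤ K)
    (hK : ∀ᶠ i in l, ∀ (m m' : Fin (I + 1)) (n n' : Fin (J + 1)),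
      LFused I J (q i) (α i) m n m' n'
        * vertexNoise (q i) (coeffA J (q i) (α i)) (coeffB I (q i) (α i)) m n m' ^ 2
        ≤ K * (L i)⁻¹ ^ 3)
    (hmodel : ∀ᶠ i in l, IsModel (q i) (α i) (μ i) (v i) (h i))
    (hA : 0 ≤ A) (s : ι → ℕ) (N : ℕ) {ρ : ℝ} (hρ : 0 < ρ) :
    Tendsto (fun i => μ i {ω | ∃ k ≤ N, ∃ k' ≤ N, ((s i * k : ℕ) : ℝ) / L i ≤ A ∧
      ((s i * k' : ℕ) : ℝ) / L i ≤ B ∧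
      ρ ≤ |∑ p ∈ Finset.range (s i * k) ×ˢ Finset.range (s i * k'),
        noise (q i) (coeffA J (q i) (α i)) (coeffB I (q i) (α i)) (v i) (h i) p ω|})
      l (𝓝 0) := by
  set T : ∀ i, ℕ × ℕ → Set (Ω i) := fun i z => {ω | ((s i * z.1 : ℕ) : ℝ) / L i ≤ A ∧
      ((s i * z.2 : ℕ) : ℝ) / L i ≤ B ∧
      ρ ≤ |∑ p ∈ Finset.range (s i * z.1) ×ˢ Finset.range (s i * z.2),
        noise (q i) (coeffA J (q i) (α i)) (coeffB I (q i) (α i)) (v i) (h i) p ω|} with hT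
  set R := Real.exp (κ * (I * A + J * B)) with hR
  set C := A * B * R ^ 2 * ((I + 1) * (J + 1) * K) / ρ ^ 2 with hC
  have hTz : ∀ z, Tendsto (fun i => μ i (T i z)) l (𝓝 0) := by
    intro z
    have hlim : Tendsto (fun i => ENNReal.ofReal (C * (L i)⁻¹)) l (𝓝 0) := by
      have h1 := (tendsto_inv_atTop_zero.comp hL).const_mul C
      rw [mul_zero] at h1
      simpa using ENNReal.tendsto_ofReal h1
    refine tendsto_of_tendsto_of_tendsto_of_le_of_le' tendsto_const_nhds hlim
      (Eventually.of_forall fun _ => zero_le) ?_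
    filter_upwards [hL.eventually_gt_atTop 0, hq, hlog, hα, hK, hmodel]
      with i hLi hqi hlogi hαi hKi hmi
    by_cases hX : ((s i * z.1 : ℕ) : ℝ) / L i ≤ A ∧ ((s i * z.2 : ℕ) : ℝ) / L i ≤ B
    · refine (measure_mono fun ω hω => hω.2.2).trans
        ((hmi.measure_sum_noise_le hqi hαi (R := R) hρ hKi (by positivity)
          fun ω x hx y hy => ?_).trans (ENNReal.ofReal_le_ofReal ?_))
      · refine (expHeight_le hqi hlogi ω x y).trans (Real.exp_le_exp.2 ?_)
        refine scaled_height_bound (I := I) (J := J) hLi hlogi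
          (le_trans ?_ hX.1) (le_trans ?_ hX.2) <;> gcongr
      · have e1 : ((s i * z.1 : ℕ) : ℝ) ≤ A * L i := (div_le_iff₀ hLi).1 hX.1
        have e2 : ((s i * z.2 : ℕ) : ℝ) ≤ B * L i := (div_le_iff₀ hLi).1 hX.2
        calc _ ≤ (A * L i) * (B * L i) * (R ^ 2 * ((I + 1) * (J + 1) * (K * (L i)⁻¹ ^ 3)))
              / ρ ^ 2 := by gcongr
          _ = _ := by rw [hC]; field_simp
    · have : T i z = ∅ := eq_empty_of_forall_notMem fun ω hω => hX ⟨hω.1, hω.2.1⟩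
      rw [this, measure_empty]; exact zero_le
  have hsum : Tendsto (fun i => ∑ z ∈ Finset.range (N + 1) ×ˢ Finset.range (N + 1), μ i (T i z)) l
      (𝓝 0) := by
    simpa using tendsto_finsetSum (Finset.range (N + 1) ×ˢ Finset.range (N + 1)) fun z _ => hTz z
  refine tendsto_of_tendsto_of_tendsto_of_le_of_le tendsto_const_nhds hsum
    (fun _ => zero_le) fun i => ?_
  refine (measure_mono ?_).trans (measure_biUnion_finset_le _ _)
  rintro ω ⟨k, hk, k', hk', hω⟩
  simp only [mem_iUnion]
  exact ⟨(k, k'), Finset.mem_product.2 ⟨Finset.mem_range.2 (by omega),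
    Finset.mem_range.2 (by omega)⟩, hω⟩

/-- The restriction of a solution of the telegraph equation to the lattice solves the discrete
equation up to a uniformly small error. -/
lemma eventually_discreteTelegraph_le {a b : ℝ} {f g : ℝ → ℝ} {u : ℝ → ℝ → ℝ} {a' b' : ι → ℝ}
    (hu : IsTelegraphSolution a b A B f g u) (hA : 0 ≤ A) (hB : 0 ≤ B) (hL : Tendsto L l atTop)
    (ha : Tendsto (fun i => L i * a' i) l (𝓝 a)) (hb : Tendsto (fun i => L i * b' i) l (𝓝 b))
    {ρ : ℝ} (hρ : 0 < ρ) :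
    ∀ᶠ i in l, ∀ X Y : ℕ, X / L i ≤ A → Y / L i ≤ B →
      |discreteTelegraph (a' i) (b' i) (fun x y => u (x / L i) (y / L i)) X Y| ≤ ρ := by
  have hcpt : IsCompact (Icc 0 A ×ˢ Icc 0 B) := isCompact_Icc.prod isCompact_Icc
  obtain ⟨R, hR⟩ := hcpt.exists_bound_of_continuousOn hu.continuousOn
  have hR0 : 0 ≤ R := (norm_nonneg _).trans (hR (0, 0) ⟨⟨le_rfl, hA⟩, ⟨le_rfl, hB⟩⟩)
  set D1 := 2 * R * (A + B) + 1 with hD1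
  set D2 := 2 * (|a| * B + |b| * A) + 1 with hD2
  have hD1' : 0 < D1 := by positivity
  have hD2' : 0 < D2 := by positivity
  have hη' : 0 < ρ / 2 / D1 := by positivity
  have hη : 0 < ρ / 2 / D2 := by positivity
  obtain ⟨δ, hδ, hosc⟩ := Metric.uniformContinuousOn_iff.1
    (hcpt.uniformContinuousOn_of_continuous hu.continuousOn) _ hη
  have hinv : ∀ᶠ i in l, 1 / L i < δ := by
    have := (tendsto_inv_atTop_zero.comp hL).eventually_lt_const hδ
    simpa using this
  filter_upwards [hL.eventually_gt_atTop 0, hinv, Metric.tendsto_nhds.1 ha _ hη',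
    Metric.tendsto_nhds.1 hb _ hη'] with i hLi hinvi hai hbi X Y hX hY
  rw [Real.dist_eq] at hai hbi
  refine (abs_discreteTelegraph_le hu hLi hai.le hbi.le (η := ρ / 2 / D2)
    (fun x hx y hy => hR (x, y) ⟨hx, hy⟩) (fun x hx y hy x' hx' y' hy' h1 h2 => ?_) hX hY).trans ?_
  · have := hosc (x, y) ⟨hx, hy⟩ (x', y') ⟨hx', hy'⟩ (by
      rw [Prod.dist_eq]
      exact max_lt (by rw [Real.dist_eq]; linarith) (by rw [Real.dist_eq]; linarith))
    rw [Real.dist_eq] at this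
    exact this.le
  · have e1 : ρ / 2 / D1 * (2 * R * (A + B)) ≤ ρ / 2 / D1 * D1 := by
      gcongr; linarith
    have e2 : (|a| * B + |b| * A) * (2 * (ρ / 2 / D2)) ≤ D2 * (ρ / 2 / D2) := by
      have : (|a| * B + |b| * A) * (2 * (ρ / 2 / D2))
        = (2 * (|a| * B + |b| * A)) * (ρ / 2 / D2) := by ring
      rw [this]
      gcongr; linarith
    rw [div_mul_cancel₀ _ hD1'.ne'] at e1
    rw [mul_div_cancel₀ _ hD2'.ne'] at e2
    linarith

set_option maxHeartbeats 800000 in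
/-- The law of large numbers for `q ^ H` on the lattice. -/
lemma tendsto_measure_lattice {a b : ℝ} {f g : ℝ → ℝ} {u : ℝ → ℝ → ℝ}
    (hu : IsTelegraphSolution a b A B f g u)
    (hA : 0 < A) (hB : 0 < B) (hL : Tendsto L l atTop) (hq : ∀ᶠ i in l, 0 < q i)
    (hlog : ∀ᶠ i in l, |Real.log (q i)| ≤ κ / L i)
    (hα : ∀ᶠ i in l, ∀ k ≤ J, 1 + α i * q i ^ k ≠ 0)
    (ha : Tendsto (fun i => L i * coeffA J (q i) (α i)) l (𝓝 a))
    (hb : Tendsto (fun i => L i * coeffB I (q i) (α i)) l (𝓝 b))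
    {K : ℝ} (hK0 : 0 ≤ K)
    (hK : ∀ᶠ i in l, ∀ (m m' : Fin (I + 1)) (n n' : Fin (J + 1)),
      LFused I J (q i) (α i) m n m' n'
        * vertexNoise (q i) (coeffA J (q i) (α i)) (coeffB I (q i) (α i)) m n m' ^ 2
        ≤ K * (L i)⁻¹ ^ 3)
    (hmodel : ∀ᶠ i in l, IsModel (q i) (α i) (μ i) (v i) (h i))
    (hbottom : ∀ ρ : ℝ, 0 < ρ → Tendsto (fun i => μ i {ω | ∃ X : ℕ, X / L i ≤ A ∧
      ρ < |expHeight (q i) (v i) (h i) ω X 0 - f (X / L i)|}) l (𝓝 0))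
    (hleft : ∀ ρ : ℝ, 0 < ρ → Tendsto (fun i => μ i {ω | ∃ Y : ℕ, Y / L i ≤ B ∧
      ρ < |expHeight (q i) (v i) (h i) ω 0 Y - g (Y / L i)|}) l (𝓝 0))
    {ε : ℝ} (hε : 0 < ε) :
    Tendsto (fun i => μ i {ω | Conserved (v i) (h i) ω ∧ ∃ X Y : ℕ, X / L i ≤ A ∧ Y / L i ≤ B ∧
      ε < |expHeight (q i) (v i) (h i) ω X Y - u (X / L i) (Y / L i)|}) l (𝓝 0) := by
  set c := max |a| |b| + 1 with hc
  have hc0 : 0 < c := by positivity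
  set R := Real.exp (|κ| * (I * A + J * B)) with hR
  have hR0 : 0 < R := Real.exp_pos _
  set E := Real.exp (4 * c * (A + B)) with hE
  have hE0 : 0 < E := Real.exp_pos _
  set D := 2 * (5 + c * (A + B)) * E with hD
  have hD0 : 0 < D := by positivity
  set ρ := ε / D with hρdef
  have hρ : 0 < ρ := by positivity
  set Cr := R * (|κ| * (I + J)) with hCr
  have hCr0 : 0 ≤ Cr := by positivity
  -- the mesh of the grid, relative to `L`
  set σ := ρ / 2 / (2 * ((2 + 2 * c * (A + B)) * Cr) + 1) with hσdef
  have hσ : 0 < σ := by positivity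
  set s : ι → ℕ := fun i => ⌊σ * L i⌋₊ with hs
  set N : ℕ := ⌈2 * (A + B) / σ⌉₊ with hN
  have hnoise := tendsto_measure_noise_grid hL hq hlog hα hK0 hK hmodel (B := B) hA.le s N
    (half_pos hρ)
  refine tendsto_measure_mono (tendsto_measure_union hnoise
    (tendsto_measure_union (hbottom ρ hρ) (hleft ρ hρ))) ?_
  have hac : ∀ᶠ i in l, |L i * coeffA J (q i) (α i)| < c :=
    ha.abs.eventually_lt_const (by rw [hc]; linarith [le_max_left |a| |b|])
  have hbc : ∀ᶠ i in l, |L i * coeffB I (q i) (α i)| < c :=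
    hb.abs.eventually_lt_const (by rw [hc]; linarith [le_max_right |a| |b|])
  have hσL : ∀ᶠ i in l, 2 ≤ σ * L i := (hL.const_mul_atTop hσ).eventually_ge_atTop 2
  filter_upwards [hL.eventually_gt_atTop 0, hq, hlog, hac, hbc, hσL,
    eventually_discreteTelegraph_le hu hA.le hB.le hL ha hb hρ]
    with i hLi hqi hlogi haci hbci hσLi hGi
  rintro ω ⟨hω, X, Y, hX, hY, hlt⟩
  by_contra hcon
  simp only [mem_union, mem_ofPred_eq, not_or, not_exists, not_and, not_le, not_lt] at hcon
  obtain ⟨hn, hbot, hlft⟩ := hcon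
  have hlogi' : |Real.log (q i)| ≤ |κ| / L i := hlogi.trans (by gcongr; exact le_abs_self κ)
  have hci : ∀ t, |L i * t| < c → |t| ≤ c / L i := fun t ht => by
    rw [abs_mul, abs_of_pos hLi] at ht
    rw [le_div_iff₀ hLi]; linarith
  have hai := hci _ haci
  have hbi := hci _ hbci
  set m := ⌊A * L i⌋₊ with hm
  set n := ⌊B * L i⌋₊ with hn'
  have hAL : 0 ≤ A * L i := by positivity
  have hBL : 0 ≤ B * L i := by positivity
  have hmA : ∀ x : ℕ, x ≤ m → (x : ℝ) / L i ≤ A := fun x hx => by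
    rw [div_le_iff₀ hLi]; exact (Nat.le_floor_iff hAL).1 hx
  have hnB : ∀ x : ℕ, x ≤ n → (x : ℝ) / L i ≤ B := fun x hx => by
    rw [div_le_iff₀ hLi]; exact (Nat.le_floor_iff hBL).1 hx
  have hXm : X ≤ m := Nat.le_floor ((div_le_iff₀ hLi).1 hX)
  have hYn : Y ≤ n := Nat.le_floor ((div_le_iff₀ hLi).1 hY)
  have hmn : (c / L i) * (m + n) ≤ c * (A + B) := by
    have e1 := hmA m le_rfl
    have e2 := hnB n le_rfl
    calc _ = c * (m / L i + n / L i) := by field_simp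
      _ ≤ _ := by gcongr
  set F := expHeight (q i) (v i) (h i) ω with hF
  set r := R * (|κ| / L i * (I + J)) with hr
  have hr0 : 0 ≤ r := by positivity
  have hFx : ∀ x < m, ∀ y ≤ n, |F (x + 1) y - F x y| ≤ r := fun x hx y hy => by
    refine abs_expHeight_succ_left_sub_le hqi hlogi' ω ?_
    have := scaled_height_bound (I := I) (J := J) hLi hlogi' (hmA (x + 1) hx) (hnB y hy)
    simpa using this
  have hFy : ∀ x ≤ m, ∀ y < n, |F x (y + 1) - F x y| ≤ r := fun x hx y hy => by
    refine abs_expHeight_succ_right_sub_le hqi hlogi' hω ?_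
    have := scaled_height_bound (I := I) (J := J) hLi hlogi' (hmA x hx) (hnB (y + 1) hy)
    simpa using this
  -- the mesh is positive and the grid has at most `N + 1` points in each direction
  have hs1 : σ * L i / 2 ≤ s i := by
    have := Nat.lt_floor_add_one (σ * L i)
    simp only [hs]; linarith
  have hs2 : (s i : ℝ) ≤ σ * L i := Nat.floor_le (by positivity)
  have hs0 : 0 < s i := by
    have : (0 : ℝ) < s i := by linarith
    exact_mod_cast this
  have hNb : ∀ x : ℕ, x / L i ≤ A + B → x / s i ≤ N := fun x hx => by
    have e1 : ((x / s i : ℕ) : ℝ) ≤ 2 * (A + B) / σ := by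
      refine Nat.cast_div_le.trans ?_
      have hs0' : (0 : ℝ) < s i := by exact_mod_cast hs0
      rw [div_le_div_iff₀ hs0' hσ]
      rw [div_le_iff₀ hLi] at hx
      calc (x : ℝ) * σ ≤ (A + B) * L i * σ := by gcongr
        _ = 2 * (A + B) * (σ * L i / 2) := by ring
        _ ≤ _ := by gcongr
    exact_mod_cast e1.trans (Nat.le_ceil _)
  have hTF : ∀ x ≤ m, ∀ y ≤ n, |discreteTelegraph (coeffA J (q i) (α i)) (coeffB I (q i) (α i))
      F x y| ≤ ρ := fun x hx y hy => by
    have hx' := (Nat.mul_div_le x (s i)).trans hx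
    have hy' := (Nat.mul_div_le y (s i)).trans hy
    have hg := hn (x / s i) (hNb x ((hmA x hx).trans (by linarith))) (y / s i)
      (hNb y ((hnB y hy).trans (by linarith))) (hmA _ hx') (hnB _ hy')
    rw [sum_noise_eq hqi _ _ hω] at hg
    refine (abs_discreteTelegraph_le_of_grid hai hbi hFx hFy hr0 hs0 hx hy hg.le).trans ?_
    have e1 : 2 * (s i : ℝ) * ((2 + 2 * (c / L i) * (m + n)) * r)
        ≤ 2 * (σ * L i) * ((2 + 2 * (c * (A + B))) * r) := by
      have e0 : 2 + 2 * (c / L i) * (m + n) ≤ 2 + 2 * (c * (A + B)) := by linarith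
      exact mul_le_mul (by linarith) (mul_le_mul_of_nonneg_right e0 hr0) (by positivity)
        (by positivity)
    have e2 : 2 * (σ * L i) * ((2 + 2 * (c * (A + B))) * r)
        = σ * (2 * ((2 + 2 * c * (A + B)) * Cr)) := by
      rw [hr, hCr]; field_simp
    have e3 : σ * (2 * ((2 + 2 * c * (A + B)) * Cr)) ≤ ρ / 2 := by
      rw [hσdef, div_mul_eq_mul_div, div_le_iff₀ (by positivity)]
      gcongr
      linarith
    linarith
  have hfin := abs_sub_le_of_discreteTelegraph (F := F) (G := fun x y => u (x / L i) (y / L i))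
    (m := m) (n := n) (δ := ρ) (κ := 2 * ρ) hai hbi hρ.le (by positivity)
    (fun x hx => by
      have := hbot x (hmA x hx)
      simpa [hu.bottom (x / L i) ⟨by positivity, hmA x hx⟩] using this)
    (fun y hy => by
      have := hlft y (hnB y hy)
      simpa [hu.left (y / L i) ⟨by positivity, hnB y hy⟩] using this)
    (fun x hx y hy => by
      have e1 := hTF x hx y hy
      have e2 := hGi x y (hmA x hx) (hnB y hy)
      refine (abs_sub _ _).trans ?_
      linarith) hXm hYn
  have hpow : (1 + 4 * (c / L i)) ^ (m + n) ≤ E := by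
    calc _ ≤ Real.exp (4 * (c / L i)) ^ (m + n) := by
          gcongr
          linarith [Real.add_one_le_exp (4 * (c / L i))]
      _ = Real.exp (4 * (c / L i * (m + n))) := by
          rw [← Real.exp_nat_mul]; congr 1; push_cast; ring
      _ ≤ E := by
          rw [hE]; exact Real.exp_le_exp.2 (by linarith)
  have hlast : 2 * (2 * ρ + (3 + c / L i * (m + n)) * ρ) * (1 + 4 * (c / L i)) ^ (m + n) ≤ ε := by
    have e1 := mul_le_mul_of_nonneg_right hmn hρ.le
    calc _ ≤ 2 * (2 * ρ + (3 + c * (A + B)) * ρ) * E :=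
          mul_le_mul (by linarith) hpow (by positivity) (by positivity)
      _ = ρ * D := by rw [hD]; ring
      _ = ε := div_mul_cancel₀ _ hD0.ne'
  exact absurd hlt (not_lt.2 (hfin.trans hlast))

end Lattice

/-! ### Convergence of the heights -/

/-- The bound of order `L⁻³` on the second moment of the noise, uniformly over the finitely many
local configurations. -/
lemma exists_noise_bound {ι : Type*} {l : Filter ι} {L q α : ι → ℝ} {a b : ι → ℝ} {α₀ : ℝ}
    (hL : Tendsto L l atTop) (hq : Tendsto q l (𝓝 1))
    (hq' : (fun i => q i - 1) =O[l] fun i => (L i)⁻¹)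
    (hα : Tendsto α l (𝓝 α₀)) (hα₀ : 1 + α₀ ≠ 0)
    (ha : a =O[l] fun i => (L i)⁻¹) (hb : b =O[l] fun i => (L i)⁻¹) (I J : ℕ) :
    ∃ K : ℝ, 0 ≤ K ∧ ∀ᶠ i in l, ∀ (m m' : Fin (I + 1)) (n n' : Fin (J + 1)),
      LFused I J (q i) (α i) m n m' n' * vertexNoise (q i) (a i) (b i) m n m' ^ 2
        ≤ K * (L i)⁻¹ ^ 3 := by
  have h1 := fun z : (Fin (I + 1) × Fin (I + 1)) × Fin (J + 1) × Fin (J + 1) =>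
    (isBigO_LFused_mul_vertexNoise_sq hL hq hq' hα hα₀ ha hb I J z.1.1 z.1.2 z.2.1 z.2.2).bound
  choose C hC using h1
  refine ⟨∑ z, |C z|, Finset.sum_nonneg fun _ _ => abs_nonneg _, ?_⟩
  filter_upwards [eventually_all.2 hC, hL.eventually_gt_atTop 0] with i hi hLi m m' n n'
  have h2 := hi ((m, m'), n, n')
  have h3 : |C ((m, m'), n, n')| ≤ ∑ z, |C z| :=
    Finset.single_le_sum (f := fun z => |C z|) (fun _ _ => abs_nonneg _) (Finset.mem_univ _)
  have hL3 : 0 < (L i)⁻¹ ^ 3 := by positivity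
  rw [Real.norm_eq_abs, Real.norm_eq_abs, abs_of_pos hL3] at h2
  calc _ ≤ _ := le_abs_self _
    _ ≤ _ := h2
    _ ≤ _ := by
      gcongr
      exact (le_abs_self _).trans h3

/-- A point of the rectangle and the lattice point below it. -/
lemma floor_div_mem {L x A : ℝ} (hL : 0 < L) (hx : x ∈ Icc 0 A) :
    ((⌊L * x⌋₊ : ℕ) : ℝ) / L ∈ Icc 0 A ∧ |((⌊L * x⌋₊ : ℕ) : ℝ) / L - x| ≤ 1 / L := by
  have h0 : 0 ≤ L * x := mul_nonneg hL.le hx.1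
  have h1 := Nat.floor_le h0
  have h2 := (Nat.lt_floor_add_one (L * x)).le
  have h3 : ((⌊L * x⌋₊ : ℕ) : ℝ) / L ≤ x := by rw [div_le_iff₀ hL]; linarith
  have h4 : x - 1 / L ≤ ((⌊L * x⌋₊ : ℕ) : ℝ) / L := by
    rw [le_div_iff₀ hL, sub_mul, one_div, inv_mul_cancel₀ hL.ne']; linarith
  exact ⟨⟨by positivity, h3.trans hx.2⟩, by
    rw [abs_le]; constructor <;> linarith [one_div_pos.2 hL]⟩

lemma abs_log_sub_log_le {s t m : ℝ} (hm : 0 < m) (hs : m ≤ s) (ht : m ≤ t) :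
    |Real.log s - Real.log t| ≤ |s - t| / m := by
  wlog hst : s ≤ t generalizing s t
  · rw [abs_sub_comm, abs_sub_comm s]
    exact this ht hs (le_of_not_ge hst)
  have hs0 := hm.trans_le hs
  have ht0 := hm.trans_le ht
  have h1 := Real.log_le_log hs0 hst
  have h2 := Real.log_le_sub_one_of_pos (div_pos ht0 hs0)
  rw [Real.log_div ht0.ne' hs0.ne'] at h2
  rw [abs_sub_comm, abs_of_nonneg (by linarith), abs_sub_comm, abs_of_nonneg (by linarith)]
  calc _ ≤ (t - s) / s := by rw [sub_div, div_self hs0.ne']; exact h2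
    _ ≤ (t - s) / m := by
      have : 0 ≤ t - s := by linarith
      gcongr

section Limit

variable {I J : ℕ} {ι : Type*} {l : Filter ι} {L q : ι → ℝ} {Ω : ι → Type*}
  [∀ i, MeasurableSpace (Ω i)] {μ : ∀ i, Measure (Ω i)}
  {v : ∀ i, ℕ → ℕ → Ω i → Fin (I + 1)} {h : ∀ i, ℕ → ℕ → Ω i → Fin (J + 1)} {A B κ : ℝ}
  {u : ℝ → ℝ → ℝ}

/-- The limit of `q ^ H` is bounded below, since the rescaled heights are bounded. -/
lemma le_limit [l.NeBot] [∀ i, IsProbabilityMeasure (μ i)] (hL : Tendsto L l atTop)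
    (hq : ∀ᶠ i in l, 0 < q i) (hlog : ∀ᶠ i in l, |Real.log (q i)| ≤ κ / L i)
    (hcons : ∀ᶠ i in l, ∀ᵐ ω ∂(μ i), Conserved (v i) (h i) ω)
    (huc : ContinuousOn (fun p : ℝ × ℝ => u p.1 p.2) (Icc 0 A ×ˢ Icc 0 B))
    (hlat : ∀ ε : ℝ, 0 < ε → Tendsto (fun i => μ i {ω | Conserved (v i) (h i) ω ∧
      ∃ X Y : ℕ, X / L i ≤ A ∧ Y / L i ≤ B ∧
        ε < |expHeight (q i) (v i) (h i) ω X Y - u (X / L i) (Y / L i)|}) l (𝓝 0))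
    {x y : ℝ} (hx : x ∈ Icc 0 A) (hy : y ∈ Icc 0 B) :
    Real.exp (-(κ * (I * A + J * B))) ≤ u x y := by
  refine le_of_forall_pos_sub_le fun ε hε => ?_
  obtain ⟨δ, hδ, hosc⟩ := Metric.continuousWithinAt_iff.1 (huc (x, y) ⟨hx, hy⟩) (ε / 2)
    (half_pos hε)
  have hinv : ∀ᶠ i in l, 1 / L i < δ := by
    have := (tendsto_inv_atTop_zero.comp hL).eventually_lt_const hδ
    simpa using this
  obtain ⟨i, hLi, hqi, hlogi, hci, hinvi, hi⟩ := ((hL.eventually_gt_atTop 0).and (hq.and (hlog.and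
    (hcons.and (hinv.and ((hlat (ε / 2) (half_pos hε)).eventually_lt_const
      (zero_lt_one (α := ℝ≥0∞)))))))).exists
  obtain ⟨hxm, hxd⟩ := floor_div_mem hLi hx
  obtain ⟨hym, hyd⟩ := floor_div_mem hLi hy
  obtain ⟨ω, hω, hωn⟩ : ∃ ω, Conserved (v i) (h i) ω ∧
      ω ∉ {ω | Conserved (v i) (h i) ω ∧ ∃ X Y : ℕ, X / L i ≤ A ∧ Y / L i ≤ B ∧
        ε / 2 < |expHeight (q i) (v i) (h i) ω X Y - u (X / L i) (Y / L i)|} := by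
    by_contra hcon
    push Not at hcon
    have h1 : (1 : ℝ≥0∞) ≤ μ i {ω | Conserved (v i) (h i) ω ∧ ∃ X Y : ℕ, X / L i ≤ A ∧
        Y / L i ≤ B ∧ ε / 2 < |expHeight (q i) (v i) (h i) ω X Y - u (X / L i) (Y / L i)|} := by
      rw [← measure_univ (μ := μ i)]
      refine measure_mono_ae ?_
      filter_upwards [hci] with ω hω _ using hcon ω hω
    exact absurd hi (not_lt.2 h1)
  have h2 : |expHeight (q i) (v i) (h i) ω ⌊L i * x⌋₊ ⌊L i * y⌋₊
      - u (⌊L i * x⌋₊ / L i) (⌊L i * y⌋₊ / L i)| ≤ ε / 2 := by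
    by_contra hcon
    exact hωn ⟨hω, _, _, hxm.2, hym.2, not_le.1 hcon⟩
  have h3 := hosc (x := (⌊L i * x⌋₊ / L i, ⌊L i * y⌋₊ / L i)) ⟨hxm, hym⟩ (by
    rw [Prod.dist_eq]
    exact max_lt (by rw [Real.dist_eq]; linarith) (by rw [Real.dist_eq]; linarith))
  rw [Real.dist_eq] at h3
  have h4 := le_expHeight (v := v i) (h := h i) hqi hlogi ω ⌊L i * x⌋₊ ⌊L i * y⌋₊
  have h5 := scaled_height_bound (I := I) (J := J) hLi hlogi hxm.2 hym.2
  have h6 := (Real.exp_le_exp.2 (neg_le_neg h5)).trans h4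
  rw [abs_le] at h2
  rw [abs_lt] at h3
  simp only at h3
  linarith

/-- From the convergence of `q ^ H` on the lattice to the convergence of the interpolated and
rescaled height function. -/
lemma tendsto_height {k : ℝ} (hk : k ≠ 0) (hL : Tendsto L l atTop)
    (hq : ∀ᶠ i in l, q i = Real.exp (k / L i))
    (hcons : ∀ᶠ i in l, ∀ᵐ ω ∂(μ i), Conserved (v i) (h i) ω)
    (huc : ContinuousOn (fun p : ℝ × ℝ => u p.1 p.2) (Icc 0 A ×ˢ Icc 0 B))
    {m : ℝ} (hm : 0 < m) (hmu : ∀ x ∈ Icc 0 A, ∀ y ∈ Icc 0 B, m ≤ u x y)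
    (hlat : ∀ ε : ℝ, 0 < ε → Tendsto (fun i => μ i {ω | Conserved (v i) (h i) ω ∧
      ∃ X Y : ℕ, X / L i ≤ A ∧ Y / L i ≤ B ∧
        ε < |expHeight (q i) (v i) (h i) ω X Y - u (X / L i) (Y / L i)|}) l (𝓝 0)) :
    TendstoUniformlyOnInProbability μ
      (fun i ω p => 1 / L i * height (v i) (h i) ω (L i * p.1) (L i * p.2))
      (fun p : ℝ × ℝ => Real.log (u p.1 p.2) / k) l (Icc 0 A ×ˢ Icc 0 B) := by
  refine TendstoUniformlyOnInProbability.of_forall fun ε hε => ?_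
  have hk0 : 0 < |k| := abs_pos.2 hk
  -- `q ^ H` is compared with `u` up to `η`, half of which is left to the oscillation of `u`
  set η := min (m / 2) (ε / 2 * |k| * (m / 2) / 2) with hη
  have hη0 : 0 < η := by positivity
  have hcpt : IsCompact (Icc 0 A ×ˢ Icc 0 B) := isCompact_Icc.prod isCompact_Icc
  obtain ⟨δ, hδ, hosc⟩ := Metric.uniformContinuousOn_iff.1
    (hcpt.uniformContinuousOn_of_continuous huc) η hη0
  have hinv : ∀ r : ℝ, 0 < r → ∀ᶠ i in l, 1 / L i < r := fun r hr => by
    have := (tendsto_inv_atTop_zero.comp hL).eventually_lt_const hr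
    simpa using this
  have hnull : Tendsto (fun i => μ i {ω | ¬ Conserved (v i) (h i) ω}) l (𝓝 0) := by
    refine tendsto_const_nhds.congr' ?_
    filter_upwards [hcons] with i hi using (ae_iff.1 hi).symm
  refine tendsto_measure_mono (tendsto_measure_union hnull (hlat η hη0)) ?_
  have hIJ : (0 : ℝ) < I + J + 1 := by positivity
  filter_upwards [hL.eventually_gt_atTop 0, hq, hinv δ hδ,
    hinv (ε / 2 / (I + J + 1)) (by positivity)]
    with i hLi hqi hinv1 hinv2
  rintro ω ⟨⟨x, y⟩, ⟨hx, hy⟩, hlt⟩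
  by_contra hcon
  simp only [mem_union, mem_ofPred_eq, not_or, not_not, not_and, not_exists, not_lt] at hcon
  obtain ⟨hω, hcon⟩ := hcon
  simp only at hx hy hlt
  obtain ⟨hxm, hxd⟩ := floor_div_mem hLi hx
  obtain ⟨hym, hyd⟩ := floor_div_mem hLi hy
  set X := ⌊L i * x⌋₊
  set Y := ⌊L i * y⌋₊
  have h1 := hcon hω X Y hxm.2 hym.2
  have h2 := hosc (X / L i, Y / L i) ⟨hxm, hym⟩ (x, y) ⟨hx, hy⟩ (by
    rw [Prod.dist_eq]
    exact max_lt (by rw [Real.dist_eq]; linarith) (by rw [Real.dist_eq]; linarith))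
  rw [Real.dist_eq] at h2
  simp only at h2
  have hq0 : 0 < q i := by rw [hqi]; exact Real.exp_pos _
  have hu1 := hmu _ hxm _ hym
  have hu2 := hmu _ hx _ hy
  have hη1 : η ≤ m / 2 := min_le_left _ _
  have hη2 : η ≤ ε / 2 * |k| * (m / 2) / 2 := min_le_right _ _
  have h3 : m / 2 ≤ expHeight (q i) (v i) (h i) ω X Y := by
    rw [abs_le] at h1; linarith
  have h4 : |expHeight (q i) (v i) (h i) ω X Y - u x y| ≤ 2 * η := by
    rw [abs_le] at h1 ⊢; rw [abs_lt] at h2; constructor <;> linarith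
  have h5 := abs_log_sub_log_le (half_pos hm) h3 (by linarith : m / 2 ≤ u x y)
  have h6 : Real.log (expHeight (q i) (v i) (h i) ω X Y)
      = k * (1 / L i * latticeHeight (v i) (h i) ω X Y) := by
    rw [expHeight_eq_exp hq0, Real.log_exp, hqi, Real.log_exp]; ring
  have h7 : |1 / L i * latticeHeight (v i) (h i) ω X Y - Real.log (u x y) / k| ≤ ε / 2 := by
    have e1 : 1 / L i * latticeHeight (v i) (h i) ω X Y - Real.log (u x y) / k
        = (Real.log (expHeight (q i) (v i) (h i) ω X Y) - Real.log (u x y)) / k := by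
      rw [h6]; field_simp
    rw [e1, abs_div, div_le_iff₀ hk0]
    refine h5.trans ?_
    rw [div_le_iff₀ (half_pos hm)]
    linarith
  have h8 : |1 / L i * height (v i) (h i) ω (L i * x) (L i * y)
      - 1 / L i * latticeHeight (v i) (h i) ω X Y| ≤ ε / 2 := by
    rw [← mul_sub, abs_mul, abs_of_pos (one_div_pos.2 hLi)]
    calc _ ≤ 1 / L i * (I + J) :=
          mul_le_mul_of_nonneg_left (abs_height_sub_le hω _ _) (one_div_pos.2 hLi).le
      _ ≤ ε / 2 / (I + J + 1) * (I + J + 1) :=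
          mul_le_mul hinv2.le (by linarith) (by positivity) (by positivity)
      _ = ε / 2 := div_mul_cancel₀ _ hIJ.ne'
  rw [abs_le] at h7 h8
  have h9 : |1 / L i * height (v i) (h i) ω (L i * x) (L i * y) - Real.log (u x y) / k| ≤ ε := by
    rw [abs_le]; constructor <;> linarith
  linarith

end Limit

end SHS6V

theorem theorem1p6 (I J : ℕ) (hI : 1 ≤ I) (hJ : 1 ≤ J)
    (β₁ β₂ : ℝ) (hβ₁ : 0 < β₁) (hβ₂ : 0 < β₂) (hβ : β₁ ≠ β₂)
    (A B : ℝ) (hA : 0 < A) (hB : 0 < B)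
    -- the boundary profiles
    (χ ψ : ℝ → ℝ)
    (hχ_mono : MonotoneOn χ (Icc 0 A) ∨ AntitoneOn χ (Icc 0 A))
    (hψ_mono : MonotoneOn ψ (Icc 0 B) ∨ AntitoneOn ψ (Icc 0 B))
    (hχ_lip : ∃ K, LipschitzOnWith K χ (Icc 0 A))
    (hψ_lip : ∃ K, LipschitzOnWith K ψ (Icc 0 B))
    -- the scaling parameter tends to infinity along a sequence or a continuous family
    {ι : Type*} (l : Filter ι) [l.NeBot] [l.IsCountablyGenerated]
    (L q α : ι → ℝ) (hL : Tendsto L l atTop)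
    (hq : ∀ᶠ i in l, q i = Real.exp ((β₁ - β₂) / L i))
    (hα : ∀ᶠ i in l, (1 + α i * q i ^ J) / (1 + α i) = Real.exp (-(J * β₂) / L i))
    -- the model for each value of the scaling parameter
    {Ω : ι → Type*} [∀ i, MeasurableSpace (Ω i)] (μ : ∀ i, Measure (Ω i))
    [∀ i, IsProbabilityMeasure (μ i)]
    (v : ∀ i, ℕ → ℕ → Ω i → Fin (I + 1)) (h : ∀ i, ℕ → ℕ → Ω i → Fin (J + 1))
    (hmodel : ∀ᶠ i in l, SHS6V.IsModel (q i) (α i) (μ i) (v i) (h i))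
    -- convergence of the boundary heights
    (hbottom : SHS6V.TendstoUniformlyOnInProbability μ
      (fun i ω x => 1 / L i * SHS6V.height (v i) (h i) ω (L i * x) 0) χ l (Icc 0 A))
    (hleft : SHS6V.TendstoUniformlyOnInProbability μ
      (fun i ω y => 1 / L i * SHS6V.height (v i) (h i) ω 0 (L i * y)) ψ l (Icc 0 B)) :
    ∃ hlim : ℝ → ℝ → ℝ,
      -- the exponential of the limit shape solves the telegraph equation
      SHS6V.IsTelegraphSolution (J * β₂) (I * β₁) A B
        (fun x => Real.exp (β₁ - β₂) ^ χ x) (fun y => Real.exp (β₁ - β₂) ^ ψ y)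
        (fun x y => Real.exp (β₁ - β₂) ^ hlim x y) ∧
      -- also pointwise, wherever the boundary profiles are differentiable
      (∀ x ∈ Ioo 0 A, ∀ y ∈ Ioo 0 B, DifferentiableAt ℝ χ x → DifferentiableAt ℝ ψ y →
        SHS6V.SatisfiesTelegraphAt (J * β₂) (I * β₁)
          (fun x y => Real.exp (β₁ - β₂) ^ hlim x y) x y) ∧
      -- it is the unique solution
      (∀ u : ℝ → ℝ → ℝ,
        SHS6V.IsTelegraphSolution (J * β₂) (I * β₁) A B
          (fun x => Real.exp (β₁ - β₂) ^ χ x) (fun y => Real.exp (β₁ - β₂) ^ ψ y) u →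
        ∀ x ∈ Icc 0 A, ∀ y ∈ Icc 0 B, u x y = Real.exp (β₁ - β₂) ^ hlim x y) ∧
      -- the rescaled height function converges to the limit shape
      SHS6V.TendstoUniformlyOnInProbability μ
        (fun i ω p => 1 / L i * SHS6V.height (v i) (h i) ω (L i * p.1) (L i * p.2))
        (fun p : ℝ × ℝ => hlim p.1 p.2) l (Icc 0 A ×ˢ Icc 0 B) := by
  obtain ⟨k, hk⟩ : ∃ k, k = β₁ - β₂ := ⟨_, rfl⟩
  have hk0 : k ≠ 0 := by rw [hk]; exact sub_ne_zero.2 hβ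
  have hrpow : ∀ t : ℝ, Real.exp (β₁ - β₂) ^ t = Real.exp (k * t) := fun t => by
    rw [hk, Real.exp_mul]
  simp only [hrpow]
  rw [← hk] at hq
  -- the scaling of the parameters
  have hL0 := hL.eventually_gt_atTop 0
  have hq1 : Tendsto q l (𝓝 1) :=
    (SHS6V.tendsto_exp_div hL k).congr' (hq.mono fun i hi => hi.symm)
  have hqO : (fun i => q i - 1) =O[l] fun i => (L i)⁻¹ :=
    SHS6V.isBigO_inv_of_tendsto_mul hL (by simpa using SHS6V.tendsto_mul_pow_sub_one hL hq 1)
  have hαlim := SHS6V.tendsto_spectral hJ hβ₁ hL (hk ▸ hq) hα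
  have hα₀ : 1 + -β₂ / β₁ ≠ 0 := by
    have : 1 + -β₂ / β₁ = (β₁ - β₂) / β₁ := by field_simp; ring
    rw [this]; exact div_ne_zero (sub_ne_zero.2 hβ) hβ₁.ne'
  have ha : Tendsto (fun i => L i * SHS6V.coeffA J (q i) (α i)) l (𝓝 (J * β₂)) :=
    SHS6V.tendsto_mul_one_sub_b₁ hL hα
  have hb : Tendsto (fun i => L i * SHS6V.coeffB I (q i) (α i)) l (𝓝 (I * β₁)) :=
    SHS6V.tendsto_mul_one_sub_b₂ hJ hβ₁ hβ hL (hk ▸ hq) hα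
  obtain ⟨K, hK0, hK⟩ := SHS6V.exists_noise_bound hL hq1 hqO hαlim hα₀
    (SHS6V.isBigO_inv_of_tendsto_mul hL ha) (SHS6V.isBigO_inv_of_tendsto_mul hL hb) I J
  have hαne : ∀ᶠ i in l, ∀ j ≤ J, 1 + α i * q i ^ j ≠ 0 := by
    have h1 : ∀ᶠ i in l, ∀ j : Fin (J + 1), 1 + α i * q i ^ (j : ℕ) ≠ 0 := eventually_all.2
      fun j => (SHS6V.tendsto_one_add_mul_pow hq1 hαlim j).eventually_ne hα₀
    filter_upwards [h1] with i hi j hj using hi ⟨j, Nat.lt_succ_of_le hj⟩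
  have hqpos : ∀ᶠ i in l, 0 < q i := hq.mono fun i hi => hi ▸ Real.exp_pos _
  have hlog : ∀ᶠ i in l, |Real.log (q i)| ≤ |k| / L i := by
    filter_upwards [hq, hL0] with i hi hLi
    rw [hi, Real.log_exp, abs_div, abs_of_pos hLi]
  have hcons : ∀ᶠ i in l, ∀ᵐ ω ∂(μ i), SHS6V.Conserved (v i) (h i) ω :=
    hmodel.mono fun i hi => hi.ae_conserved
  -- the limiting boundary values
  have hχ0 : χ 0 = 0 := hbottom.eq_zero_of_forall ⟨le_rfl, hA.le⟩ fun i ω => by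
    simp [SHS6V.height, SHS6V.latticeHeight]
  have hψ0 : ψ 0 = 0 := hleft.eq_zero_of_forall ⟨le_rfl, hB.le⟩ fun i ω => by
    simp [SHS6V.height, SHS6V.latticeHeight]
  obtain ⟨Kχ, hKχ⟩ := hχ_lip
  obtain ⟨Kψ, hKψ⟩ := hψ_lip
  obtain ⟨u, hu, hu'⟩ := SHS6V.exists_isTelegraphSolution (J * β₂) (I * β₁) hA hB
    (f := fun x => Real.exp (k * χ x)) (g := fun y => Real.exp (k * ψ y))
    (by have := hKχ.continuousOn; fun_prop) (by have := hKψ.continuousOn; fun_prop)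
    (by simp only [hχ0, hψ0])
  have hexp : ∀ᶠ i in l, ∀ ω X Y, SHS6V.expHeight (q i) (v i) (h i) ω X Y
      = Real.exp (k * (1 / L i * SHS6V.latticeHeight (v i) (h i) ω X Y)) := by
    filter_upwards [hq, hqpos] with i hi hqi ω X Y
    rw [SHS6V.expHeight_eq_exp hqi, hi, Real.log_exp]
    congr 1; ring
  have hlat := fun (ε : ℝ) (hε : 0 < ε) => SHS6V.tendsto_measure_lattice (μ := μ) (v := v) (h := h)
    hu hA hB hL hqpos hlog hαne ha hb hK0 hK hmodel
    (fun ρ hρ => by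
      refine SHS6V.tendsto_measure_mono (hbottom.exp k (I * A) hρ) ?_
      filter_upwards [hL0, hexp] with i hLi hei
      rintro ω ⟨X, hX, hlt⟩
      have hXL : L i * (X / L i) = X := mul_div_cancel₀ _ hLi.ne'
      refine ⟨X / L i, ⟨by positivity, hX⟩, ?_, ?_⟩
      · simp only [hXL, SHS6V.height_natCast_zero]
        have h1 := SHS6V.abs_latticeHeight_le (v := v i) (h := h i) ω X 0
        rw [abs_mul, abs_of_pos (one_div_pos.2 hLi)]
        calc _ ≤ 1 / L i * (I * X + J * (0 : ℕ)) := by gcongr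
          _ = I * (X / L i) := by push_cast; ring
          _ ≤ I * A := by gcongr
      · simp only [hXL, SHS6V.height_natCast_zero]
        rwa [hei] at hlt)
    (fun ρ hρ => by
      refine SHS6V.tendsto_measure_mono (hleft.exp k (J * B) hρ) ?_
      filter_upwards [hL0, hexp] with i hLi hei
      rintro ω ⟨Y, hY, hlt⟩
      have hYL : L i * (Y / L i) = Y := mul_div_cancel₀ _ hLi.ne'
      refine ⟨Y / L i, ⟨by positivity, hY⟩, ?_, ?_⟩
      · simp only [hYL, SHS6V.height_zero_natCast]
        have h1 := SHS6V.abs_latticeHeight_le (v := v i) (h := h i) ω 0 Y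
        rw [abs_mul, abs_of_pos (one_div_pos.2 hLi)]
        calc _ ≤ 1 / L i * (I * (0 : ℕ) + J * Y) := by gcongr
          _ = J * (Y / L i) := by push_cast; ring
          _ ≤ J * B := by gcongr
      · simp only [hYL, SHS6V.height_zero_natCast]
        rwa [hei] at hlt)
    hε
  have hlow : ∀ x ∈ Icc 0 A, ∀ y ∈ Icc 0 B, Real.exp (-(|k| * (I * A + J * B))) ≤ u x y :=
    fun x hx y hy => SHS6V.le_limit hL hqpos hlog hcons hu.continuousOn hlat hx hy
  have hulog : ∀ x ∈ Icc 0 A, ∀ y ∈ Icc 0 B,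
      Real.exp (k * (Real.log (u x y) / k)) = u x y := fun x hx y hy => by
    rw [mul_div_cancel₀ _ hk0, Real.exp_log ((Real.exp_pos _).trans_le (hlow x hx y hy))]
  refine ⟨fun x y => Real.log (u x y) / k, hu.congr hA.le hB.le hulog,
    fun x hx y hy hχx hψy => (hu' x hx y hy ?_ ?_).congr hx hy hulog,
    fun u' hu'' x hx y hy => ?_, ?_⟩
  · exact (hχx.const_mul k).exp
  · exact (hψy.const_mul k).exp
  · rw [hulog x hx y hy]; exact hu''.unique hu hx hy
  · exact SHS6V.tendsto_height hk0 hL hq hcons hu.continuousOn (Real.exp_pos _) hlow hlat
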